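/- Let $0\le d<m$ be integers. "Generic" means: outside the zero set of some nonzero polynomial in the coordinates of the data. For $A\in\mathbb R^{d\times m}$, $b\in\mathbb R^d$, $c\in\mathbb R^m$ consider the linear program of minimizing $cx$ subject to $Ax=b$, $x\ge 0$. Its central path is defined if for every $\lambda>0$ the system $$c-\lambda\Bigl(\tfrac1{x_1},\dots,\tfrac1{x_m}\Bigr)-y^tA=0,\qquad Ax=b,\qquad x>0$$ has a unique solution $(x^*(\lambda),y^*(\lambda))\in\mathbb R^m\times\mathbb R^d$. In that case the central curve $\mathcal C_{LP}(c,A,b)\subset\mathbb C^m$ is the projection to $\mathbb C^m$ of the Zariski closure in $\mathbb C^m\times\mathbb C^d$ of $\{(x^*(\lambda),y^*(\lambda)):\lambda>0\}$, and its degree is the number of points in which it meets a generic affine hyperplane of $\mathbb C^m$. Let $\psi_{LP}(m,d)$ denote the degree of $\mathcal C_{LP}(c,A,b)$ for generic $A,b,c$ whose central path is defined. For a linear space $\mathcal L$ of real symmetric $m\times m$ matrices, the ML degree of the linear concentration model of $\mathcal L$ is the number of complex symmetric matrices $\Sigma$ such that $$\Sigma K=\mathrm{Id}_m \text{ for some }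 K\in\mathcal L\otimes\mathbb C,\qquad \mathrm{Tr}\bigl((\Sigma-S)M\bigr)=0\ \text{ for all } M\in\mathcal L,$$ where $S$ is a generic real symmetric matrix. Let $\phi_{\mathrm{diag}}(m,r)$ denote the ML degree of the model of the span of $r$ generic real diagonal $m\times m$ matrices. Then $\psi_{LP}(m,d)$ and $\phi_{\mathrm{diag}}(m,d+1)$ are well defined (each is the same finite number for all generic choices, and is uniquely determined by this), and $$\psi_{LP}(m,d)=\phi_{\mathrm{diag}}(m,d+1).$$ -/

import Mathlib

/-- `P` holds for generic points of the affine space `K^σ`: it holds off the zero set of some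
nonzero polynomial, i.e. on a nonempty Zariski open set (for `K` infinite). -/
def ForGeneric {σ K : Type} [Field K] (P : (σ → K) → Prop) : Prop :=
  ∃ f : MvPolynomial σ K, f ≠ 0 ∧ ∀ p : σ → K, MvPolynomial.eval p f ≠ 0 → P p

/-- The Zariski closure of a subset of complex affine space. -/
def zariskiClosure {σ : Type} (V : Set (σ → ℂ)) : Set (σ → ℂ) :=
  MvPolynomial.zeroLocus ℂ (MvPolynomial.vanishingIdeal ℂ V)

/-- The affine hyperplane `∑ j, e j * x j = f` in `ℂ^m`, where `e j = p (some j)` and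
`f = p none`. -/
def hyperplane {m : ℕ} (p : Option (Fin m) → ℂ) : Set (Fin m → ℂ) :=
  {x | ∑ j, p (some j) * x j = p none}

/-- The curve `C` in `ℂ^m` has degree `n`: a generic hyperplane meets it in exactly `n` points. -/
def HasCurveDegree {m : ℕ} (C : Set (Fin m → ℂ)) (n : ℕ) : Prop :=
  ForGeneric fun p : Option (Fin m) → ℂ => (C ∩ hyperplane p).encard = n

/-- The data of a linear program: minimize `c x` subject to `A x = b`, `x ≥ 0`. -/
structure LPData (m d : ℕ) where
  A : Matrix (Fin d) (Fin m) ℝ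
  b : Fin d → ℝ
  c : Fin m → ℝ

namespace LPData

variable {m d : ℕ}

/-- The KKT conditions with barrier parameter `lam`. As they involve `1 / x j`, the condition
`x ≥ 0` means `x j > 0` for all `j`. -/
def KKT (D : LPData m d) (lam : ℝ) (x : Fin m → ℝ) (y : Fin d → ℝ) : Prop :=
  (∀ j, D.c j - lam * (1 / x j) - Matrix.vecMul y D.A j = 0) ∧
    Matrix.mulVec D.A x = D.b ∧ ∀ j, 0 < x j

/-- The central path is defined: for each `lam > 0` the KKT system has a unique solution
`(x, y)`. -/
def HasCentralPath (D : LPData m d) : Prop :=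
  ∀ lam : ℝ, 0 < lam → ∃! q : (Fin m → ℝ) × (Fin d → ℝ), D.KKT lam q.1 q.2

/-- The primal-dual central path `{(x*(lam), y*(lam)) | lam > 0}`, as a subset of `ℂ^m × ℂ^d`. -/
def centralPath (D : LPData m d) : Set (Fin m ⊕ Fin d → ℂ) :=
  {q | ∃ (lam : ℝ) (x : Fin m → ℝ) (y : Fin d → ℝ), 0 < lam ∧ D.KKT lam x y ∧
    q = Sum.elim (fun j => (x j : ℂ)) (fun i => (y i : ℂ))}

/-- The (primal) central curve: the projection to `ℂ^m` of the Zariski closure in `ℂ^m × ℂ^d`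
of the primal-dual central path. -/
def centralCurve (D : LPData m d) : Set (Fin m → ℂ) :=
  (fun q j => q (Sum.inl j)) '' zariskiClosure D.centralPath

/-- The linear program with the given vector of `d * m + d + m` coordinates. -/
def ofCoords (p : (Fin d × Fin m) ⊕ (Fin d ⊕ Fin m) → ℝ) : LPData m d where
  A := Matrix.of fun i j => p (Sum.inl (i, j))
  b := fun i => p (Sum.inr (Sum.inl i))
  c := fun j => p (Sum.inr (Sum.inr j))

end LPData

/-- `n` is the degree of the central curve of the linear program with generic `A`, `b`, `c`
(among the programs that have a central path). -/
def IsGenericCentralCurveDegree (m d n : ℕ) : Prop :=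
  ForGeneric fun p : (Fin d × Fin m) ⊕ (Fin d ⊕ Fin m) → ℝ =>
    (LPData.ofCoords p).HasCentralPath → HasCurveDegree (LPData.ofCoords p).centralCurve n

/-- A real matrix regarded as a complex one. -/
noncomputable def complexify {m : ℕ} (M : Matrix (Fin m) (Fin m) ℝ) : Matrix (Fin m) (Fin m) ℂ :=
  M.map Complex.ofReal

/-- The complex solutions of the likelihood equations `Σ K = Id`, `K ∈ L`, `Σ - S ∈ L^⊥` (for the
trace form) of the linear concentration model `L` and the sample covariance matrix `S`. -/
def likelihoodSolutions {m : ℕ} (L : Submodule ℝ (Matrix (Fin m) (Fin m) ℝ))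
    (S : Matrix (Fin m) (Fin m) ℝ) : Set (Matrix (Fin m) (Fin m) ℂ) :=
  {Sig | Sig.IsSymm ∧
    (∃ K ∈ Submodule.span ℂ (complexify '' (L : Set (Matrix (Fin m) (Fin m) ℝ))), Sig * K = 1) ∧
    ∀ M ∈ L, Matrix.trace ((Sig - complexify S) * complexify M) = 0}

/-- The real symmetric matrix with the given entries on and above the diagonal. -/
def symmOfCoords {m : ℕ} (s : Sym2 (Fin m) → ℝ) : Matrix (Fin m) (Fin m) ℝ :=
  Matrix.of fun i j => s s(i, j)

/-- The linear concentration model `L` has ML degree `n`: for a generic symmetric matrix `S` the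
likelihood equations have exactly `n` complex solutions. -/
def HasMLDegree {m : ℕ} (L : Submodule ℝ (Matrix (Fin m) (Fin m) ℝ)) (n : ℕ) : Prop :=
  ForGeneric fun s : Sym2 (Fin m) → ℝ => (likelihoodSolutions L (symmOfCoords s)).encard = n

/-- `n` is the ML degree of the linear concentration model spanned by `r` generic diagonal
`m × m` matrices. -/
def IsGenericDiagonalMLDegree (m r n : ℕ) : Prop :=
  ForGeneric fun k : Fin r × Fin m → ℝ =>
    HasMLDegree
      (Submodule.span ℝ (Set.range fun i : Fin r => Matrix.diagonal fun j => k (i, j))) n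

/-!
Both degrees count the points of a generic section of one irreducible family, so they are proved
equal without being computed.

*The central curve.* Consider the total space of all tuples `(A, x, s, y, e, lam)` with
`x j * s j = lam ≠ 0` (`TotalRing`). It maps to linear programs by `(A, b, c) = (A, A x, s + y A)`
and to hyperplanes by `(e, g) = (e, e x)`. It is rational of the same dimension as the space of
pairs of a linear program and a hyperplane, and the map is dominant, so a generic fibre has a
constant number `n` of points (`exists_encard_fibrePoints`). The fibre consists of the points of the
complexified central curve on the hyperplane (`exists_generic_centralSection`). These points lie on
the Zariski closure of the real central path, which is an infinite subset of a curve, because the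
generic such curve is irreducible. Indeed, at `lam = 0` a point with `x j = 0` for `j ≥ d` and
`s j = 0` for `j < d` is a rational function of its linear program, so that the function field of
linear programs is the residue field of a place of the function field of the total space and hence
algebraically closed in it (`exists_eq_of_isAlgebraic_of_place`); irreducibility passes to generic
specializations (`exists_forall_irreducible_map_minpoly`), and polynomials that vanish on the path
vanish on the curve (`exists_forall_apply_eq_zero_of_infinite`). So `n` is the degree of the central
curve (`exists_generic_centralCurveDegree`); it is the only number with this property because
central paths exist on a Zariski dense set (`exists_hasCentralPath`).

*The diagonal model.* If `W` is the matrix whose rows are the `d + 1` diagonals, the likelihood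
equations read `W (1 / (z W)) = W s` with `z` a vector of `d + 1` numbers and `s` the diagonal of
the sample covariance matrix (`encard_likelihoodSolutions`). On the other side, if `c` is the first
row of `W` and `A` consists of the others, the substitution `x = 1 / (z W)`, `y = - z' / z 0`,
`lam = 1 / z 0` turns a section of the central curve into the equations
`W' (1 / (z W)) = v`, where `W'` is `W` with its first row replaced by `e`, and `v = (g, b)`
(`encard_centralSection`). The likelihood equations are the special case `e = c` of these, with `W`
real; what has to be seen is that they have as many solutions as the equations with generic `e`.

*Specialization of `e` to `c`.* For real `W` and real `v`, all complex solutions `z W` are real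
(`im_vecMul_eq_zero`), and at a real solution the Jacobian is minus the Gram matrix of `W` with the
positive weights `(z W)⁻²`; so every solution is nondegenerate (`reciprocalDeriv_injective`) and
deforms uniquely. No solutions escape to infinity under deformation, because `z W` pairs to `m ≠ 0`
with its inverse, while it is orthogonal to the kernel of `W`
(`exists_tendsto_reciprocalSolutions`). Hence the number of solutions at `e = c` is that for a
suitable small perturbation, and perturbations can be chosen generic (`exists_perturbation`).
-/

/-! ### Fibres of generically finite maps -/

section Structure

variable {B T : Type*} [CommRing B] [IsDomain B] [CommRing T] [IsDomain T] [Algebra B T]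
  [FaithfulSMul B T]

/-- A finitely generated domain `T`, algebraic over an integrally closed domain `B` of
characteristic zero, is generated up to a denominator `δ ∈ B` by one integral element `τ`. -/
theorem exists_integral_generator [CharZero B] [Algebra.IsAlgebraic B T] [Algebra.FiniteType B T] :
    ∃ τ : T, IsIntegral B τ ∧ ∃ δ : B, δ ≠ 0 ∧ ∀ t : T, ∃ (N : ℕ) (r : Polynomial B),
      algebraMap B T (δ ^ N) * t = Polynomial.aeval τ r := by
  classical
  let k := FractionRing B
  let L := FractionRing T
  let : Algebra k L := FractionRing.liftAlgebra B L
  have : IsScalarTower B k L := FractionRing.isScalarTower_liftAlgebra B L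
  have : CharZero k := inferInstance
  have halg : ∀ t : T, IsIntegral k (algebraMap T L t) := by
    intro t
    have h1 : IsAlgebraic B t := Algebra.IsAlgebraic.isAlgebraic t
    have h2 : IsAlgebraic B (algebraMap T L t) := h1.algebraMap
    exact (h2.extendScalars (IsFractionRing.injective B k)).isIntegral
  obtain ⟨S, hS⟩ := ‹Algebra.FiniteType B T›
  have hmem : ∀ t : T, algebraMap T L t ∈
      IntermediateField.adjoin k ((algebraMap T L) '' (S : Set T)) := by
    intro t
    have ht : t ∈ Algebra.adjoin B (S : Set T) := by rw [hS]; trivial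
    induction ht using Algebra.adjoin_induction with
    | mem x hx => exact IntermediateField.subset_adjoin _ _ ⟨x, hx, rfl⟩
    | algebraMap b =>
      rw [← IsScalarTower.algebraMap_apply B T L, IsScalarTower.algebraMap_apply B k L]
      exact IntermediateField.algebraMap_mem _ _
    | add x y _ _ hx hy => rw [map_add]; exact add_mem hx hy
    | mul x y _ _ hx hy => rw [map_mul]; exact mul_mem hx hy
  have htop : IntermediateField.adjoin k ((algebraMap T L) '' (S : Set T)) = ⊤ := by
    rw [eq_top_iff]
    intro l _
    obtain ⟨a, b, -, rfl⟩ := IsFractionRing.div_surjective (A := T) l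
    exact div_mem (hmem a) (hmem b)
  have : FiniteDimensional k L := by
    have : Finite ((algebraMap T L) '' (S : Set T)) := (S.finite_toSet.image _).to_subtype
    have := IntermediateField.finiteDimensional_adjoin (K := k) (L := L)
      (S := (algebraMap T L) '' (S : Set T)) (by rintro _ ⟨x, _, rfl⟩; exact halg x)
    rw [htop] at this
    exact Module.Finite.equiv (IntermediateField.topEquiv (F := k) (E := L)).toLinearEquiv
  -- The generator is a multiple by an element of `B` of a primitive element of the fraction fields.
  obtain ⟨α, hα⟩ := Field.exists_primitive_element k L
  have hfrac : ∀ l : L, ∃ (t : T) (b : B), b ≠ 0 ∧ algebraMap B L b * l = algebraMap T L t := by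
    intro l
    obtain ⟨a, b, hb, rfl⟩ := IsFractionRing.div_surjective (A := T) l
    have hb' : b ≠ 0 := nonZeroDivisors.ne_zero hb
    obtain ⟨r, hr, c, hc⟩ :=
      (Algebra.IsAlgebraic.isAlgebraic (R := B) b).exists_nonzero_dvd hb
    refine ⟨c * a, r, hr, ?_⟩
    rw [IsScalarTower.algebraMap_apply B T L, hc]
    have : algebraMap T L b ≠ 0 := by simpa using hb'
    rw [map_mul, map_mul, mul_div_assoc', div_eq_iff this]
    ring
  obtain ⟨t, b, hb, htb⟩ := hfrac α
  obtain ⟨y, hy, hint⟩ := (Algebra.IsAlgebraic.isAlgebraic (R := B) t).exists_integral_multiple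
  have hprim : IntermediateField.adjoin k {algebraMap T L (y • t)} = ⊤ := by
    rw [eq_top_iff, ← hα, IntermediateField.adjoin_simple_le_iff]
    have hu : algebraMap k L (algebraMap B k (y * b)) ≠ 0 := by
      simpa using ⟨hy, hb⟩
    have : α = algebraMap T L (y • t) / algebraMap k L (algebraMap B k (y * b)) := by
      rw [eq_div_iff hu, ← IsScalarTower.algebraMap_apply B k L, Algebra.smul_def, map_mul,
        map_mul, ← htb, ← IsScalarTower.algebraMap_apply B T L]
      ring
    rw [this]
    exact div_mem (IntermediateField.mem_adjoin_simple_self _ _)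
      (IntermediateField.algebraMap_mem _ _)
  refine ⟨y • t, hint, ?_⟩
  set τ := y • t with hτ
  have hτint : IsIntegral k (algebraMap T L τ) := halg τ
  have hone : ∀ t : T, ∃ (δ : B) (r : Polynomial B), δ ≠ 0 ∧
      algebraMap B T δ * t = Polynomial.aeval τ r := by
    intro t
    have ht : algebraMap T L t ∈ IntermediateField.adjoin k {algebraMap T L τ} := by
      rw [hprim]; trivial
    rw [← IntermediateField.mem_toSubalgebra,
      IntermediateField.adjoin_simple_toSubalgebra_of_isAlgebraic hτint.isAlgebraic,
      Algebra.adjoin_singleton_eq_range_aeval] at ht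
    obtain ⟨p, hp⟩ := ht
    obtain ⟨δ, hδ, hp2⟩ := IsLocalization.integerNormalization_spec (nonZeroDivisors B) p
    refine ⟨δ, IsLocalization.integerNormalization (nonZeroDivisors B) p,
      nonZeroDivisors.ne_zero hδ, ?_⟩
    apply IsFractionRing.injective T L
    have h3 := congrArg (Polynomial.aeval (algebraMap T L τ)) hp2
    rw [Polynomial.aeval_map_algebraMap, Polynomial.aeval_algebraMap_apply] at h3
    have hp' : Polynomial.aeval (algebraMap T L τ) p = algebraMap T L t := hp
    rw [h3, Algebra.smul_def, Polynomial.algebraMap_apply, map_mul, map_mul, hp',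
      Polynomial.aeval_C, ← IsScalarTower.algebraMap_apply B k L,
      ← IsScalarTower.algebraMap_apply B T L]
  -- The denominators of finitely many generators suffice.
  choose δ r hδ hr using hone
  refine ⟨∏ s ∈ S, δ s, Finset.prod_ne_zero_iff.2 fun s _ => hδ s, fun t => ?_⟩
  have ht : t ∈ Algebra.adjoin B (S : Set T) := by rw [hS]; trivial
  induction ht using Algebra.adjoin_induction with
  | mem x hx =>
    refine ⟨1, Polynomial.C (∏ s ∈ S.erase x, δ s) * r x, ?_⟩
    rw [map_mul, ← hr, pow_one, ← Finset.mul_prod_erase S δ hx]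
    simp only [map_mul, Polynomial.aeval_C]
    ring
  | algebraMap b => exact ⟨0, Polynomial.C b, by simp⟩
  | add x y _ _ hx hy =>
    obtain ⟨N, p, hp⟩ := hx
    obtain ⟨M, q, hq⟩ := hy
    refine ⟨N + M, Polynomial.C ((∏ s ∈ S, δ s) ^ M) * p +
      Polynomial.C ((∏ s ∈ S, δ s) ^ N) * q, ?_⟩
    simp only [map_add, map_mul, Polynomial.aeval_C, ← hp, ← hq, pow_add]
    ring
  | mul x y _ _ hx hy =>
    obtain ⟨N, p, hp⟩ := hx
    obtain ⟨M, q, hq⟩ := hy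
    refine ⟨N + M, p * q, ?_⟩
    simp only [map_mul, ← hp, ← hq, pow_add]
    ring

end Structure

section GenericFibre

variable {ι : Type} {T : Type*} [CommRing T] [Algebra ℂ T] [Algebra (MvPolynomial ι ℂ) T]

/-- The complex points of `T` over the point `p` of the affine space with coordinate ring
`MvPolynomial ι ℂ`. -/
def fibrePoints (ι : Type) (T : Type*) [CommRing T] [Algebra ℂ T] [Algebra (MvPolynomial ι ℂ) T]
    (p : ι → ℂ) : Set (T →ₐ[ℂ] ℂ) :=
  {χ | ∀ b : MvPolynomial ι ℂ, χ (algebraMap _ T b) = MvPolynomial.eval p b}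

theorem apply_aeval_of_mem_fibrePoints {p : ι → ℂ} {χ : T →ₐ[ℂ] ℂ} (hχ : χ ∈ fibrePoints ι T p)
    (τ : T) (r : Polynomial (MvPolynomial ι ℂ)) :
    χ (Polynomial.aeval τ r) = (r.map (MvPolynomial.eval p)).eval (χ τ) := by
  have h : (χ : T →+* ℂ).comp (algebraMap (MvPolynomial ι ℂ) T) = MvPolynomial.eval p :=
    RingHom.ext hχ
  rw [Polynomial.aeval_def, Polynomial.eval_map, ← h]
  exact Polynomial.hom_eval₂ r (algebraMap (MvPolynomial ι ℂ) T) (χ : T →+* ℂ) τ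

/-- A nonzero function vanishes at no point of a generic fibre. -/
theorem exists_forall_fibrePoints_apply_ne_zero [IsDomain T]
    [Algebra.IsAlgebraic (MvPolynomial ι ℂ) T]
    {u : T} (hu : u ≠ 0) : ∃ F : MvPolynomial ι ℂ, F ≠ 0 ∧ ∀ p, MvPolynomial.eval p F ≠ 0 →
      ∀ χ ∈ fibrePoints ι T p, χ u ≠ 0 := by
  obtain ⟨r, hr, c, hc⟩ := (Algebra.IsAlgebraic.isAlgebraic (R := MvPolynomial ι ℂ) u
    ).exists_nonzero_dvd (mem_nonZeroDivisors_of_ne_zero hu)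
  refine ⟨r, hr, fun p hp χ hχ h0 => hp ?_⟩
  rw [← hχ r, hc, map_mul, h0, zero_mul]

/-- The generic fibre of a dominant, generically finite map from a variety to an affine space has
a constant number of points: the degree of the extension of function fields. Away from the
denominators the fibre consists of the roots of the minimal polynomial of an integral generator,
which remain distinct where the discriminant does not vanish. -/
theorem exists_encard_fibrePoints [IsDomain T]
    [IsScalarTower ℂ (MvPolynomial ι ℂ) T] [FaithfulSMul (MvPolynomial ι ℂ) T]
    [Algebra.IsAlgebraic (MvPolynomial ι ℂ) T] [Algebra.FiniteType ℂ T] :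
    ∃ (n : ℕ) (F : MvPolynomial ι ℂ), F ≠ 0 ∧ ∀ p, MvPolynomial.eval p F ≠ 0 →
      (fibrePoints ι T p).encard = n := by
  classical
  have : Algebra.FiniteType (MvPolynomial ι ℂ) T := .of_restrictScalars_finiteType ℂ _ _
  obtain ⟨τ, hτ, δ, hδ, hgen⟩ := exists_integral_generator (B := MvPolynomial ι ℂ) (T := T)
  set q := minpoly (MvPolynomial ι ℂ) τ with hq
  have hmonic : q.Monic := minpoly.monic hτ
  -- A Bezout relation between `q` and its derivative, with cleared denominators.
  let k := FractionRing (MvPolynomial ι ℂ)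
  let L := FractionRing T
  let : Algebra k L := FractionRing.liftAlgebra (MvPolynomial ι ℂ) L
  have : IsScalarTower (MvPolynomial ι ℂ) k L := FractionRing.isScalarTower_liftAlgebra _ L
  have hqk : q.map (algebraMap _ k) = minpoly k (algebraMap T L τ) := by
    rw [minpoly.isIntegrallyClosed_eq_field_fractions k L hτ]
  have hsep : (q.map (algebraMap _ k)).Separable := by
    rw [hqk]
    have : IsIntegral k (algebraMap T L τ) := (hτ.algebraMap (B := L)).tower_top
    exact (minpoly.irreducible this).separable
  obtain ⟨a, b, hab⟩ := hsep
  obtain ⟨D, hD, ha⟩ := IsLocalization.integerNormalization_spec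
    (nonZeroDivisors (MvPolynomial ι ℂ)) a
  obtain ⟨E, hE, hb⟩ := IsLocalization.integerNormalization_spec
    (nonZeroDivisors (MvPolynomial ι ℂ)) b
  set a' := IsLocalization.integerNormalization (nonZeroDivisors (MvPolynomial ι ℂ)) a
  set b' := IsLocalization.integerNormalization (nonZeroDivisors (MvPolynomial ι ℂ)) b
  have hbez : Polynomial.C E * a' * q + Polynomial.C D * b' * Polynomial.derivative q
      = Polynomial.C (D * E) := by
    apply Polynomial.map_injective _ (IsFractionRing.injective (MvPolynomial ι ℂ) k)
    have h1 : (Polynomial.C (algebraMap _ k D)) * (Polynomial.C (algebraMap _ k E)) *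
        (a * q.map (algebraMap _ k) + b * Polynomial.derivative (q.map (algebraMap _ k))) =
        (Polynomial.C (algebraMap _ k D)) * (Polynomial.C (algebraMap _ k E)) := by
      rw [hab, mul_one]
    simp only [Polynomial.map_add, Polynomial.map_mul, Polynomial.map_C, ha, hb, map_mul,
      ← Polynomial.derivative_map, Algebra.smul_def, Polynomial.algebraMap_apply]
    rw [← h1]
    ring
  refine ⟨q.natDegree, δ * (D * E), mul_ne_zero hδ (mul_ne_zero (nonZeroDivisors.ne_zero hD)
    (nonZeroDivisors.ne_zero hE)), fun p hp => ?_⟩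
  simp only [map_mul, mul_ne_zero_iff] at hp
  obtain ⟨hδp, hDp, hEp⟩ := hp
  set qp := q.map (MvPolynomial.eval p) with hqp
  have hqpm : qp.Monic := hmonic.map _
  have hsepp : qp.Separable := by
    have h2 := congrArg (Polynomial.map (MvPolynomial.eval p)) hbez
    simp only [Polynomial.map_add, Polynomial.map_mul, Polynomial.map_C,
      ← Polynomial.derivative_map] at h2
    rw [← hqp] at h2
    set κ := MvPolynomial.eval p D * MvPolynomial.eval p E with hκ
    have hκ0 : κ ≠ 0 := mul_ne_zero hDp hEp
    refine ⟨Polynomial.C κ⁻¹ * (Polynomial.C (MvPolynomial.eval p E) *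
      a'.map (MvPolynomial.eval p)), Polynomial.C κ⁻¹ * (Polynomial.C (MvPolynomial.eval p D) *
      b'.map (MvPolynomial.eval p)), ?_⟩
    rw [mul_assoc, mul_assoc (Polynomial.C κ⁻¹) _ (Polynomial.derivative qp), ← mul_add, h2,
      map_mul, ← hκ, ← Polynomial.C_mul, inv_mul_cancel₀ hκ0, Polynomial.C_1]
  have hroots : (qp.roots.toFinset : Set ℂ).encard = (q.natDegree : ℕ∞) := by
    rw [Set.encard_coe_eq_coe_finsetCard, Multiset.toFinset_card_of_nodup
      (Polynomial.nodup_roots hsepp), ← hmonic.natDegree_map (MvPolynomial.eval p),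
      (IsAlgClosed.splits qp).natDegree_eq_card_roots]
  have hqp0 : qp ≠ 0 := hqpm.ne_zero
  rw [← hroots]
  have hbij : Set.BijOn (fun χ : T →ₐ[ℂ] ℂ => χ τ) (fibrePoints ι T p)
      (qp.roots.toFinset : Set ℂ) := by
    refine ⟨fun χ hχ => ?_, fun χ hχ χ' hχ' h => ?_, fun ρ hρ => ?_⟩
    · simp only [Finset.mem_coe, Multiset.mem_toFinset, Polynomial.mem_roots hqp0,
        Polynomial.IsRoot.def]
      rw [hqp, ← apply_aeval_of_mem_fibrePoints hχ, hq, minpoly.aeval, map_zero]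
    · ext t
      obtain ⟨N, r, hr⟩ := hgen t
      have h1 := congrArg χ hr
      have h2 := congrArg χ' hr
      rw [apply_aeval_of_mem_fibrePoints hχ, map_mul, hχ] at h1
      rw [apply_aeval_of_mem_fibrePoints hχ', map_mul, hχ'] at h2
      simp only at h
      rw [← h, ← h1] at h2
      have : MvPolynomial.eval p (δ ^ N) ≠ 0 := by rw [map_pow]; exact pow_ne_zero _ hδp
      exact (mul_left_cancel₀ this h2).symm
    · have hρ : qp.eval ρ = 0 := by
        simpa [Polynomial.mem_roots hqp0] using hρ
      -- Evaluation at `ρ` of polynomials in `τ` is well defined.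
      have hwd : ∀ r s : Polynomial (MvPolynomial ι ℂ),
          Polynomial.aeval τ r = Polynomial.aeval τ s →
          (r.map (MvPolynomial.eval p)).eval ρ = (s.map (MvPolynomial.eval p)).eval ρ := by
        intro r s hrs
        have h0 : Polynomial.aeval τ (r - s) = 0 := by rw [map_sub, hrs, sub_self]
        obtain ⟨w, hw⟩ := (minpoly.isIntegrallyClosed_dvd_iff hτ _).1 h0
        have := congrArg (fun f => (f.map (MvPolynomial.eval p)).eval ρ) hw
        simp only [Polynomial.map_sub, Polynomial.eval_sub, Polynomial.map_mul,
          Polynomial.eval_mul] at this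
        rw [← hq, ← hqp, hρ, zero_mul] at this
        exact sub_eq_zero.1 this
      set δp := MvPolynomial.eval p δ with hδpdef
      choose N r hr using hgen
      have key : ∀ (t : T) (M : ℕ) (s : Polynomial (MvPolynomial ι ℂ)),
          algebraMap _ T (δ ^ M) * t = Polynomial.aeval τ s →
          ((r t).map (MvPolynomial.eval p)).eval ρ / δp ^ N t =
            (s.map (MvPolynomial.eval p)).eval ρ / δp ^ M := by
        intro t M s hs
        have h1 := hwd (Polynomial.C (δ ^ M) * r t) (Polynomial.C (δ ^ N t) * s) (by
          rw [map_mul, map_mul, ← hr, ← hs, Polynomial.aeval_C, Polynomial.aeval_C]; ring)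
        simp only [Polynomial.map_mul, Polynomial.map_C, Polynomial.eval_mul, Polynomial.eval_C,
          map_pow, Polynomial.map_pow, Polynomial.eval_pow, ← hδpdef] at h1
        rw [div_eq_div_iff (pow_ne_zero _ hδp) (pow_ne_zero _ hδp), mul_comm, h1, mul_comm]
      let χ : T →ₐ[ℂ] ℂ := AlgHom.ofLinearMap
        { toFun := fun t => ((r t).map (MvPolynomial.eval p)).eval ρ / δp ^ N t
          map_add' := fun x y => by
            rw [key (x + y) (N x + N y) (Polynomial.C (δ ^ N y) * r x +
              Polynomial.C (δ ^ N x) * r y) (by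
                rw [map_add, map_mul, map_mul, ← hr, ← hr, Polynomial.aeval_C, Polynomial.aeval_C,
                  pow_add, map_mul]; ring)]
            simp only [Polynomial.map_add, Polynomial.map_mul, Polynomial.map_C,
              Polynomial.eval_mul, Polynomial.eval_C, Polynomial.eval_add, map_pow,
              Polynomial.map_pow, Polynomial.eval_pow, ← hδpdef, pow_add]
            field_simp
          map_smul' := fun c x => by
            rw [key (c • x) (N x) (Polynomial.C (MvPolynomial.C c) * r x) (by
                rw [map_mul, ← hr, Polynomial.aeval_C, Algebra.smul_def,
                  IsScalarTower.algebraMap_apply ℂ (MvPolynomial ι ℂ) T, MvPolynomial.algebraMap_eq]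
                ring)]
            simp [mul_div_assoc] }
        (by
          change ((r 1).map (MvPolynomial.eval p)).eval ρ / δp ^ N 1 = 1
          rw [key 1 0 1 (by simp)]; simp)
        (by
          intro x y
          change ((r (x * y)).map (MvPolynomial.eval p)).eval ρ / δp ^ N (x * y) =
            ((r x).map (MvPolynomial.eval p)).eval ρ / δp ^ N x *
            (((r y).map (MvPolynomial.eval p)).eval ρ / δp ^ N y)
          rw [key (x * y) (N x + N y) (r x * r y) (by
            rw [map_mul, ← hr, ← hr, pow_add, map_mul]; ring)]
          simp only [Polynomial.map_mul, Polynomial.eval_mul, pow_add]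
          field_simp)
      refine ⟨χ, fun b => ?_, ?_⟩
      · change ((r _).map (MvPolynomial.eval p)).eval ρ / δp ^ N _ = _
        rw [key _ 0 (Polynomial.C b) (by simp)]
        simp
      · change ((r τ).map (MvPolynomial.eval p)).eval ρ / δp ^ N τ = ρ
        rw [key _ 0 Polynomial.X (by simp)]
        simp
  rw [← hbij.image_eq, hbij.injOn.encard_image]

end GenericFibre

/-! ### Linear disjointness from the algebraic closure -/

section LinearDisjoint

variable {k L Ω : Type*} [Field k] [Field L] [Field Ω] [Algebra k L] [Algebra k Ω] [Algebra L Ω]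
  [IsScalarTower k L Ω]

/-- If `k` is algebraically closed in `L`, the degree over `k` of an element algebraic over `k` does
not drop over `L`: the coefficients of the minimal polynomial over `L` are algebraic over `k`. -/
theorem minpoly_natDegree_le_of_algebraicallyClosedIn
    (hk : ∀ a : L, IsAlgebraic k a → a ∈ Set.range (algebraMap k L)) {α : Ω}
    (hα : IsIntegral k α) : (minpoly k α).natDegree ≤ (minpoly L α).natDegree := by
  have hαL : IsIntegral L α := hα.tower_top
  have hdvd : minpoly L α ∣ (minpoly k α).map (algebraMap k L) :=
    minpoly.dvd_map_of_isScalarTower k L α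
  have hlift := integralClosure.mem_lifts_of_monic_of_dvd_map L (minpoly.monic hα)
    (minpoly.monic hαL) hdvd
  have hlift' : minpoly L α ∈ Polynomial.lifts (algebraMap k L) := by
    rw [Polynomial.lifts_iff_coeff_lifts] at hlift ⊢
    intro i
    obtain ⟨y, hy⟩ := hlift i
    rw [← hy]
    exact hk _ (y.2 : IsIntegral k (y : L)).isAlgebraic
  obtain ⟨g, hg, hdeg, hgm⟩ :=
    Polynomial.lifts_and_natDegree_eq_and_monic hlift' (minpoly.monic hαL)
  rw [← hdeg]
  refine Polynomial.natDegree_le_of_dvd (minpoly.dvd k α ?_) hgm.ne_zero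
  rw [← Polynomial.aeval_map_algebraMap L, hg, minpoly.aeval]

theorem linearDisjoint_of_finiteDimensional [CharZero k]
    (hk : ∀ a : L, IsAlgebraic k a → a ∈ Set.range (algebraMap k L)) (M : IntermediateField k Ω)
    [FiniteDimensional k M] : M.LinearDisjoint L := by
  let pb := Field.powerBasisOfFiniteOfSeparable k M
  refine IntermediateField.LinearDisjoint.of_basis_left pb.basis ?_
  have hint : IsIntegral k pb.gen := IsIntegral.of_finite k _
  have hle : pb.dim ≤ (minpoly L (pb.gen : Ω)).natDegree := by
    rw [← pb.natDegree_minpoly, ← minpoly.algHom_eq M.val M.val.injective]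
    exact minpoly_natDegree_le_of_algebraicallyClosedIn hk (hint.map M.val)
  have h := (linearIndependent_pow (K := L) (pb.gen : Ω)).comp (Fin.castLE hle)
    (Fin.castLE_injective hle)
  convert h using 1
  funext i
  simp

theorem LinearIndependent.of_algebraicallyClosedIn [CharZero k]
    (hk : ∀ a : L, IsAlgebraic k a → a ∈ Set.range (algebraMap k L)) {κ : Type*} [Finite κ]
    {v : κ → Ω} (hv : LinearIndependent k v) (halg : ∀ i, IsAlgebraic k (v i)) :
    LinearIndependent L v := by
  have hfin : FiniteDimensional k (IntermediateField.adjoin k (Set.range v)) := by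
    refine IntermediateField.finiteDimensional_adjoin ?_
    rintro _ ⟨i, rfl⟩
    exact (halg i).isIntegral
  let w : κ → IntermediateField.adjoin k (Set.range v) :=
    fun i => ⟨v i, IntermediateField.subset_adjoin _ _ ⟨i, rfl⟩⟩
  have hw : LinearIndependent k w :=
    LinearIndependent.of_comp (IntermediateField.adjoin k (Set.range v)).val.toLinearMap hv
  exact (linearDisjoint_of_finiteDimensional hk _).linearIndependent_left hw

/-- If `k` is algebraically closed in `L` and has characteristic zero, `L` is linearly disjoint from
the algebraic closure of `k`. -/
theorem linearDisjoint_algebraicClosure [CharZero k]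
    (hk : ∀ a : L, IsAlgebraic k a → a ∈ Set.range (algebraMap k L)) :
    (algebraicClosure k Ω).LinearDisjoint L := by
  obtain ⟨ι, ⟨a⟩⟩ : ∃ ι : Set (algebraicClosure k Ω),
      Nonempty (Module.Basis ι k (algebraicClosure k Ω)) :=
    ⟨_, ⟨Module.Basis.ofVectorSpace k (algebraicClosure k Ω)⟩⟩
  refine IntermediateField.LinearDisjoint.of_basis_left a ?_
  have h0 : LinearIndependent k (fun i => (a i : Ω)) :=
    a.linearIndependent.map' (algebraicClosure k Ω).val.toLinearMap
      (LinearMap.ker_eq_bot.2 (algebraicClosure k Ω).val.injective)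
  refine linearIndependent_iff_finset_linearIndependent.2 fun s => ?_
  exact LinearIndependent.of_algebraicallyClosedIn hk (h0.comp _ Subtype.val_injective)
    fun i => mem_algebraicClosure_iff.1 (a i).2

end LinearDisjoint

/-! ### Irreducibility of generic specializations -/

section Specialization

attribute [local instance] MvPolynomial.algebraMvPolynomial

/-- A system of polynomial equations with parameters that has no solution in an algebraically closed
extension of the ring of parameters has none for generic values of the parameters: by the
Nullstellensatz a nonzero parameter polynomial lies in the ideal of the equations. -/
theorem exists_C_mem_span_of_forall_exists_aeval_ne_zero {R : Type*} (K : Type*) [CommRing R]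
    [IsDomain R] [Field K] [IsAlgClosed K] [Algebra R K] [FaithfulSMul R K] {U : Type} [Finite U]
    (E : Set (MvPolynomial U R)) (h : ∀ x : U → K, ∃ e ∈ E, MvPolynomial.aeval x e ≠ 0) :
    ∃ F : R, F ≠ 0 ∧ MvPolynomial.C F ∈ Ideal.span E := by
  let k := FractionRing R
  let : Algebra k K := FractionRing.liftAlgebra R K
  have : IsScalarTower R k K := FractionRing.isScalarTower_liftAlgebra R K
  set I := (Ideal.span E).map (algebraMap (MvPolynomial U R) (MvPolynomial U k)) with hI
  have hempty : MvPolynomial.zeroLocus K I = ∅ := by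
    rw [Set.eq_empty_iff_forall_notMem]
    intro x hx
    obtain ⟨e, he, hne⟩ := h x
    refine hne ?_
    have := hx _ (Ideal.mem_map_of_mem _ (Ideal.subset_span he))
    rwa [MvPolynomial.algebraMap_def, MvPolynomial.aeval_map_algebraMap] at this
  have hrad := MvPolynomial.vanishingIdeal_zeroLocus_eq_radical (K := K) I
  rw [hempty, MvPolynomial.vanishingIdeal_empty, eq_comm, Ideal.radical_eq_top,
    Ideal.eq_top_iff_one, hI, IsLocalization.mem_map_algebraMap_iff
      ((nonZeroDivisors R).map (MvPolynomial.C (σ := U)))] at hrad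
  obtain ⟨⟨x, ⟨_, s, hs, rfl⟩⟩, hx⟩ := hrad
  refine ⟨s, nonZeroDivisors.ne_zero hs, ?_⟩
  rw [one_mul] at hx
  have hinj : Function.Injective (algebraMap (MvPolynomial U R) (MvPolynomial U k)) := by
    rw [MvPolynomial.algebraMap_def]
    exact MvPolynomial.map_injective _ (IsFractionRing.injective R k)
  have := hinj hx
  simp only at this
  rw [this]
  exact x.2

open Polynomial

/-- The monic bivariate polynomial `Y ^ i + ∑ b < i, ∑ a ≤ D, x (b, a) X ^ a Y ^ b`. -/
noncomputable def monicOfCoeffs {R : Type*} [CommRing R] (i D : ℕ)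
    (x : Fin i × Fin (D + 1) → R) : R[X][X] :=
  X ^ i + ∑ b : Fin i, C (∑ a : Fin (D + 1), C (x (b, a)) * X ^ (a : ℕ)) * X ^ (b : ℕ)

theorem map_monicOfCoeffs {R S : Type*} [CommRing R] [CommRing S] (φ : R →+* S) (i D : ℕ)
    (x : Fin i × Fin (D + 1) → R) :
    (monicOfCoeffs i D x).map (mapRingHom φ) = monicOfCoeffs i D (φ ∘ x) := by
  simp [monicOfCoeffs, Polynomial.map_sum]

theorem monic_monicOfCoeffs {R : Type*} [CommRing R] (i D : ℕ) (x : Fin i × Fin (D + 1) → R) :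
    (monicOfCoeffs i D x).Monic := by
  refine monic_X_pow_add ?_
  refine (degree_sum_le _ _).trans_lt ?_
  rw [Finset.sup_lt_iff (by exact WithBot.bot_lt_coe i)]
  intro b _
  exact (degree_C_mul_X_pow_le _ _).trans_lt (by exact_mod_cast b.2)

theorem natDegree_monicOfCoeffs {R : Type*} [CommRing R] [Nontrivial R] (i D : ℕ)
    (x : Fin i × Fin (D + 1) → R) : (monicOfCoeffs i D x).natDegree = i := by
  rw [monicOfCoeffs, natDegree_add_eq_left_of_degree_lt, natDegree_X_pow]
  rw [degree_X_pow]
  refine (degree_sum_le _ _).trans_lt ?_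
  rw [Finset.sup_lt_iff (by exact WithBot.bot_lt_coe i)]
  intro b _
  exact (degree_C_mul_X_pow_le _ _).trans_lt (by exact_mod_cast b.2)

theorem exists_eq_monicOfCoeffs {R : Type*} [CommRing R] {i D : ℕ} {Q : R[X][X]} (hQ : Q.Monic)
    (hi : Q.natDegree = i) (hD : ∀ b, (Q.coeff b).natDegree ≤ D) :
    ∃ x, Q = monicOfCoeffs i D x := by
  refine ⟨fun ba => (Q.coeff ba.1).coeff ba.2, ?_⟩
  conv_lhs => rw [hQ.as_sum, hi]
  rw [monicOfCoeffs, ← Fin.sum_univ_eq_sum_range (fun b => C (Q.coeff b) * X ^ b)]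
  congr 1
  refine Finset.sum_congr rfl fun b _ => ?_
  congr 2
  conv_lhs => rw [(Q.coeff b).as_sum_range_C_mul_X_pow' (Nat.lt_succ_of_le (hD b))]
  rw [← Fin.sum_univ_eq_sum_range (fun a => C ((Q.coeff b).coeff a) * X ^ a)]

theorem coeff_coeff_swap {R : Type*} [CommRing R] (Q : R[X][X]) (a b : ℕ) :
    ((Bivariate.swap Q).coeff a).coeff b = (Q.coeff b).coeff a := by
  induction Q using Polynomial.induction_on' with
  | add p q hp hq => simp [hp, hq]
  | monomial n f =>
    rw [Bivariate.swap_monomial, coeff_mul_C, coeff_map, coeff_C_mul, coeff_X_pow, coeff_monomial]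
    by_cases h : b = n
    · subst h; simp
    · rw [if_neg h, if_neg (fun h' => h h'.symm)]; simp

/-- The degree in the inner variable of a factor is at most that of the product. -/
theorem natDegree_coeff_le_of_mul_eq {R : Type*} [CommRing R] [IsDomain R] {P Q q : R[X][X]} {D : ℕ}
    (h : P * Q = q) (hq0 : q ≠ 0) (hq : ∀ b, (q.coeff b).natDegree ≤ D) (b : ℕ) :
    (P.coeff b).natDegree ≤ D := by
  have hsw : Bivariate.swap P * Bivariate.swap Q = Bivariate.swap q := by rw [← map_mul, h]
  have hP : Bivariate.swap P ≠ 0 := by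
    rw [ne_eq, EmbeddingLike.map_eq_zero_iff]; rintro rfl; simp at h; exact hq0 h.symm
  have hQ : Bivariate.swap Q ≠ 0 := by
    rw [ne_eq, EmbeddingLike.map_eq_zero_iff]; rintro rfl; simp at h; exact hq0 h.symm
  have hdeg : (Bivariate.swap q).natDegree ≤ D := by
    rw [natDegree_le_iff_coeff_eq_zero]
    intro a ha
    ext b
    rw [coeff_coeff_swap, coeff_zero]
    exact coeff_eq_zero_of_natDegree_lt ((hq b).trans_lt ha)
  rw [← hsw, natDegree_mul hP hQ] at hdeg
  rw [natDegree_le_iff_coeff_eq_zero]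
  intro a ha
  have : (Bivariate.swap P).natDegree < a := by omega
  rw [← coeff_coeff_swap, coeff_eq_zero_of_natDegree_lt this, coeff_zero]

/-- The equations, in the coefficients of two monic polynomials of degrees `i` and `j`, saying that
their product is `q`. -/
noncomputable def factorizationEquations {R : Type*} [CommRing R] (i j D : ℕ) (q : R[X][X]) :
    (MvPolynomial ((Fin i × Fin (D + 1)) ⊕ (Fin j × Fin (D + 1))) R)[X][X] :=
  monicOfCoeffs i D (fun ba => MvPolynomial.X (Sum.inl ba)) *
    monicOfCoeffs j D (fun ba => MvPolynomial.X (Sum.inr ba)) - q.map (mapRingHom MvPolynomial.C)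

theorem map_factorizationEquations {R S : Type*} [CommRing R] [CommRing S] (φ : R →+* S)
    (i j D : ℕ) (q : R[X][X]) (z : (Fin i × Fin (D + 1)) ⊕ (Fin j × Fin (D + 1)) → S) :
    (factorizationEquations i j D q).map (mapRingHom (MvPolynomial.eval₂Hom φ z)) =
      monicOfCoeffs i D (z ∘ Sum.inl) * monicOfCoeffs j D (z ∘ Sum.inr) -
        q.map (mapRingHom φ) := by
  have h1 : (MvPolynomial.eval₂Hom φ z).comp MvPolynomial.C = φ := by
    ext r; simp
  simp only [factorizationEquations, Polynomial.map_sub, Polynomial.map_mul, map_monicOfCoeffs,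
    Polynomial.map_map, mapRingHom_comp, h1]
  congr 3 <;> · funext ba; simp

/-- If a monic bivariate polynomial with parameters has no monic factorization into factors of
smaller degree over an algebraically closed extension of the ring of parameters, then its generic
specializations are irreducible. -/
theorem exists_forall_irreducible_map {R : Type*} (K : Type*) [CommRing R] [IsDomain R] [Field K]
    [IsAlgClosed K] [Algebra R K] [FaithfulSMul R K] {q : R[X][X]} (hq : q.Monic)
    (hpos : 0 < q.natDegree)
    (h : ∀ Q₁ Q₂ : K[X][X], Q₁.Monic → Q₂.Monic → Q₁.natDegree < q.natDegree →
      Q₂.natDegree < q.natDegree → Q₁ * Q₂ ≠ q.map (mapRingHom (algebraMap R K))) :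
    ∃ F : R, F ≠ 0 ∧ ∀ (K' : Type) [Field K'] (φ : R →+* K'), φ F ≠ 0 →
      Irreducible (q.map (mapRingHom φ)) := by
  classical
  obtain ⟨D, hD⟩ : ∃ D, ∀ b, (q.coeff b).natDegree ≤ D := by
    refine ⟨q.support.sup fun b => (q.coeff b).natDegree, fun b => ?_⟩
    by_cases hb : b ∈ q.support
    · exact Finset.le_sup (f := fun b => (q.coeff b).natDegree) hb
    · rw [notMem_support_iff.1 hb]; simp
  -- For each degree `i` of a factor, the coefficients of the factors solve no system of equations.
  have key : ∀ i : ℕ, ∃ F : R, F ≠ 0 ∧ (0 < i → i < q.natDegree →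
      ∀ (K' : Type) [Field K'] (φ : R →+* K'), φ F ≠ 0 →
      ∀ x y, monicOfCoeffs i D x * monicOfCoeffs (q.natDegree - i) D y ≠
        q.map (mapRingHom φ)) := by
    intro i
    by_cases hi : 0 < i ∧ i < q.natDegree
    swap
    · exact ⟨1, one_ne_zero, fun h1 h2 => (hi ⟨h1, h2⟩).elim⟩
    let U := (Fin i × Fin (D + 1)) ⊕ (Fin (q.natDegree - i) × Fin (D + 1))
    let G := factorizationEquations i (q.natDegree - i) D q
    obtain ⟨F, hF, hspan⟩ := exists_C_mem_span_of_forall_exists_aeval_ne_zero K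
      (Set.range fun ab : ℕ × ℕ => (G.coeff ab.2).coeff ab.1) (by
        intro z
        by_contra! hcon
        have hzero : G.map (mapRingHom (MvPolynomial.eval₂Hom (algebraMap R K) z)) = 0 := by
          ext b a
          rw [coeff_map, coe_mapRingHom, coeff_map, coeff_zero, coeff_zero]
          exact hcon _ ⟨(a, b), rfl⟩
        rw [map_factorizationEquations, sub_eq_zero] at hzero
        refine h _ _ (monic_monicOfCoeffs _ _ _) (monic_monicOfCoeffs _ _ _) ?_ ?_ hzero
        · rw [natDegree_monicOfCoeffs]; exact hi.2
        · rw [natDegree_monicOfCoeffs]; omega)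
    refine ⟨F, hF, fun _ _ K' _ φ hφ x y hxy => hφ ?_⟩
    let z : U → K' := Sum.elim x y
    have hzero : G.map (mapRingHom (MvPolynomial.eval₂Hom φ z)) = 0 := by
      rw [map_factorizationEquations, sub_eq_zero]; exact hxy
    have hle : Ideal.span (Set.range fun ab : ℕ × ℕ => (G.coeff ab.2).coeff ab.1) ≤
        RingHom.ker (MvPolynomial.eval₂Hom φ z) := by
      rw [Ideal.span_le]
      rintro _ ⟨⟨a, b⟩, rfl⟩
      have := congrArg (fun f => (f.coeff b).coeff a) hzero
      simpa using this
    have := hle hspan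
    simpa using this
  choose F hF hkey using key
  refine ⟨∏ i ∈ Finset.range q.natDegree, F i, Finset.prod_ne_zero_iff.2 fun i _ => hF i,
    fun K' _ φ hφ => ?_⟩
  rw [map_prod, Finset.prod_ne_zero_iff] at hφ
  have hqm : (q.map (mapRingHom φ)).Monic := hq.map _
  have hqd : (q.map (mapRingHom φ)).natDegree = q.natDegree := hq.natDegree_map _
  have hDφ : ∀ b, ((q.map (mapRingHom φ)).coeff b).natDegree ≤ D := fun b => by
    rw [coeff_map]; exact natDegree_map_le.trans (hD b)
  rw [hqm.irreducible_iff_natDegree]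
  refine ⟨fun h1 => by rw [h1, natDegree_one] at hqd; omega, ?_⟩
  intro f g hf hg hfg
  by_contra! hcon
  have hdeg : f.natDegree + g.natDegree = q.natDegree := by
    rw [← hf.natDegree_mul hg, hfg, hqd]
  obtain ⟨x, hx⟩ := exists_eq_monicOfCoeffs hf rfl
    (natDegree_coeff_le_of_mul_eq hfg hqm.ne_zero hDφ)
  obtain ⟨y, hy⟩ := exists_eq_monicOfCoeffs (i := q.natDegree - f.natDegree) hg (by omega)
    (natDegree_coeff_le_of_mul_eq ((mul_comm _ _).trans hfg) hqm.ne_zero hDφ)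
  have h1 := hcon.1
  have h2 := hcon.2
  refine hkey f.natDegree (by omega) (by omega) K' φ (hφ _ (Finset.mem_range.2 (by omega))) x y ?_
  rw [← hx, ← hy, hfg]

end Specialization

/-! ### Zariski density of infinite subsets of generic curves -/

section Density

open Polynomial

/-- The value at `(l, τ)` of the bivariate polynomial `Q`. -/
noncomputable def evalPair {R S : Type*} [CommRing R] [CommRing S] [Algebra R S] (l τ : S) :
    R[X][X] →+* S :=
  eval₂RingHom (eval₂RingHom (algebraMap R S) l) τ

theorem evalPair_monomial {R S : Type*} [CommRing R] [CommRing S] [Algebra R S] (l τ : S)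
    (a b : ℕ) (v : R) : evalPair l τ (monomial b (monomial a v)) = v • (l ^ a * τ ^ b) := by
  simp [evalPair, Algebra.smul_def, mul_assoc]

/-- Independence of the products `l ^ a * τ ^ b` with `b < n` means that `l` and `τ` satisfy no
polynomial relation of degree less than `n` in `τ`. -/
theorem linearIndependent_pow_mul_pow_iff {R S : Type*} [CommRing R] [CommRing S] [Algebra R S]
    (l τ : S) (n : ℕ) :
    LinearIndependent R (fun ab : ℕ × Fin n => l ^ ab.1 * τ ^ (ab.2 : ℕ)) ↔
      ∀ Q : R[X][X], (∀ b, n ≤ b → Q.coeff b = 0) → evalPair l τ Q = 0 → Q = 0 := by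
  let Ψ : (ℕ × Fin n →₀ R) →+ R[X][X] :=
    Finsupp.liftAddHom fun ab => ((monomial (ab.2 : ℕ)).toAddMonoidHom.comp
      (monomial (R := R) ab.1).toAddMonoidHom)
  have hΨ : ∀ ab v, Ψ (Finsupp.single ab v) = monomial (ab.2 : ℕ) (monomial ab.1 v) := by
    intro ab v; simp [Ψ]
  have hcoeff : ∀ c a (b : Fin n), ((Ψ c).coeff b).coeff a = c (a, b) := by
    intro c a b
    induction c using Finsupp.induction_linear with
    | zero => simp
    | add f g hf hg => simp [hf, hg]
    | single ab v =>
      obtain ⟨a', b'⟩ := ab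
      rw [hΨ, coeff_monomial, Finsupp.single_apply]
      by_cases hb : b' = b
      · subst hb
        simp [coeff_monomial]
      · rw [if_neg (by simpa [Fin.ext_iff] using hb), if_neg (by simp [hb]), coeff_zero]
  have hdeg : ∀ c b, n ≤ b → (Ψ c).coeff b = 0 := by
    intro c b hb
    induction c using Finsupp.induction_linear with
    | zero => simp
    | add f g hf hg => simp [hf, hg]
    | single ab v =>
      rw [hΨ, coeff_monomial, if_neg (by have := ab.2.2; omega)]
  have hev : ∀ c, evalPair l τ (Ψ c) =
      Finsupp.linearCombination R (fun ab : ℕ × Fin n => l ^ ab.1 * τ ^ (ab.2 : ℕ)) c := by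
    intro c
    induction c using Finsupp.induction_linear with
    | zero => simp
    | add f g hf hg => simp [hf, hg]
    | single ab v => rw [hΨ, evalPair_monomial, Finsupp.linearCombination_single]
  rw [linearIndependent_iff]
  constructor
  · intro h Q hQ h0
    let c : ℕ × Fin n →₀ R := ∑ b : Fin n, ∑ a ∈ (Q.coeff b).support,
      Finsupp.single (a, b) ((Q.coeff b).coeff a)
    have hc : Ψ c = Q := by
      simp only [c, map_sum, hΨ]
      ext b a
      have hb : ∀ b' : Fin n, ∑ a ∈ (Q.coeff b').support, (monomial (b' : ℕ))
          ((monomial a) ((Q.coeff b').coeff a)) = monomial (b' : ℕ) (Q.coeff b') := by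
        intro b'
        rw [← map_sum, ← (Q.coeff b').as_sum_support]
      rw [Finset.sum_congr rfl fun b' _ => hb b',
        Fin.sum_univ_eq_sum_range (fun b => monomial b (Q.coeff b)) n, finsetSum_coeff]
      simp only [coeff_monomial, Finset.sum_ite_eq', Finset.mem_range]
      split_ifs with h'
      · rfl
      · rw [hQ b (not_lt.1 h')]
    rw [← hc, h c (by rw [← hev, hc, h0]), map_zero]
  · intro h c hc
    ext ⟨a, b⟩
    rw [← hcoeff, h (Ψ c) (hdeg c) (by rw [hev, hc])]
    simp

theorem evalPair_map {R R' S S' : Type*} [CommRing R] [CommRing S] [Algebra R S] [CommRing R']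
    [CommRing S'] [Algebra R' S'] (φ : R →+* R') (f : S →+* S')
    (h : ∀ x, f (algebraMap R S x) = algebraMap R' S' (φ x)) (l τ : S) (Q : R[X][X]) :
    evalPair (f l) (f τ) (Q.map (mapRingHom φ)) = f (evalPair l τ Q) := by
  have h3 : (evalPair (f l) (f τ)).comp (mapRingHom (mapRingHom φ)) = f.comp (evalPair l τ) := by
    refine Polynomial.ringHom_ext' (Polynomial.ringHom_ext' (RingHom.ext fun x => ?_) ?_) ?_
    · simp [evalPair, h]
    · simp [evalPair]
    · simp [evalPair]
  exact congrArg (fun g => g Q) h3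

theorem aeval_eq_evalPair {R S : Type*} [CommRing R] [CommRing S] [Algebra R S] [Algebra R[X] S]
    [IsScalarTower R R[X] S] (τ : S) (r : R[X][X]) :
    aeval τ r = evalPair (algebraMap R[X] S X) τ r := by
  rw [aeval_def, evalPair, coe_eval₂RingHom]
  congr 1
  refine Polynomial.ringHom_ext' (RingHom.ext fun x => ?_) ?_
  · simp only [RingHom.comp_apply, coe_eval₂RingHom, eval₂_C]
    rw [IsScalarTower.algebraMap_apply R R[X] S]
    rfl
  · simp

/-- Algebraic relations between two elements `l`, `τ` of a field in which `k` is algebraically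
closed acquire no smaller degree in `τ` over the algebraic closure of `k`. -/
theorem eq_zero_of_evalPair_eq_zero {R k L Ω : Type*} [CommRing R] [IsDomain R] [Field k] [Field L]
    [Field Ω] [Algebra R k] [IsFractionRing R k] [Algebra k L] [Algebra R L] [IsScalarTower R k L]
    [Algebra k Ω] [Algebra L Ω] [IsScalarTower k L Ω] [CharZero k]
    (hk : ∀ a : L, IsAlgebraic k a → a ∈ Set.range (algebraMap k L)) {l τ : L} {n : ℕ}
    (h : ∀ Q : R[X][X], (∀ b, n ≤ b → Q.coeff b = 0) → evalPair l τ Q = 0 → Q = 0)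
    (Q : (algebraicClosure k Ω)[X][X]) (hQ : ∀ b, n ≤ b → Q.coeff b = 0)
    (h0 : evalPair (algebraMap L Ω l) (algebraMap L Ω τ) Q = 0) : Q = 0 := by
  have hind := (linearDisjoint_algebraicClosure (Ω := Ω) hk).linearIndependent_right'
    ((LinearIndependent.iff_fractionRing R k).1 ((linearIndependent_pow_mul_pow_iff l τ n).2 h))
  have hcomp : (algebraMap L Ω ∘ fun ab : ℕ × Fin n => l ^ ab.1 * τ ^ (ab.2 : ℕ)) =
      fun ab : ℕ × Fin n => (algebraMap L Ω l) ^ ab.1 * (algebraMap L Ω τ) ^ (ab.2 : ℕ) := by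
    funext ab; simp
  rw [hcomp] at hind
  exact (linearIndependent_pow_mul_pow_iff (R := algebraicClosure k Ω) _ _ n).1 hind Q hQ h0

/-- If the field of fractions of `R` is algebraically closed in that of `T`, the minimal polynomial
over `R[X]` of an integral element of `T` is irreducible for generic values of the parameters. -/
theorem exists_forall_irreducible_map_minpoly {R T : Type*} [CommRing R] [IsDomain R] [CharZero R]
    [CommRing T] [IsDomain T] [Algebra R T] [Algebra R[X] T] [IsScalarTower R R[X] T]
    [FaithfulSMul R[X] T] [IsIntegrallyClosed R[X]]
    (hk : ∀ a : FractionRing T, IsAlgebraic R a →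
      ∃ b c : R, c ≠ 0 ∧ algebraMap _ (FractionRing T) c * a = algebraMap _ _ b)
    {τ : T} (hτ : IsIntegral R[X] τ) :
    ∃ F : R, F ≠ 0 ∧ ∀ (K' : Type) [Field K'] (φ : R →+* K'), φ F ≠ 0 →
      Irreducible ((minpoly R[X] τ).map (mapRingHom φ)) := by
  set q := minpoly R[X] τ with hq
  let k := FractionRing R
  let L := FractionRing T
  have hRT : FaithfulSMul R T := FaithfulSMul.trans R R[X] T
  let : Algebra k L := FractionRing.liftAlgebra R L
  have : IsScalarTower R k L := FractionRing.isScalarTower_liftAlgebra R L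
  have : CharZero k := inferInstance
  let Ω := AlgebraicClosure L
  have hk' : ∀ a : L, IsAlgebraic k a → a ∈ Set.range (algebraMap k L) := by
    intro a ha
    obtain ⟨b, c, hc, h⟩ := hk a ((IsFractionRing.isAlgebraic_iff R k L).2 ha)
    refine ⟨algebraMap R k b / algebraMap R k c, ?_⟩
    have hc' : algebraMap R L c ≠ 0 := by
      rw [IsScalarTower.algebraMap_apply R k L]; simpa using hc
    rw [map_div₀, ← IsScalarTower.algebraMap_apply, ← IsScalarTower.algebraMap_apply,
      div_eq_iff hc', mul_comm]
    exact h.symm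
  set l := algebraMap R[X] T X with hl
  have hindR : ∀ Q : R[X][X], (∀ b, q.natDegree ≤ b → Q.coeff b = 0) →
      evalPair (algebraMap T L l) (algebraMap T L τ) Q = 0 → Q = 0 := by
    intro Q hQ h0
    have h1 := evalPair_map (RingHom.id R) (algebraMap T L)
      (fun x => (IsScalarTower.algebraMap_apply R T L x).symm) l τ Q
    rw [mapRingHom_id, Polynomial.map_id] at h1
    rw [h1, map_eq_zero_iff _ (IsFractionRing.injective T L), ← aeval_eq_evalPair] at h0
    by_contra hne
    have h2 := minpoly.IsIntegrallyClosed.degree_le_of_ne_zero (s := τ) (R := R[X]) hne h0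
    exact hne (leadingCoeff_eq_zero.1 (hQ Q.natDegree (natDegree_le_natDegree h2)))
  have hindA := eq_zero_of_evalPair_eq_zero (Ω := Ω) hk' hindR
  have hAcl : IsAlgClosed (algebraicClosure k Ω) := IsAlgClosure.isAlgClosed k
  let A := algebraicClosure k Ω
  let : Algebra R A := ((algebraMap k A).comp (algebraMap R k)).toAlgebra
  have hAf : FaithfulSMul R A := by
    rw [faithfulSMul_iff_algebraMap_injective]
    exact (algebraMap k A).injective.comp (IsFractionRing.injective R k)
  have hzero : evalPair (algebraMap L Ω (algebraMap T L l)) (algebraMap L Ω (algebraMap T L τ))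
      (q.map (mapRingHom (algebraMap R A))) = 0 := by
    have h1 : evalPair l τ q = 0 := by rw [← aeval_eq_evalPair, hq, minpoly.aeval]
    have h2 := evalPair_map (algebraMap R A) ((algebraMap L Ω).comp (algebraMap T L)) (fun x => by
      change algebraMap L Ω (algebraMap T L (algebraMap R T x)) = algebraMap k Ω (algebraMap R k x)
      rw [← IsScalarTower.algebraMap_apply R T L, IsScalarTower.algebraMap_apply R k L,
        ← IsScalarTower.algebraMap_apply k L Ω]) l τ q
    rw [h1, map_zero] at h2
    exact h2
  refine exists_forall_irreducible_map A (minpoly.monic hτ) (minpoly.natDegree_pos hτ) ?_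
  intro Q₁ Q₂ h₁ h₂ hd₁ hd₂ hmul
  rw [← hmul, map_mul, mul_eq_zero] at hzero
  rcases hzero with h0 | h0
  · exact h₁.ne_zero (hindA Q₁ (fun b hb => coeff_eq_zero_of_natDegree_lt (by omega)) h0)
  · exact h₂.ne_zero (hindA Q₂ (fun b hb => coeff_eq_zero_of_natDegree_lt (by omega)) h0)

/-- Let `T` be the coordinate ring of a family of curves over the affine space with coordinates
`ι`, such that `ℂ(ι)` is algebraically closed in the function field of `T`. On a generic curve of
the family, any function vanishing on a set on which the coordinate `X` takes infinitely many values
vanishes at all points with `u ≠ 0`. The reason is that `t` is, up to a denominator, a polynomial in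
an integral generator, and the minimal polynomial of this generator remains irreducible. -/
theorem exists_forall_apply_eq_zero_of_infinite {ι : Type} {T : Type} [CommRing T] [IsDomain T]
    [Algebra ℂ T] [Algebra (MvPolynomial ι ℂ) T] [IsScalarTower ℂ (MvPolynomial ι ℂ) T]
    [Algebra (MvPolynomial ι ℂ)[X] T] [IsScalarTower (MvPolynomial ι ℂ) (MvPolynomial ι ℂ)[X] T]
    [FaithfulSMul (MvPolynomial ι ℂ)[X] T] [Algebra.IsAlgebraic (MvPolynomial ι ℂ)[X] T]
    [Algebra.FiniteType ℂ T]
    (hk : ∀ a : FractionRing T, IsAlgebraic (MvPolynomial ι ℂ) a →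
      ∃ b c : MvPolynomial ι ℂ, c ≠ 0 ∧ algebraMap _ (FractionRing T) c * a = algebraMap _ _ b) :
    ∃ u : T, u ≠ 0 ∧ ∀ (p : ι → ℂ) (Y : Set (T →ₐ[ℂ] ℂ)), Y ⊆ fibrePoints ι T p →
      ((fun χ : T →ₐ[ℂ] ℂ => χ (algebraMap (MvPolynomial ι ℂ)[X] T X)) '' Y).Infinite →
      ∀ t : T, (∀ χ ∈ Y, χ t = 0) → ∀ χ ∈ fibrePoints ι T p, χ u ≠ 0 → χ t = 0 := by
  classical
  have htow : IsScalarTower ℂ (MvPolynomial ι ℂ)[X] T := by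
    refine IsScalarTower.of_algebraMap_eq fun x => ?_
    rw [IsScalarTower.algebraMap_apply ℂ (MvPolynomial ι ℂ) T,
      IsScalarTower.algebraMap_apply (MvPolynomial ι ℂ) (MvPolynomial ι ℂ)[X] T]
    rfl
  have : Algebra.FiniteType (MvPolynomial ι ℂ)[X] T := .of_restrictScalars_finiteType ℂ _ _
  obtain ⟨τ, hτ, δ, hδ, hgen⟩ := exists_integral_generator (B := (MvPolynomial ι ℂ)[X]) (T := T)
  obtain ⟨F, hF, hirr⟩ := exists_forall_irreducible_map_minpoly hk hτ
  set l := algebraMap (MvPolynomial ι ℂ)[X] T X with hl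
  set q := minpoly (MvPolynomial ι ℂ)[X] τ with hq
  refine ⟨algebraMap _ T (δ * C F), ?_, ?_⟩
  · rw [ne_eq, map_eq_zero_iff _ (FaithfulSMul.algebraMap_injective _ _)]
    exact mul_ne_zero hδ (by simpa using hF)
  intro p Y hY hinf t ht χ' hχ' hu
  have hCF : algebraMap (MvPolynomial ι ℂ)[X] T (C F) = algebraMap _ T F := by
    rw [IsScalarTower.algebraMap_apply (MvPolynomial ι ℂ) (MvPolynomial ι ℂ)[X] T]; rfl
  rw [map_mul, map_mul, mul_ne_zero_iff, hCF, hχ' F] at hu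
  set φ := MvPolynomial.eval p with hφ
  have hirrp := hirr ℂ φ hu.2
  set qp := q.map (mapRingHom φ) with hqp
  have hqpm : qp.Monic := (minpoly.monic hτ).map _
  have heval : ∀ χ ∈ fibrePoints ι T p, ∀ r : (MvPolynomial ι ℂ)[X][X],
      χ (aeval τ r) = evalPair (χ l) (χ τ) (r.map (mapRingHom φ)) := by
    intro χ hχ r
    rw [aeval_eq_evalPair]
    exact (evalPair_map φ (χ : T →+* ℂ) (fun x => hχ x) l τ r).symm
  obtain ⟨N, r, hr⟩ := hgen t
  set rp := r.map (mapRingHom φ) with hrp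
  -- Otherwise a Bezout relation between `qp` and `rp` over `ℂ(X)` shows that `X` takes only
  -- finitely many values at common zeros.
  have hdvd : qp ∣ rp := by
    by_contra hnd
    let K := RatFunc ℂ
    have hinj := IsFractionRing.injective ℂ[X] K
    have hirrK : Irreducible (qp.map (algebraMap ℂ[X] K)) :=
      (hqpm.irreducible_iff_irreducible_map_fraction_map (K := K)).1 hirrp
    have hndK : ¬ qp.map (algebraMap ℂ[X] K) ∣ rp.map (algebraMap ℂ[X] K) := by
      rwa [Polynomial.map_dvd_map _ hinj hqpm]
    obtain ⟨a, b, hab⟩ := (hirrK.coprime_iff_not_dvd).2 hndK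
    obtain ⟨D, hD, ha⟩ := IsLocalization.integerNormalization_spec (nonZeroDivisors ℂ[X]) a
    obtain ⟨E, hE, hb⟩ := IsLocalization.integerNormalization_spec (nonZeroDivisors ℂ[X]) b
    set a' := IsLocalization.integerNormalization (nonZeroDivisors ℂ[X]) a
    set b' := IsLocalization.integerNormalization (nonZeroDivisors ℂ[X]) b
    have hbez : C E * a' * qp + C D * b' * rp = C (D * E) := by
      apply Polynomial.map_injective _ hinj
      have h1 : (C (algebraMap _ K D)) * (C (algebraMap _ K E)) *
          (a * qp.map (algebraMap _ K) + b * rp.map (algebraMap _ K)) =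
          (C (algebraMap _ K D)) * (C (algebraMap _ K E)) := by
        rw [hab, mul_one]
      simp only [Polynomial.map_add, Polynomial.map_mul, Polynomial.map_C, ha, hb, map_mul,
        Algebra.smul_def, Polynomial.algebraMap_apply]
      rw [← h1]
      ring
    have hDE : D * E ≠ 0 := mul_ne_zero (nonZeroDivisors.ne_zero hD) (nonZeroDivisors.ne_zero hE)
    refine hinf (((D * E).roots.toFinset.finite_toSet).subset ?_)
    rintro _ ⟨χ, hχ, rfl⟩
    have h0 := congrArg (evalPair (χ l) (χ τ)) hbez
    have hq0 : evalPair (χ l) (χ τ) qp = 0 := by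
      rw [hqp, ← heval χ (hY hχ), hq, minpoly.aeval, map_zero]
    have hr0 : evalPair (χ l) (χ τ) rp = 0 := by
      rw [hrp, ← heval χ (hY hχ), ← hr, map_mul, ht χ hχ, mul_zero]
    rw [map_add, map_mul, map_mul _ (C D * b'), hq0, hr0, mul_zero, mul_zero, add_zero] at h0
    simp only [Finset.mem_coe, Multiset.mem_toFinset]
    rw [mem_roots hDE, IsRoot.def]
    have : evalPair (χ l) (χ τ) (C (D * E)) = (D * E).eval (χ l) := by
      simp [evalPair, eval₂_eq_eval_map]
    rw [this] at h0
    exact h0.symm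
  obtain ⟨w, hw⟩ := hdvd
  have h1 := congrArg χ' hr
  rw [heval χ' hχ', ← hrp, hw, map_mul (evalPair _ _), hqp, ← heval χ' hχ', hq, minpoly.aeval,
    map_zero, zero_mul, map_mul, mul_eq_zero, map_pow, map_pow] at h1
  exact h1.resolve_left (pow_ne_zero _ hu.1)

end Density

/-! ### A place with rational residue field -/

section Place

open PowerSeries

variable {R T F : Type*} [CommRing R] [CommRing T] [IsDomain T] [Algebra R T] [Field F]
  [Algebra R F] {ps : R →+* F⟦X⟧} {J : T →+* LaurentSeries F}

/-- An element algebraic over `R` has no pole at a place of which the residue field contains `R`. -/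
theorem exists_powerSeries_of_isAlgebraic [FaithfulSMul R F] (hJ : Function.Injective J)
    (hps : ∀ r, J (algebraMap R T r) = algebraMap F⟦X⟧ (LaurentSeries F) (ps r))
    (hconst : ∀ r, constantCoeff (ps r) = algebraMap R F r) {a : FractionRing T}
    (ha : IsAlgebraic R a) :
    ∃ f : F⟦X⟧, IsFractionRing.lift hJ a = algebraMap F⟦X⟧ (LaurentSeries F) f := by
  obtain ⟨y, hy, hint⟩ := ha.exists_integral_multiple
  have hcomp : ((IsFractionRing.lift hJ : FractionRing T →+* LaurentSeries F)).comp
      (algebraMap R (FractionRing T)) = (algebraMap F⟦X⟧ (LaurentSeries F)).comp ps := by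
    ext1 r
    rw [RingHom.comp_apply, IsScalarTower.algebraMap_apply R T (FractionRing T),
      IsFractionRing.lift_algebraMap, hps, RingHom.comp_apply]
  have hint' : IsIntegral F⟦X⟧ (IsFractionRing.lift hJ (y • a) : LaurentSeries F) :=
    hint.map_of_comp_eq ps (IsFractionRing.lift hJ) hcomp.symm
  obtain ⟨f, hf⟩ := IsIntegrallyClosed.isIntegral_iff.1 hint'
  have hu : IsUnit (ps y) := by
    rw [PowerSeries.isUnit_iff_constantCoeff, hconst, isUnit_iff_ne_zero]
    simpa using hy
  obtain ⟨v, hv⟩ := hu.exists_left_inv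
  refine ⟨v * f, ?_⟩
  have h1 := RingHom.congr_fun hcomp y
  simp only [RingHom.comp_apply] at h1
  rw [map_mul, hf, Algebra.smul_def, map_mul, h1, ← mul_assoc, ← map_mul, hv, map_one, one_mul]

/-- An element algebraic over `R` that vanishes at the place is zero. -/
theorem eq_zero_of_isAlgebraic_of_constantCoeff_eq_zero [FaithfulSMul R F] [IsDomain R]
    (hJ : Function.Injective J)
    (hps : ∀ r, J (algebraMap R T r) = algebraMap F⟦X⟧ (LaurentSeries F) (ps r))
    (hconst : ∀ r, constantCoeff (ps r) = algebraMap R F r) {a : FractionRing T}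
    (ha : IsAlgebraic R a) {g : F⟦X⟧} (hg : constantCoeff g = 0)
    (hag : IsFractionRing.lift hJ a = algebraMap F⟦X⟧ (LaurentSeries F) g) : a = 0 := by
  by_contra hne
  obtain ⟨f, hf⟩ := exists_powerSeries_of_isAlgebraic hJ hps hconst ha.inv
  have h1 : algebraMap F⟦X⟧ (LaurentSeries F) (g * f) = algebraMap F⟦X⟧ (LaurentSeries F) 1 := by
    rw [map_mul, ← hag, ← hf, ← map_mul, mul_inv_cancel₀ hne, map_one, map_one]
  have h2 := congrArg constantCoeff (IsFractionRing.injective F⟦X⟧ (LaurentSeries F) h1)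
  rw [map_mul, hg, zero_mul, map_one] at h2
  exact zero_ne_one h2

/-- If the field of fractions of `R` is the residue field of a place of the function field of `T`,
it is algebraically closed in that field: subtracting from an algebraic element its residue leaves
an algebraic element vanishing at the place. -/
theorem exists_eq_of_isAlgebraic_of_place [IsFractionRing R F] [IsDomain R]
    (hJ : Function.Injective J)
    (hps : ∀ r, J (algebraMap R T r) = algebraMap F⟦X⟧ (LaurentSeries F) (ps r))
    (hconst : ∀ r, constantCoeff (ps r) = algebraMap R F r) {a : FractionRing T}
    (ha : IsAlgebraic R a) : ∃ b c : R, c ≠ 0 ∧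
      algebraMap _ (FractionRing T) c * a = algebraMap _ (FractionRing T) b := by
  obtain ⟨f, hf⟩ := exists_powerSeries_of_isAlgebraic hJ hps hconst ha
  obtain ⟨b, c, hc, hbc⟩ := IsFractionRing.div_surjective (A := R) (constantCoeff f)
  refine ⟨b, c, nonZeroDivisors.ne_zero hc, ?_⟩
  have hc0 : algebraMap R F c ≠ 0 := by
    simpa using nonZeroDivisors.ne_zero hc
  have hres : ∀ r : R, IsFractionRing.lift hJ (algebraMap R (FractionRing T) r) =
      algebraMap F⟦X⟧ (LaurentSeries F) (ps r) := fun r => by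
    rw [IsScalarTower.algebraMap_apply R T (FractionRing T), IsFractionRing.lift_algebraMap, hps]
  rw [← sub_eq_zero]
  refine eq_zero_of_isAlgebraic_of_constantCoeff_eq_zero hJ hps hconst
    (a := algebraMap R (FractionRing T) c * a - algebraMap R (FractionRing T) b)
    (((isAlgebraic_algebraMap c).mul ha).sub (isAlgebraic_algebraMap b))
    (g := ps c * f - ps b) ?_ ?_
  · rw [map_sub, map_mul, hconst, hconst, ← hbc, mul_div_cancel₀ _ hc0, sub_self]
  · rw [map_sub, map_mul, hf, hres, hres, map_sub, map_mul]

end Place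

/-! ### The total space of central curves -/

section TotalSpace

open MvPolynomial

/-- The indices of the coordinates `A`, `b`, `c` of a linear program. -/
abbrev LPCoord (m d : ℕ) : Type := (Fin d × Fin m) ⊕ (Fin d ⊕ Fin m)

/-- The indices of the coordinates `A`, `y`, `p`, `e` of the total space other than `lam`; here
`p j` stands for `x j` if `j < d` and for the slack `s j = c j - (y A) j` otherwise. -/
abbrev TotalCoord (m d : ℕ) : Type := (Fin d × Fin m) ⊕ Fin d ⊕ Fin m ⊕ Fin m

variable {m d : ℕ}

/-- The coordinates `A`, `b = A x`, `c = s + y A` of the linear program that has the primal-dual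
point `(x, y)` with slack `s`. -/
def lpOfPoint {S : Type*} [CommRing S] (A : Fin d → Fin m → S) (x s : Fin m → S) (y : Fin d → S) :
    LPCoord m d → S :=
  Sum.elim (fun ij => A ij.1 ij.2)
    (Sum.elim (fun i => ∑ j, A i j * x j) (fun j => s j + ∑ i, y i * A i j))

theorem map_lpOfPoint {S S' : Type*} [CommRing S] [CommRing S'] (f : S →+* S')
    (A : Fin d → Fin m → S) (x s : Fin m → S) (y : Fin d → S) (i : LPCoord m d) :
    f (lpOfPoint A x s y i) =
      lpOfPoint (fun i j => f (A i j)) (fun j => f (x j)) (fun j => f (s j)) (fun i => f (y i)) i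
    := by
  rcases i with ⟨i, j⟩ | i | j <;> simp [lpOfPoint]

/-- `v` on the first `d` indices, `w` on the others. -/
def splitAt {S : Type*} (d : ℕ) (v w : Fin m → S) (j : Fin m) : S :=
  if (j : ℕ) < d then v j else w j

variable (m d) in
/-- The function `lam * ∏ j, p j`. -/
noncomputable def totalDenom : MvPolynomial (Option (TotalCoord m d)) ℂ :=
  X none * ∏ j, X (some (Sum.inr (Sum.inr (Sum.inl j))))

theorem totalDenom_ne_zero : totalDenom m d ≠ 0 :=
  mul_ne_zero (X_ne_zero _) (Finset.prod_ne_zero_iff.2 fun _ _ => X_ne_zero _)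

variable (m d) in
/-- The coordinate ring of the total space: its points consist of a matrix `A`, vectors `x`, `s`,
`y`, `e` and a number `lam ≠ 0` with `x j * s j = lam` for all `j`. -/
def TotalRing : Type := Localization.Away (totalDenom m d)

namespace TotalRing

noncomputable instance : CommRing (TotalRing m d) :=
  inferInstanceAs (CommRing (Localization.Away (totalDenom m d)))

noncomputable instance : Algebra (MvPolynomial (Option (TotalCoord m d)) ℂ) (TotalRing m d) :=
  inferInstanceAs (Algebra _ (Localization.Away (totalDenom m d)))

noncomputable instance : Algebra ℂ (TotalRing m d) :=
  inferInstanceAs (Algebra ℂ (Localization.Away (totalDenom m d)))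

instance : IsScalarTower ℂ (MvPolynomial (Option (TotalCoord m d)) ℂ) (TotalRing m d) :=
  inferInstanceAs (IsScalarTower ℂ _ (Localization.Away (totalDenom m d)))

instance : IsLocalization.Away (totalDenom m d) (TotalRing m d) :=
  inferInstanceAs (IsLocalization.Away _ (Localization.Away (totalDenom m d)))

instance : IsDomain (TotalRing m d) :=
  IsLocalization.isDomain_of_le_nonZeroDivisors (M := Submonoid.powers (totalDenom m d)) _
    (powers_le_nonZeroDivisors_of_noZeroDivisors totalDenom_ne_zero)

instance : Algebra.FiniteType ℂ (TotalRing m d) :=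
  inferInstanceAs (Algebra.FiniteType ℂ (Localization.Away (totalDenom m d)))

variable (m d) in
/-- The coordinate with index `i`. -/
noncomputable def coord (i : Option (TotalCoord m d)) : TotalRing m d :=
  algebraMap (MvPolynomial (Option (TotalCoord m d)) ℂ) (TotalRing m d) (X i)

variable (m d) in
/-- The inverse of the coordinate `p j`. -/
noncomputable def pinv (j : Fin m) : TotalRing m d :=
  Ring.inverse (coord m d (some (Sum.inr (Sum.inr (Sum.inl j)))))

theorem isUnit_denom : IsUnit (algebraMap _ (TotalRing m d) (totalDenom m d)) :=
  IsLocalization.Away.algebraMap_isUnit _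

theorem coord_mul_pinv (j : Fin m) :
    coord m d (some (Sum.inr (Sum.inr (Sum.inl j)))) * pinv m d j = 1 := by
  refine Ring.mul_inverse_cancel _ (isUnit_of_dvd_unit ?_ (isUnit_denom (m := m) (d := d)))
  exact map_dvd (algebraMap (MvPolynomial (Option (TotalCoord m d)) ℂ) (TotalRing m d))
    (Dvd.dvd.mul_left (Finset.dvd_prod_of_mem
      (fun j =>
        (X (some (Sum.inr (Sum.inr (Sum.inl j)))) : MvPolynomial (Option (TotalCoord m d)) ℂ))
      (Finset.mem_univ j)) _)

variable (m d) in
/-- The matrix `A` of coordinates. -/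
noncomputable def A (i : Fin d) (j : Fin m) : TotalRing m d := coord m d (some (Sum.inl (i, j)))

variable (m d) in
/-- The dual vector. -/
noncomputable def y (i : Fin d) : TotalRing m d := coord m d (some (Sum.inr (Sum.inl i)))

variable (m d) in
/-- The vector `p`. -/
noncomputable def p (j : Fin m) : TotalRing m d :=
  coord m d (some (Sum.inr (Sum.inr (Sum.inl j))))

variable (m d) in
/-- The normal vector `e` of a hyperplane. -/
noncomputable def e (j : Fin m) : TotalRing m d :=
  coord m d (some (Sum.inr (Sum.inr (Sum.inr j))))

variable (m d) in
/-- The barrier parameter. -/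
noncomputable def lam : TotalRing m d := coord m d none

variable (m d) in
/-- The primal vector. -/
noncomputable def x : Fin m → TotalRing m d := splitAt d (p m d) fun j => lam m d * pinv m d j

variable (m d) in
/-- The vector of slacks. -/
noncomputable def s : Fin m → TotalRing m d := splitAt d (fun j => lam m d * pinv m d j) (p m d)

theorem x_mul_s (j : Fin m) : x m d j * s m d j = lam m d := by
  have h := coord_mul_pinv (d := d) j
  unfold x s splitAt
  split_ifs
  · rw [mul_left_comm, p, h, mul_one]
  · rw [mul_assoc, mul_comm (pinv m d j), p, h, mul_one]

theorem algHom_ext {χ χ' : TotalRing m d →ₐ[ℂ] ℂ} (hA : ∀ i j, χ (A m d i j) = χ' (A m d i j))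
    (hy : ∀ i, χ (y m d i) = χ' (y m d i)) (hx : ∀ j, χ (x m d j) = χ' (x m d j))
    (hs : ∀ j, χ (s m d j) = χ' (s m d j)) (he : ∀ j, χ (e m d j) = χ' (e m d j))
    (hl : χ (lam m d) = χ' (lam m d)) : χ = χ' := by
  have h : (χ : TotalRing m d →+* ℂ) = χ' := by
    refine IsLocalization.ringHom_ext (Submonoid.powers (totalDenom m d)) ?_
    refine MvPolynomial.ringHom_ext (fun r => ?_) ?_
    · simp only [RingHom.comp_apply, RingHom.coe_coe]
      rw [← MvPolynomial.algebraMap_eq, ← IsScalarTower.algebraMap_apply ℂ _ (TotalRing m d)]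
      simp
    · rintro (_ | ⟨i, j⟩ | i | j | j)
      · exact hl
      · exact hA i j
      · exact hy i
      · have h1 := hx j
        have h2 := hs j
        unfold x s splitAt at *
        split_ifs at h1 h2
        · exact h1
        · exact h2
      · exact he j
  exact AlgHom.coe_ringHom_injective h

/-- All tuples `(A, x, s, y, e, lam)` with `x j * s j = lam ≠ 0` are points of the total space. -/
theorem exists_algHom (A' : Fin d → Fin m → ℂ) {x' s' : Fin m → ℂ} (y' : Fin d → ℂ)
    (e' : Fin m → ℂ) {lam' : ℂ} (hlam : lam' ≠ 0) (hxs : ∀ j, x' j * s' j = lam') :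
    ∃ χ : TotalRing m d →ₐ[ℂ] ℂ, (∀ i j, χ (A m d i j) = A' i j) ∧ (∀ i, χ (y m d i) = y' i) ∧
      (∀ j, χ (x m d j) = x' j) ∧ (∀ j, χ (s m d j) = s' j) ∧ (∀ j, χ (e m d j) = e' j) ∧
      χ (lam m d) = lam' := by
  let v : Option (TotalCoord m d) → ℂ := fun o => o.elim lam' (Sum.elim (fun ij => A' ij.1 ij.2)
    (Sum.elim y' (Sum.elim (splitAt d x' s') e')))
  have hne : ∀ j, x' j ≠ 0 ∧ s' j ≠ 0 := fun j => by
    rw [← mul_ne_zero_iff, hxs]; exact hlam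
  have hp : ∀ j, splitAt d x' s' j ≠ 0 := fun j => by
    unfold splitAt; split_ifs
    exacts [(hne j).1, (hne j).2]
  have hunit : IsUnit (aeval (R := ℂ) v (totalDenom m d)) := by
    rw [isUnit_iff_ne_zero, totalDenom, map_mul, map_prod]
    simp only [aeval_X]
    exact mul_ne_zero hlam (Finset.prod_ne_zero_iff.2 fun j _ => hp j)
  let χ : TotalRing m d →ₐ[ℂ] ℂ := IsLocalization.liftAlgHom
    (M := Submonoid.powers (totalDenom m d))
    (f := aeval (R := ℂ) v) (by
      rintro ⟨_, n, rfl⟩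
      rw [map_pow]
      exact hunit.pow n)
  have hχ : ∀ i, χ (coord m d i) = v i := fun i => by
    change IsLocalization.lift _ (algebraMap _ _ _) = _
    rw [IsLocalization.lift_eq]
    simp
  have hinv : ∀ j, χ (pinv m d j) = (splitAt d x' s' j)⁻¹ := fun j => by
    have h1 := congrArg χ (coord_mul_pinv (d := d) j)
    rw [map_mul, hχ, map_one] at h1
    exact eq_inv_of_mul_eq_one_right h1
  refine ⟨χ, fun i j => hχ _, fun i => hχ _, fun j => ?_, fun j => ?_, fun j => hχ _, hχ _⟩
  · unfold x splitAt
    split_ifs with h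
    · rw [p, hχ]; simp [v, splitAt, h]
    · rw [map_mul, lam, hχ, hinv]
      simp only [v, splitAt, h, Option.elim, if_false]
      rw [← hxs j, mul_inv_cancel_right₀ (hne j).2]
  · unfold s splitAt
    split_ifs with h
    · rw [map_mul, lam, hχ, hinv]
      simp only [v, splitAt, h, Option.elim, if_true]
      rw [← hxs j, mul_comm, inv_mul_cancel_left₀ (hne j).1]
    · rw [p, hχ]; simp [v, splitAt, h]

end TotalRing

end TotalSpace

/-! ### Algebraic bases of the total space -/

section TotalSpace

open MvPolynomial

/-- If `T` is algebraic over a polynomial ring with variables `σ`, it is algebraic over any subring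
that contains an algebraically independent family of the same size. -/
theorem AlgebraicIndependent.isAlgebraic_of_card_eq {σ τ T S : Type} [Fintype σ] [Fintype τ]
    [CommRing T] [IsDomain T] [Algebra ℂ T] [Algebra (MvPolynomial σ ℂ) T]
    [IsScalarTower ℂ (MvPolynomial σ ℂ) T] [FaithfulSMul (MvPolynomial σ ℂ) T]
    [Algebra.IsAlgebraic (MvPolynomial σ ℂ) T] {v : τ → T} (hv : AlgebraicIndependent ℂ v)
    (hcard : Fintype.card σ = Fintype.card τ) [CommRing S] [Algebra S T]
    (hS : ∀ c : ℂ, algebraMap ℂ T c ∈ (algebraMap S T).range)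
    (hvS : ∀ i, v i ∈ (algebraMap S T).range) : Algebra.IsAlgebraic S T := by
  have hb : IsTranscendenceBasis ℂ (algebraMap (MvPolynomial σ ℂ) T ∘ X) :=
    (IsTranscendenceBasis.mvPolynomial σ ℂ).algebraMap_comp
  have htr : IsTranscendenceBasis ℂ v := by
    refine hv.isTranscendenceBasis_of_lift_trdeg_le_of_finite ?_
    have h1 := hb.lift_cardinalMk_eq_trdeg
    rw [← h1]
    simp [hcard]
  have halg := htr.isAlgebraic
  have hrange : ∀ a ∈ Algebra.adjoin ℂ (Set.range v), a ∈ (algebraMap S T).range := by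
    intro a ha
    induction ha using Algebra.adjoin_induction with
    | mem a ha => obtain ⟨i, rfl⟩ := ha; exact hvS i
    | algebraMap c => exact hS c
    | add _ _ _ _ h1 h2 => exact add_mem h1 h2
    | mul _ _ _ _ h1 h2 => exact mul_mem h1 h2
  refine ⟨fun t => ?_⟩
  obtain ⟨p, hp, hpt⟩ := halg.isAlgebraic t
  have hlift : p.map (algebraMap (Algebra.adjoin ℂ (Set.range v)) T) ∈
      Polynomial.lifts (algebraMap S T) := by
    rw [Polynomial.lifts_iff_coeff_lifts]
    intro n
    rw [Polynomial.coeff_map]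
    exact hrange _ (p.coeff n).2
  obtain ⟨q, hq⟩ := (Polynomial.mem_lifts _).1 hlift
  refine ⟨q, ?_, ?_⟩
  · rintro rfl
    rw [Polynomial.map_zero] at hq
    exact hp (Polynomial.map_injective (algebraMap (Algebra.adjoin ℂ (Set.range v)) T)
      Subtype.val_injective (by rw [Polynomial.map_zero]; exact hq.symm))
  · rw [← Polynomial.eval_map_algebraMap, hq, Polynomial.eval_map_algebraMap, hpt]

variable {m d : ℕ}

/-- The determinant of the first `d` columns of `A`. -/
noncomputable def basisDet {S : Type*} [CommRing S] (hdm : d ≤ m) (A : Fin d → Fin m → S) : S :=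
  (Matrix.of fun i k => A i (Fin.castLE hdm k)).det

theorem map_basisDet {S S' : Type*} [CommRing S] [CommRing S'] (f : S →+* S') (hdm : d ≤ m)
    (A : Fin d → Fin m → S) : f (basisDet hdm A) = basisDet hdm fun i j => f (A i j) := by
  unfold basisDet
  rw [RingHom.map_det]
  rfl

theorem basisDet_X_ne_zero {σ : Type} {S : Type*} [CommRing S] [Nontrivial S] (hdm : d ≤ m)
    {a : Fin d → Fin m → σ}
    (ha : Function.Injective fun ij : Fin d × Fin m => a ij.1 ij.2) :
    basisDet hdm (fun i j => (X (a i j) : MvPolynomial σ S)) ≠ 0 := by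
  classical
  intro h
  let v : σ → S := fun t => if ∃ i k, t = a i (Fin.castLE hdm k) ∧ i = k then 1 else 0
  have h1 := congrArg (eval v) h
  rw [map_basisDet, map_zero, basisDet] at h1
  have h3 : (Matrix.of fun i k => (eval v (X (a i (Fin.castLE hdm k)) : MvPolynomial σ S))) =
      (1 : Matrix (Fin d) (Fin d) S) := by
    ext i k
    simp only [Matrix.of_apply, eval_X, v, Matrix.one_apply]
    refine if_congr ⟨?_, fun h => ⟨i, k, rfl, h⟩⟩ rfl rfl
    rintro ⟨i', k', h1, h2⟩
    have h4 : (i, Fin.castLE hdm k) = (i', Fin.castLE hdm k') := ha h1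
    simp only [Prod.mk.injEq, Fin.castLE_inj] at h4
    rw [h4.1, h4.2, h2]
  rw [h3, Matrix.det_one] at h1
  exact one_ne_zero h1

theorem sum_mul_splitAt_zero {S : Type*} [CommRing S] (hdm : d ≤ m) (f q : Fin m → S) :
    ∑ j, f j * splitAt d q 0 j = ∑ k, f (Fin.castLE hdm k) * q (Fin.castLE hdm k) := by
  symm
  refine Fintype.sum_of_injective (Fin.castLE hdm) (Fin.castLE_injective hdm) _ _ ?_ ?_
  · intro j hj
    have : ¬ (j : ℕ) < d := fun h => hj ⟨⟨j, h⟩, rfl⟩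
    simp [splitAt, this]
  · intro k; simp [splitAt]

/-- `x` supported on the first `d` indices and a slack supported on the others determine a linear
program for which the pair is optimal; conversely they are determined by the linear program if the
first `d` columns are independent. -/
theorem exists_lpOfPoint_splitAt_eq {K : Type*} [Field K] (hdm : d ≤ m) (A : Fin d → Fin m → K)
    (b : Fin d → K) (c : Fin m → K)
    (hA : basisDet hdm A ≠ 0) :
    ∃ (y : Fin d → K) (p : Fin m → K), lpOfPoint A (splitAt d p 0) (splitAt d 0 p) y =
      Sum.elim (fun ij => A ij.1 ij.2) (Sum.elim b c) := by
  set M := Matrix.of fun i k => A i (Fin.castLE hdm k) with hM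
  have hu : IsUnit M.det := isUnit_iff_ne_zero.2 hA
  let y : Fin d → K := Matrix.vecMul (fun k => c (Fin.castLE hdm k)) M⁻¹
  let xB : Fin d → K := Matrix.mulVec M⁻¹ b
  have hy : ∀ k, ∑ i, y i * A i (Fin.castLE hdm k) = c (Fin.castLE hdm k) := fun k => by
    have : Matrix.vecMul y M k = c (Fin.castLE hdm k) := by
      simp only [y]
      rw [Matrix.vecMul_vecMul, Matrix.nonsing_inv_mul _ hu, Matrix.vecMul_one]
    simpa [Matrix.vecMul, dotProduct, hM] using this
  have hx : ∀ i, ∑ k, A i (Fin.castLE hdm k) * xB k = b i := fun i => by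
    have : Matrix.mulVec M xB i = b i := by
      simp only [xB]
      rw [Matrix.mulVec_mulVec, Matrix.mul_nonsing_inv _ hu, Matrix.one_mulVec]
    simpa [Matrix.mulVec, dotProduct, hM] using this
  refine ⟨y, fun j => if h : (j : ℕ) < d then xB ⟨j, h⟩ else c j - ∑ i, y i * A i j, ?_⟩
  ext (⟨i, j⟩ | i | j)
  · rfl
  · simp only [lpOfPoint, Sum.elim_inr, Sum.elim_inl]
    rw [← hx i, sum_mul_splitAt_zero hdm]
    simp
  · simp only [lpOfPoint, Sum.elim_inr]
    by_cases h : (j : ℕ) < d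
    · simpa [splitAt, h] using hy ⟨j, h⟩
    · simp [splitAt, h]

theorem splitAt_eq_of_lpOfPoint_eq {K : Type*} [Field K] (hdm : d ≤ m) {A : Fin d → Fin m → K}
    (hA : basisDet hdm A ≠ 0) {y y' : Fin d → K}
    {p p' : Fin m → K} (h : lpOfPoint A (splitAt d p 0) (splitAt d 0 p) y =
      lpOfPoint A (splitAt d p' 0) (splitAt d 0 p') y') : y = y' ∧ p = p' := by
  set M := Matrix.of fun i k => A i (Fin.castLE hdm k) with hM
  have hu : IsUnit M := (Matrix.isUnit_iff_isUnit_det _).2 (isUnit_iff_ne_zero.2 hA)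
  have hy : y = y' := by
    apply Matrix.vecMul_injective_of_isUnit hu
    ext k
    have := congrFun h (Sum.inr (Sum.inr (Fin.castLE hdm k)))
    simpa [lpOfPoint, splitAt, Matrix.vecMul, dotProduct, hM] using this
  refine ⟨hy, ?_⟩
  have hB : (fun k => p (Fin.castLE hdm k)) = fun k => p' (Fin.castLE hdm k) := by
    apply Matrix.mulVec_injective_of_isUnit hu
    ext i
    have := congrFun h (Sum.inr (Sum.inl i))
    simp only [lpOfPoint, Sum.elim_inr, Sum.elim_inl, sum_mul_splitAt_zero hdm] at this
    simpa [Matrix.mulVec, dotProduct, hM] using this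
  ext j
  by_cases hj : (j : ℕ) < d
  · exact congrFun hB ⟨j, hj⟩
  · have := congrFun h (Sum.inr (Sum.inr j))
    simpa [lpOfPoint, splitAt, hj, hy] using this

/-- The polynomial functions of a linear program and a vector `e`. -/
abbrev LPRing (m d : ℕ) : Type := MvPolynomial (LPCoord m d ⊕ Fin m) ℂ

/-- The polynomial functions of a linear program and a hyperplane. -/
abbrev CutRing (m d : ℕ) : Type := MvPolynomial (LPCoord m d ⊕ Option (Fin m)) ℂ

namespace TotalRing

variable (m d) in
/-- The linear program of a point of the total space. -/
noncomputable def lp : LPCoord m d → TotalRing m d :=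
  lpOfPoint (A m d) (x m d) (s m d) (y m d)

variable (m d) in
/-- The value `f` for which the hyperplane `e x = f` passes through the point. -/
noncomputable def g : TotalRing m d := ∑ j, e m d j * x m d j

noncomputable instance : Algebra (LPRing m d) (TotalRing m d) :=
  (aeval (R := ℂ) (Sum.elim (lp m d) (e m d))).toRingHom.toAlgebra

theorem algebraMap_lpRing (P : LPRing m d) :
    algebraMap (LPRing m d) (TotalRing m d) P = aeval (Sum.elim (lp m d) (e m d)) P := rfl

instance : IsScalarTower ℂ (LPRing m d) (TotalRing m d) :=
  IsScalarTower.of_algebraMap_eq fun c => by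
    rw [algebraMap_lpRing, AlgHom.commutes]

noncomputable instance : Algebra (Polynomial (LPRing m d)) (TotalRing m d) :=
  (Polynomial.aeval (R := LPRing m d) (lam m d)).toRingHom.toAlgebra

theorem algebraMap_polynomial_lpRing (P : Polynomial (LPRing m d)) :
    algebraMap (Polynomial (LPRing m d)) (TotalRing m d) P = Polynomial.aeval (lam m d) P := rfl

instance : IsScalarTower (LPRing m d) (Polynomial (LPRing m d)) (TotalRing m d) :=
  IsScalarTower.of_algebraMap_eq fun c => by
    rw [algebraMap_polynomial_lpRing, Polynomial.algebraMap_eq, Polynomial.aeval_C]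

noncomputable instance : Algebra (CutRing m d) (TotalRing m d) :=
  (aeval (R := ℂ) (Sum.elim (lp m d) fun o => o.elim (g m d) (e m d))).toRingHom.toAlgebra

theorem algebraMap_cutRing (P : CutRing m d) : algebraMap (CutRing m d) (TotalRing m d) P =
    aeval (Sum.elim (lp m d) fun o => o.elim (g m d) (e m d)) P := rfl

instance : IsScalarTower ℂ (CutRing m d) (TotalRing m d) :=
  IsScalarTower.of_algebraMap_eq fun c => by
    rw [algebraMap_cutRing, AlgHom.commutes]

end TotalRing

end TotalSpace

/-! ### The place of the total space at `lam = 0` -/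

section TotalSpace

open MvPolynomial

theorem map_aeval_apply {σ S S' : Type*} [CommRing S] [CommRing S'] [Algebra ℂ S] [Algebra ℂ S']
    (f : S →+* S') (hf : ∀ c, f (algebraMap ℂ S c) = algebraMap ℂ S' c) (v : σ → S)
    (P : MvPolynomial σ ℂ) : f (aeval v P) = aeval (fun i => f (v i)) P := by
  let f' : S →ₐ[ℂ] S' := { f with commutes' := hf }
  change f' _ = _
  rw [← AlgHom.comp_apply, comp_aeval]
  rfl

variable {m d : ℕ}

/-- The linear program and the vector `e` of a point at `lam = 0`, where `x j = 0` for `j ≥ d` and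
`s j = 0` for `j < d`. -/
def centerPoint {S : Type*} [CommRing S] (q : TotalCoord m d → S) : LPCoord m d ⊕ Fin m → S :=
  Sum.elim (lpOfPoint (fun i j => q (Sum.inl (i, j)))
    (splitAt d (fun j => q (Sum.inr (Sum.inr (Sum.inl j)))) 0)
    (splitAt d 0 fun j => q (Sum.inr (Sum.inr (Sum.inl j)))) fun i => q (Sum.inr (Sum.inl i)))
    fun j => q (Sum.inr (Sum.inr (Sum.inr j)))

theorem map_splitAt {S S' : Type*} [CommRing S] [CommRing S'] (f : S →+* S') (p q : Fin m → S)
    (j : Fin m) : f (splitAt d p q j) = splitAt d (fun j => f (p j)) (fun j => f (q j)) j := by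
  unfold splitAt
  split_ifs <;> rfl

theorem map_centerPoint {S S' : Type*} [CommRing S] [CommRing S'] (f : S →+* S')
    (q : TotalCoord m d → S) (i : LPCoord m d ⊕ Fin m) :
    f (centerPoint q i) = centerPoint (fun i => f (q i)) i := by
  rcases i with i | i
  · simp only [centerPoint, Sum.elim_inl, map_lpOfPoint, map_splitAt, Pi.zero_apply, map_zero]
    rfl
  · rfl

namespace TotalRing

variable (m d) in
/-- The field of rational functions of the coordinates of the total space other than `lam`. -/
abbrev Center : Type := FractionRing (MvPolynomial (TotalCoord m d) ℂ)

variable (m d) in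
/-- The variable with index `i`, as a rational function. -/
noncomputable def centerVar (i : TotalCoord m d) : Center m d :=
  algebraMap (MvPolynomial (TotalCoord m d) ℂ) (Center m d) (X i)

theorem centerVar_ne_zero (i : TotalCoord m d) : centerVar m d i ≠ 0 := by
  unfold centerVar
  rw [Ne, FaithfulSMul.algebraMap_eq_zero_iff]
  exact X_ne_zero i

noncomputable instance : Algebra (LPRing m d) (Center m d) :=
  (aeval (R := ℂ) (centerPoint (centerVar m d))).toRingHom.toAlgebra

theorem algebraMap_center (P : LPRing m d) : algebraMap (LPRing m d) (Center m d) P =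
    aeval (centerPoint (centerVar m d)) P := rfl

/-- Linear programs whose first `d` columns are independent come from points at `lam = 0`; hence a
polynomial vanishing at these points is zero. -/
theorem algebraMap_center_injective (hdm : d ≤ m) :
    Function.Injective (algebraMap (LPRing m d) (Center m d)) := by
  rw [injective_iff_map_eq_zero]
  intro P hP
  let D : LPRing m d := basisDet hdm fun i j => X (Sum.inl (Sum.inl (i, j)))
  have hD : D ≠ 0 := basisDet_X_ne_zero hdm fun a b h => by simpa [Prod.ext_iff] using h
  have hv : aeval (R := ℂ) (centerPoint (X : _ → MvPolynomial (TotalCoord m d) ℂ)) P = 0 := by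
    apply FaithfulSMul.algebraMap_injective (MvPolynomial (TotalCoord m d) ℂ) (Center m d)
    rw [map_zero, ← hP, algebraMap_center,
      map_aeval_apply (algebraMap (MvPolynomial (TotalCoord m d) ℂ) (Center m d))
        (fun c => (IsScalarTower.algebraMap_apply ℂ (MvPolynomial (TotalCoord m d) ℂ) _ c).symm)]
    simp only [map_centerPoint]
    rfl
  suffices P * D = 0 from (mul_eq_zero.1 this).resolve_right hD
  apply MvPolynomial.funext
  intro q
  rw [map_mul, map_zero]
  by_cases hDq : eval q D = 0
  · rw [hDq, mul_zero]
  have hDq' : basisDet hdm (fun i j => q (Sum.inl (Sum.inl (i, j)))) ≠ 0 := by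
    simpa only [D, map_basisDet, eval_X] using hDq
  obtain ⟨y, p, hyp⟩ := exists_lpOfPoint_splitAt_eq hdm _
    (fun i => q (Sum.inl (Sum.inr (Sum.inl i)))) (fun i => q (Sum.inl (Sum.inr (Sum.inr i)))) hDq'
  let w : TotalCoord m d → ℂ := Sum.elim (fun ij => q (Sum.inl (Sum.inl (ij.1, ij.2))))
    (Sum.elim y (Sum.elim p fun j => q (Sum.inr j)))
  have hw : centerPoint w = q := by
    ext (i | i)
    · refine (congrFun hyp i).trans ?_
      rcases i with i | i | i <;> rfl
    · rfl
  have h1 := congrArg (eval w) hv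
  rw [map_zero, map_aeval_apply _ (fun c => by simp [algebraMap_eq])] at h1
  simp only [map_centerPoint, eval_X] at h1
  refine mul_eq_zero_of_left (Eq.trans ?_ h1) _
  rw [← hw]
  rfl

instance [Fact (d ≤ m)] : FaithfulSMul (LPRing m d) (Center m d) :=
  (faithfulSMul_iff_algebraMap_injective _ _).2 (algebraMap_center_injective Fact.out)

/-- A point at `lam = 0` is a rational function of its linear program: by Cramer's rule `x` and `y`
are determined by `A x = b` and `y A = c` on the first `d` columns. -/
theorem isFractionRing_center (hdm : d ≤ m) : IsFractionRing (LPRing m d) (Center m d) := by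
  have : Fact (d ≤ m) := ⟨hdm⟩
  let κ := FractionRing (LPRing m d)
  let φ : κ →+* Center m d := IsFractionRing.lift (algebraMap_center_injective hdm)
  have hφ : ∀ r : LPRing m d, φ (algebraMap _ κ r) = algebraMap _ (Center m d) r := fun r =>
    IsFractionRing.lift_algebraMap _ _
  let q : LPCoord m d ⊕ Fin m → κ := fun i => algebraMap (LPRing m d) κ (X i)
  have hφq : ∀ i, φ (q i) = centerPoint (centerVar m d) i := fun i => by
    rw [hφ, algebraMap_center, aeval_X]
  have hDq' : basisDet hdm (fun i j => q (Sum.inl (Sum.inl (i, j)))) ≠ 0 := by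
    have := map_basisDet (algebraMap (LPRing m d) κ) hdm fun i j => X (Sum.inl (Sum.inl (i, j)))
    rw [← this, Ne, FaithfulSMul.algebraMap_eq_zero_iff]
    exact basisDet_X_ne_zero hdm fun a b h => by simpa [Prod.ext_iff] using h
  obtain ⟨y, p, hyp⟩ := exists_lpOfPoint_splitAt_eq hdm _
    (fun i => q (Sum.inl (Sum.inr (Sum.inl i)))) (fun i => q (Sum.inl (Sum.inr (Sum.inr i)))) hDq'
  let w : TotalCoord m d → κ := Sum.elim (fun ij => q (Sum.inl (Sum.inl (ij.1, ij.2))))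
    (Sum.elim y (Sum.elim p fun j => q (Sum.inr j)))
  have hw : ∀ i, centerPoint w i = q i := by
    rintro (i | i)
    · refine (congrFun hyp i).trans ?_
      rcases i with i | i | i <;> rfl
    · rfl
  have hφw : centerPoint (fun i => φ (w i)) = centerPoint (centerVar m d) := by
    ext i
    rw [← map_centerPoint, hw, hφq]
  have hA : ∀ i j, φ (q (Sum.inl (Sum.inl (i, j)))) = centerVar m d (Sum.inl (i, j)) := fun i j =>
    hφq _
  have hDc : basisDet hdm (fun i j => centerVar m d (Sum.inl (i, j))) ≠ 0 := by
    simp only [← hA]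
    rw [← map_basisDet]
    exact (map_ne_zero φ).2 hDq'
  have huniq : (fun i => φ (y i)) = (fun i => centerVar m d (Sum.inr (Sum.inl i))) ∧
      (fun j => φ (p j)) = fun j => centerVar m d (Sum.inr (Sum.inr (Sum.inl j))) := by
    refine splitAt_eq_of_lpOfPoint_eq hdm hDc ?_
    ext i
    have h1 := congrFun hφw (Sum.inl i)
    simp only [centerPoint, Sum.elim_inl, w, Sum.elim_inr, hA] at h1
    exact h1
  have hvar : ∀ i, ∃ a, φ a = centerVar m d i := by
    rintro (⟨i, j⟩ | i | j | j)
    · exact ⟨_, hA i j⟩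
    · exact ⟨_, congrFun huniq.1 i⟩
    · exact ⟨_, congrFun huniq.2 j⟩
    · exact ⟨_, hφq (Sum.inr j)⟩
  have hpoly : ∀ P : MvPolynomial (TotalCoord m d) ℂ, ∃ a, φ a = algebraMap _ (Center m d) P := by
    intro P
    induction P using MvPolynomial.induction_on with
    | C c =>
      refine ⟨algebraMap (LPRing m d) κ (C c), ?_⟩
      rw [hφ, algebraMap_center, aeval_C, ← MvPolynomial.algebraMap_eq,
        ← IsScalarTower.algebraMap_apply]
    | add P Q hP hQ =>
      obtain ⟨a, ha⟩ := hP
      obtain ⟨b, hb⟩ := hQ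
      exact ⟨a + b, by rw [map_add, map_add, ha, hb]⟩
    | mul_X P i hP =>
      obtain ⟨a, ha⟩ := hP
      obtain ⟨b, hb⟩ := hvar i
      exact ⟨a * b, by rw [map_mul, map_mul, ha, hb]; rfl⟩
  refine IsFractionRing.of_field _ _ fun z => ?_
  obtain ⟨P, Q, -, rfl⟩ := IsFractionRing.div_surjective (A := MvPolynomial (TotalCoord m d) ℂ) z
  obtain ⟨a, ha⟩ := hpoly P
  obtain ⟨b, hb⟩ := hpoly Q
  obtain ⟨r, t, -, hrt⟩ := IsFractionRing.div_surjective (A := LPRing m d) (a / b)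
  refine ⟨r, t, ?_⟩
  rw [← ha, ← hb, ← map_div₀, ← hrt, map_div₀, hφ, hφ]

end TotalRing

end TotalSpace

section TotalSpace

open MvPolynomial

namespace TotalRing

variable {m d : ℕ}

variable (m d) in
/-- The expansion at `lam = 0` of polynomial functions on the total space. -/
noncomputable def polyExpansion :
    MvPolynomial (Option (TotalCoord m d)) ℂ →+* PowerSeries (Center m d) :=
  (Polynomial.coeToPowerSeries.ringHom.comp (Polynomial.mapRingHom
    (algebraMap (MvPolynomial (TotalCoord m d) ℂ) (Center m d)))).comp
      (optionEquivLeft ℂ (TotalCoord m d)).toRingEquiv.toRingHom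

theorem polyExpansion_injective : Function.Injective (polyExpansion m d) := by
  have h1 : Function.Injective (Polynomial.coeToPowerSeries.ringHom (R := Center m d)) :=
    Polynomial.coe_injective _
  have h2 : Function.Injective (Polynomial.mapRingHom
      (algebraMap (MvPolynomial (TotalCoord m d) ℂ) (Center m d))) :=
    Polynomial.map_injective _ (FaithfulSMul.algebraMap_injective _ _)
  exact (h1.comp h2).comp (optionEquivLeft ℂ (TotalCoord m d)).injective

theorem polyExpansion_X_none : polyExpansion m d (X none) = PowerSeries.X := by
  simp [polyExpansion]

theorem polyExpansion_X_some (i : TotalCoord m d) :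
    polyExpansion m d (X (some i)) = PowerSeries.C (centerVar m d i) := by
  simp [polyExpansion, centerVar]

theorem polyExpansion_C (c : ℂ) :
    polyExpansion m d (C c) = algebraMap ℂ _ c := by
  simp [polyExpansion, optionEquivLeft_C, PowerSeries.algebraMap_apply]
  rfl

variable (m d) in
/-- The expansion at `lam = 0` of functions on the total space. -/
noncomputable def expansion : TotalRing m d →+* LaurentSeries (Center m d) :=
  IsLocalization.lift (M := Submonoid.powers (totalDenom m d))
    (g := (algebraMap (PowerSeries (Center m d)) (LaurentSeries (Center m d))).comp
      (polyExpansion m d)) <| by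
    rintro ⟨_, n, rfl⟩
    have h : algebraMap (PowerSeries (Center m d)) (LaurentSeries (Center m d))
        (polyExpansion m d (totalDenom m d ^ n)) ≠ 0 := by
      rw [Ne, FaithfulSMul.algebraMap_eq_zero_iff, map_eq_zero_iff _ polyExpansion_injective]
      exact pow_ne_zero n totalDenom_ne_zero
    exact IsUnit.mk0 (G₀ := LaurentSeries (Center m d)) _ h

theorem expansion_algebraMap (P : MvPolynomial (Option (TotalCoord m d)) ℂ) :
    expansion m d (algebraMap _ _ P) =
      algebraMap (PowerSeries (Center m d)) (LaurentSeries (Center m d)) (polyExpansion m d P) :=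
  IsLocalization.lift_eq _ _

theorem expansion_injective : Function.Injective (expansion m d) := by
  rw [injective_iff_map_eq_zero]
  intro t ht
  obtain ⟨P, s, rfl⟩ := IsLocalization.exists_mk'_eq (Submonoid.powers (totalDenom m d)) t
  have h1 : expansion m d (algebraMap _ _ P) = 0 := by
    rw [← IsLocalization.mk'_spec (TotalRing m d) P s, map_mul, ht, zero_mul]
  rw [expansion_algebraMap, FaithfulSMul.algebraMap_eq_zero_iff,
    map_eq_zero_iff _ polyExpansion_injective] at h1
  rw [h1, IsLocalization.mk'_zero]

theorem expansion_algebraMap_complex (c : ℂ) : expansion m d (algebraMap ℂ _ c) =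
    algebraMap (PowerSeries (Center m d)) (LaurentSeries (Center m d)) (algebraMap ℂ _ c) := by
  rw [IsScalarTower.algebraMap_apply ℂ (MvPolynomial (Option (TotalCoord m d)) ℂ),
    expansion_algebraMap, MvPolynomial.algebraMap_eq, polyExpansion_C]

/-- The inclusion of power series in Laurent series. -/
local notation "ser" => algebraMap (PowerSeries (Center m d)) (LaurentSeries (Center m d))

theorem expansion_lam : expansion m d (lam m d) = ser PowerSeries.X := by
  rw [lam, coord, expansion_algebraMap, polyExpansion_X_none]

theorem expansion_coord (i : TotalCoord m d) :
    expansion m d (coord m d (some i)) = ser (PowerSeries.C (centerVar m d i)) := by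
  rw [coord, expansion_algebraMap, polyExpansion_X_some]

theorem expansion_pinv (j : Fin m) : expansion m d (pinv m d j) =
    ser (PowerSeries.C (centerVar m d (Sum.inr (Sum.inr (Sum.inl j))))⁻¹) := by
  have h1 := congrArg (expansion m d) (coord_mul_pinv (d := d) j)
  rw [map_mul, expansion_coord, map_one] at h1
  have h2 : ser (PowerSeries.C (centerVar m d (Sum.inr (Sum.inr (Sum.inl j))))) *
      ser (PowerSeries.C (centerVar m d (Sum.inr (Sum.inr (Sum.inl j))))⁻¹) = 1 := by
    rw [← map_mul, ← map_mul, mul_inv_cancel₀ (centerVar_ne_zero _), map_one, map_one]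
  exact mul_left_cancel₀ (left_ne_zero_of_mul_eq_one h1) (h1.trans h2.symm)

variable (m d) in
/-- The expansion of `x`. -/
noncomputable def seriesX : Fin m → PowerSeries (Center m d) :=
  splitAt d (fun j => PowerSeries.C (centerVar m d (Sum.inr (Sum.inr (Sum.inl j)))))
    fun j => PowerSeries.X * PowerSeries.C (centerVar m d (Sum.inr (Sum.inr (Sum.inl j))))⁻¹

variable (m d) in
/-- The expansion of `s`. -/
noncomputable def seriesS : Fin m → PowerSeries (Center m d) :=
  splitAt d (fun j =>
    PowerSeries.X * PowerSeries.C (centerVar m d (Sum.inr (Sum.inr (Sum.inl j))))⁻¹)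
    fun j => PowerSeries.C (centerVar m d (Sum.inr (Sum.inr (Sum.inl j))))

theorem expansion_x (j : Fin m) : expansion m d (x m d j) = ser (seriesX m d j) := by
  unfold x seriesX
  rw [map_splitAt, map_splitAt]
  congr 1 <;> funext j
  · exact expansion_coord _
  · rw [map_mul, expansion_lam, expansion_pinv, map_mul]

theorem expansion_s (j : Fin m) : expansion m d (s m d j) = ser (seriesS m d j) := by
  unfold s seriesS
  rw [map_splitAt, map_splitAt]
  congr 1 <;> funext j
  · rw [map_mul, expansion_lam, expansion_pinv, map_mul]
  · exact expansion_coord _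

variable (m d) in
/-- The expansion of the linear program and the vector `e` of a point. -/
noncomputable def seriesPoint : LPCoord m d ⊕ Fin m → PowerSeries (Center m d) :=
  Sum.elim (lpOfPoint (fun i j => PowerSeries.C (centerVar m d (Sum.inl (i, j)))) (seriesX m d)
    (seriesS m d) fun i => PowerSeries.C (centerVar m d (Sum.inr (Sum.inl i))))
    fun j => PowerSeries.C (centerVar m d (Sum.inr (Sum.inr (Sum.inr j))))

theorem expansion_point (i : LPCoord m d ⊕ Fin m) :
    expansion m d (Sum.elim (lp m d) (e m d) i) = ser (seriesPoint m d i) := by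
  rcases i with i | j
  · simp only [Sum.elim_inl, lp, map_lpOfPoint, seriesPoint, expansion_x, expansion_s, A, y,
      expansion_coord]
  · exact expansion_coord _

theorem constantCoeff_seriesX (j : Fin m) : PowerSeries.constantCoeff (seriesX m d j) =
    splitAt d (fun j => centerVar m d (Sum.inr (Sum.inr (Sum.inl j)))) 0 j := by
  unfold seriesX splitAt
  split_ifs <;> simp

theorem constantCoeff_seriesS (j : Fin m) : PowerSeries.constantCoeff (seriesS m d j) =
    splitAt d 0 (fun j => centerVar m d (Sum.inr (Sum.inr (Sum.inl j)))) j := by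
  unfold seriesS splitAt
  split_ifs <;> simp

theorem constantCoeff_seriesPoint (i : LPCoord m d ⊕ Fin m) :
    PowerSeries.constantCoeff (seriesPoint m d i) = centerPoint (centerVar m d) i := by
  rcases i with i | j
  · simp only [seriesPoint, Sum.elim_inl, map_lpOfPoint, centerPoint, constantCoeff_seriesX,
      constantCoeff_seriesS, PowerSeries.constantCoeff_C]
  · simp [seriesPoint, centerPoint]

theorem expansion_lpRing (P : LPRing m d) : expansion m d (algebraMap (LPRing m d) _ P) =
    ser (aeval (R := ℂ) (seriesPoint m d) P) := by
  rw [algebraMap_lpRing, aeval_def, aeval_def, hom_eval₂, hom_eval₂]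
  congr 1
  · ext1 c
    exact expansion_algebraMap_complex c
  · funext i
    exact expansion_point i

theorem constantCoeff_aeval_seriesPoint (P : LPRing m d) :
    PowerSeries.constantCoeff (aeval (R := ℂ) (seriesPoint m d) P) =
      algebraMap (LPRing m d) (Center m d) P := by
  rw [map_aeval_apply _ (fun c => by simp [PowerSeries.algebraMap_apply]), algebraMap_center]
  simp only [constantCoeff_seriesPoint]

theorem algebraMap_lpRing_injective (hdm : d ≤ m) :
    Function.Injective (algebraMap (LPRing m d) (TotalRing m d)) := by
  refine fun P Q h => algebraMap_center_injective hdm ?_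
  have h1 := congrArg (expansion m d) h
  rw [expansion_lpRing, expansion_lpRing] at h1
  rw [← constantCoeff_aeval_seriesPoint, ← constantCoeff_aeval_seriesPoint,
    FaithfulSMul.algebraMap_injective _ _ h1]

/-- A nonzero function on the total space that vanishes at `lam = 0` is transcendental over the
functions of the linear program and `e`. -/
theorem transcendental_of_constantCoeff_eq_zero (hdm : d ≤ m) {t : TotalRing m d} (ht : t ≠ 0)
    {f : PowerSeries (Center m d)} (hf : expansion m d t = ser f)
    (hf0 : PowerSeries.constantCoeff f = 0) : Transcendental (LPRing m d) t := by
  intro halg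
  have : Fact (d ≤ m) := ⟨hdm⟩
  refine ht (FaithfulSMul.algebraMap_injective (TotalRing m d) (FractionRing (TotalRing m d)) ?_)
  rw [map_zero]
  exact eq_zero_of_isAlgebraic_of_constantCoeff_eq_zero
    (ps := (aeval (R := ℂ) (seriesPoint m d)).toRingHom) expansion_injective
    expansion_lpRing constantCoeff_aeval_seriesPoint halg.algebraMap hf0
    ((IsFractionRing.lift_algebraMap _ _).trans hf)

/-- The field of rational functions of the linear program and `e` is algebraically closed in the
function field of the total space, as it is the residue field at `lam = 0`. -/
theorem exists_eq_of_isAlgebraic (hdm : d ≤ m) {a : FractionRing (TotalRing m d)}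
    (ha : IsAlgebraic (LPRing m d) a) : ∃ b c : LPRing m d, c ≠ 0 ∧
      algebraMap _ (FractionRing (TotalRing m d)) c * a = algebraMap _ _ b := by
  have := isFractionRing_center hdm
  exact exists_eq_of_isAlgebraic_of_place
    (ps := (aeval (R := ℂ) (seriesPoint m d)).toRingHom) expansion_injective
    expansion_lpRing constantCoeff_aeval_seriesPoint ha

theorem transcendental_lam (hdm : d ≤ m) : Transcendental (LPRing m d) (lam m d) :=
  transcendental_of_constantCoeff_eq_zero hdm
    (fun h => X_ne_zero _ (polyExpansion_injective (FaithfulSMul.algebraMap_injective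
      (PowerSeries (Center m d)) (LaurentSeries (Center m d))
        (by rw [← expansion_algebraMap]; exact (congrArg _ h).trans (by simp)))))
    expansion_lam PowerSeries.constantCoeff_X

/-- The function `e x` on the central curve is not constant: with `x_B` the value of `x` at
`lam = 0` as a function of the linear program, `e x - e_B x_B` vanishes at `lam = 0`, but not
everywhere. -/
theorem transcendental_g (hdm : d < m) : Transcendental (LPRing m d) (g m d) := by
  let M : Matrix (Fin d) (Fin d) (LPRing m d) :=
    Matrix.of fun i k => X (Sum.inl (Sum.inl (i, Fin.castLE hdm.le k)))
  let h : LPRing m d := ∑ k, X (Sum.inr (Fin.castLE hdm.le k)) *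
    Matrix.mulVec M.adjugate (fun i => X (Sum.inl (Sum.inr (Sum.inl i)))) k
  have hne : algebraMap _ (TotalRing m d) M.det * g m d - algebraMap _ _ h ≠ 0 := by
    intro h0
    -- At the point with `A = (1 0)`, `x = s = 1` and `e` the unit vector `d`, the function is `1`.
    obtain ⟨χ, hA, hy, hx, hs, he, hl⟩ := exists_algHom (m := m) (d := d)
      (fun i j => if (i : ℕ) = j then 1 else 0) (x' := 1) (s' := 1) 0
      (fun j => if (j : ℕ) = d then 1 else 0) one_ne_zero (fun j => by simp)
    have h1 := congrArg χ h0
    have hdet : χ (algebraMap _ (TotalRing m d) M.det) = 1 := by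
      have h2 := RingHom.map_det (χ.toRingHom.comp (algebraMap (LPRing m d) (TotalRing m d))) M
      refine h2.trans (Eq.trans ?_ (Matrix.det_one (n := Fin d) (R := ℂ)))
      congr 1
      ext i k
      simp only [RingHom.mapMatrix_apply, Matrix.map_apply, M, Matrix.of_apply, RingHom.comp_apply,
        algebraMap_lpRing, aeval_X, Sum.elim_inl, lp, lpOfPoint]
      refine (hA _ _).trans ?_
      simp [Matrix.one_apply, Fin.ext_iff]
    have hh : χ (algebraMap _ (TotalRing m d) h) = 0 := by
      simp only [h, map_sum, map_mul]
      refine Finset.sum_eq_zero fun k _ => mul_eq_zero_of_left ?_ _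
      rw [algebraMap_lpRing, aeval_X, Sum.elim_inr, he]
      simp [k.2.ne]
    have hg : χ (g m d) = 1 := by
      simp only [g, map_sum, map_mul, he, hx, Pi.one_apply, mul_one]
      rw [Finset.sum_eq_single ⟨d, hdm⟩]
      · simp
      · intro j _ hj
        simp [Fin.ext_iff] at hj
        simp [hj]
      · simp
    rw [map_sub, map_mul, hdet, hg, hh, map_zero] at h1
    norm_num at h1
  have htr := transcendental_of_constantCoeff_eq_zero hdm.le hne
    (f := aeval (R := ℂ) (seriesPoint m d) M.det *
      (∑ j, PowerSeries.C (centerVar m d (Sum.inr (Sum.inr (Sum.inr j)))) * seriesX m d j) -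
      aeval (R := ℂ) (seriesPoint m d) h) ?_ ?_
  · exact fun halg => htr (((isAlgebraic_algebraMap _).mul halg).sub (isAlgebraic_algebraMap _))
  · rw [map_sub, map_mul, expansion_lpRing, expansion_lpRing, map_sub, map_mul]
    congr 2
    simp only [g, map_sum, map_mul, expansion_x, e, expansion_coord]
  · rw [map_sub, map_mul, constantCoeff_aeval_seriesPoint, constantCoeff_aeval_seriesPoint, map_sum]
    simp only [map_mul, PowerSeries.constantCoeff_C, constantCoeff_seriesX]
    rw [sum_mul_splitAt_zero hdm.le, sub_eq_zero, Finset.mul_sum, map_sum]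
    refine Finset.sum_congr rfl fun k _ => ?_
    have hb : (fun i => algebraMap (LPRing m d) (Center m d) (X (Sum.inl (Sum.inr (Sum.inl i))))) =
        Matrix.mulVec ((algebraMap (LPRing m d) (Center m d)).mapMatrix M)
          fun k => centerVar m d (Sum.inr (Sum.inr (Sum.inl (Fin.castLE hdm.le k)))) := by
      funext i
      simp only [algebraMap_center, aeval_X, centerPoint, Sum.elim_inl, lpOfPoint, Sum.elim_inr,
        sum_mul_splitAt_zero hdm.le, Matrix.mulVec, dotProduct, RingHom.mapMatrix_apply,
        Matrix.map_apply, M, Matrix.of_apply]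
    rw [map_mul, RingHom.map_mulVec, RingHom.map_det]
    have hadj := RingHom.map_adjugate (algebraMap (LPRing m d) (Center m d)) M
    rw [RingHom.mapMatrix_apply] at hadj
    have hb' : (⇑(algebraMap (LPRing m d) (Center m d)) ∘
        fun i => X (Sum.inl (Sum.inr (Sum.inl i)))) = _ := hb
    rw [hadj, hb', Matrix.mulVec_mulVec, Matrix.adjugate_mul, Matrix.smul_mulVec,
      Matrix.one_mulVec, Pi.smul_apply, smul_eq_mul]
    rw [algebraMap_center (X _), aeval_X]
    simp only [centerPoint, Sum.elim_inr]
    ring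

end TotalRing

end TotalSpace

/-! ### Generic central curves and their hyperplane sections -/

section TotalSpace

open MvPolynomial

namespace TotalRing

variable {m d : ℕ}

instance : FaithfulSMul (MvPolynomial (Option (TotalCoord m d)) ℂ) (TotalRing m d) :=
  (faithfulSMul_iff_algebraMap_injective _ _).2 <| IsLocalization.injective _
    (powers_le_nonZeroDivisors_of_noZeroDivisors totalDenom_ne_zero)

instance : Algebra.IsAlgebraic (MvPolynomial (Option (TotalCoord m d)) ℂ) (TotalRing m d) :=
  IsLocalization.isAlgebraic _ (Submonoid.powers (totalDenom m d))

theorem algebraicIndependent_point (hdm : d ≤ m) :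
    AlgebraicIndependent ℂ (Sum.elim (lp m d) (e m d)) := algebraMap_lpRing_injective hdm

theorem algebraicIndependent_option (hdm : d ≤ m) {t : TotalRing m d}
    (ht : Transcendental (LPRing m d) t) :
    AlgebraicIndependent ℂ fun o : Option _ => o.elim t (Sum.elim (lp m d) (e m d)) := by
  rw [(algebraicIndependent_point hdm).option_iff_transcendental]
  exact (transcendental_ringHom_iff_of_comp_eq (algebraicIndependent_point hdm).aevalEquiv
    (RingHom.id (TotalRing m d)) Function.injective_id
    (RingHom.ext fun P => (algebraicIndependent_point hdm).algebraMap_aevalEquiv P)).2 ht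

theorem faithfulSMul_polynomial_lpRing (hdm : d ≤ m) :
    FaithfulSMul (Polynomial (LPRing m d)) (TotalRing m d) :=
  (faithfulSMul_iff_algebraMap_injective _ _).2 (transcendental_iff_injective.1
    (transcendental_lam hdm))

theorem isAlgebraic_polynomial_lpRing (hdm : d ≤ m) :
    Algebra.IsAlgebraic (Polynomial (LPRing m d)) (TotalRing m d) := by
  refine (algebraicIndependent_option hdm (transcendental_lam hdm)).isAlgebraic_of_card_eq
    (σ := Option (TotalCoord m d)) ?_ ?_ ?_
  · simp; ring
  · intro c
    refine ⟨Polynomial.C (C c), ?_⟩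
    rw [algebraMap_polynomial_lpRing, Polynomial.aeval_C, algebraMap_lpRing, aeval_C]
  · rintro (_ | i)
    · exact ⟨Polynomial.X, Polynomial.aeval_X _⟩
    · refine ⟨Polynomial.C (X i), ?_⟩
      rw [algebraMap_polynomial_lpRing, Polynomial.aeval_C, algebraMap_lpRing, aeval_X]
      rfl

theorem algebraicIndependent_cut (hdm : d < m) :
    AlgebraicIndependent ℂ
      (Sum.elim (lp m d) fun o : Option (Fin m) => o.elim (g m d) (e m d)) := by
  let E : LPCoord m d ⊕ Option (Fin m) → Option (LPCoord m d ⊕ Fin m) :=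
    Sum.elim (fun i => some (Sum.inl i)) fun o => o.elim none fun j => some (Sum.inr j)
  have hE : Function.Injective E := by
    rintro (i | _ | i) (j | _ | j) h <;> simp_all [E]
  convert (algebraicIndependent_option hdm.le (transcendental_g hdm)).comp E hE using 1
  ext (i | _ | i) <;> rfl

theorem faithfulSMul_cutRing (hdm : d < m) : FaithfulSMul (CutRing m d) (TotalRing m d) :=
  (faithfulSMul_iff_algebraMap_injective _ _).2 (algebraicIndependent_cut hdm)

/-- The projection of the total space to linear programs with a hyperplane is generically finite: it
is dominant, and both have the same dimension. -/
theorem isAlgebraic_cutRing (hdm : d < m) : Algebra.IsAlgebraic (CutRing m d) (TotalRing m d) := by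
  refine (algebraicIndependent_cut hdm).isAlgebraic_of_card_eq
    (σ := Option (TotalCoord m d)) ?_ ?_ ?_
  · simp; ring
  · intro c
    refine ⟨C c, ?_⟩
    rw [algebraMap_cutRing, aeval_C]
  · intro i
    refine ⟨X i, ?_⟩
    rw [algebraMap_cutRing, aeval_X]

end TotalRing

variable {m d : ℕ}

/-- The slack vector `c - y A` of the point `q = (x, y)`. -/
def slack {K : Type*} [CommRing K] (θ : LPCoord m d → K) (q : Fin m ⊕ Fin d → K) (j : Fin m) : K :=
  θ (Sum.inr (Sum.inr j)) - ∑ i, q (Sum.inr i) * θ (Sum.inl (i, j))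

/-- The points `(x, y)` with `A x = b` and `x j * (c - y A) j = lam` for all `j`. -/
def centralEquations {K : Type*} [CommRing K] (θ : LPCoord m d → K) (lam : K) :
    Set (Fin m ⊕ Fin d → K) :=
  {q | (∀ j, q (Sum.inl j) * slack θ q j = lam) ∧
    ∀ i, ∑ j, θ (Sum.inl (i, j)) * q (Sum.inl j) = θ (Sum.inr (Sum.inl i))}

/-- The complex points `(x, y)` of the central curve that belong to nonzero values of `lam`. -/
def centralPoints (θ : LPCoord m d → ℂ) : Set (Fin m ⊕ Fin d → ℂ) :=
  {q | ∃ lam ≠ 0, q ∈ centralEquations θ lam}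

/-- The points `(x, y)` of the central curve over those of a hyperplane. -/
def centralSection (p : LPCoord m d ⊕ Option (Fin m) → ℂ) : Set (Fin m ⊕ Fin d → ℂ) :=
  {q ∈ centralPoints fun i => p (Sum.inl i) |
    ∑ j, p (Sum.inr (some j)) * q (Sum.inl j) = p (Sum.inr none)}

namespace TotalRing

/-- The point `(x, y)` of a point of the total space. -/
noncomputable def pair (χ : TotalRing m d →ₐ[ℂ] ℂ) : Fin m ⊕ Fin d → ℂ :=
  fun i => χ (Sum.elim (x m d) (y m d) i)

theorem mem_fibrePoints_lpRing {p : LPCoord m d ⊕ Fin m → ℂ} {χ : TotalRing m d →ₐ[ℂ] ℂ} :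
    χ ∈ fibrePoints _ (TotalRing m d) p ↔ ∀ i, χ (Sum.elim (lp m d) (e m d) i) = p i := by
  constructor
  · intro h i
    have := h (X i)
    rwa [algebraMap_lpRing, aeval_X, eval_X] at this
  · intro h P
    have := map_aeval_apply (χ : TotalRing m d →+* ℂ) (fun c => by simp)
      (Sum.elim (lp m d) (e m d)) P
    refine this.trans ?_
    simp only [RingHom.coe_coe, h]
    rfl

theorem mem_fibrePoints_cutRing {p : LPCoord m d ⊕ Option (Fin m) → ℂ}
    {χ : TotalRing m d →ₐ[ℂ] ℂ} : χ ∈ fibrePoints _ (TotalRing m d) p ↔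
      ∀ i, χ (Sum.elim (lp m d) (fun o => o.elim (g m d) (e m d)) i) = p i := by
  constructor
  · intro h i
    have := h (X i)
    rwa [algebraMap_cutRing, aeval_X, eval_X] at this
  · intro h P
    have := map_aeval_apply (χ : TotalRing m d →+* ℂ) (fun c => by simp)
      (Sum.elim (lp m d) fun o => o.elim (g m d) (e m d)) P
    refine this.trans ?_
    simp only [RingHom.coe_coe, h]
    rfl

theorem apply_lp (χ : TotalRing m d →ₐ[ℂ] ℂ) (i : LPCoord m d) : χ (lp m d i) =
    lpOfPoint (fun i j => χ (A m d i j)) (fun j => χ (x m d j)) (fun j => χ (s m d j))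
      (fun i => χ (y m d i)) i :=
  map_lpOfPoint (χ : TotalRing m d →+* ℂ) _ _ _ _ _

theorem slack_pair (χ : TotalRing m d →ₐ[ℂ] ℂ) (j : Fin m) :
    slack (fun i => χ (lp m d i)) (pair χ) j = χ (s m d j) := by
  simp [slack, apply_lp, lpOfPoint, pair]

theorem pair_mem_centralEquations (χ : TotalRing m d →ₐ[ℂ] ℂ) :
    pair χ ∈ centralEquations (fun i => χ (lp m d i)) (χ (lam m d)) := by
  refine ⟨fun j => ?_, fun i => ?_⟩
  · rw [slack_pair, ← x_mul_s j, map_mul]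
    rfl
  · simp [apply_lp, lpOfPoint, pair]

theorem apply_lam_ne_zero (χ : TotalRing m d →ₐ[ℂ] ℂ) : χ (lam m d) ≠ 0 := by
  have h : IsUnit (lam m d) := isUnit_of_dvd_unit
    (map_dvd (algebraMap (MvPolynomial (Option (TotalCoord m d)) ℂ) (TotalRing m d))
      (Dvd.intro _ rfl)) isUnit_denom
  exact (h.map χ).ne_zero

theorem exists_pair_eq {θ : LPCoord m d → ℂ} {q : Fin m ⊕ Fin d → ℂ} (hq : q ∈ centralPoints θ)
    (v : Fin m → ℂ) : ∃ χ : TotalRing m d →ₐ[ℂ] ℂ, pair χ = q ∧ (∀ i, χ (lp m d i) = θ i) ∧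
      ∀ j, χ (e m d j) = v j := by
  obtain ⟨lam', hlam, hxs, hb⟩ := hq
  obtain ⟨χ, hA, hy, hx, hs, he, hl⟩ := exists_algHom (m := m) (d := d)
    (fun i j => θ (Sum.inl (i, j))) (fun i => q (Sum.inr i)) v hlam hxs
  refine ⟨χ, ?_, ?_, he⟩
  · ext (j | i)
    · exact hx j
    · exact hy i
  · intro i
    rw [apply_lp]
    simp only [hA, hx, hs, hy]
    rcases i with ⟨i, j⟩ | i | j
    · rfl
    · exact hb i
    · simp [lpOfPoint, slack]

theorem pair_injOn (hdm : d < m) (p : LPCoord m d ⊕ Option (Fin m) → ℂ) :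
    Set.InjOn pair (fibrePoints _ (TotalRing m d) p) := by
  intro χ hχ χ' hχ' h
  rw [mem_fibrePoints_cutRing] at hχ hχ'
  have hlp : ∀ i, χ (lp m d i) = χ' (lp m d i) := fun i =>
    (hχ (Sum.inl i)).trans (hχ' (Sum.inl i)).symm
  have hs : ∀ j, χ (s m d j) = χ' (s m d j) := fun j => by
    rw [← slack_pair, ← slack_pair, h]
    simp only [hlp]
  have hx : ∀ j, χ (x m d j) = χ' (x m d j) := fun j => congrFun h (Sum.inl j)
  refine algHom_ext (fun i j => hlp (Sum.inl (i, j))) (fun i => congrFun h (Sum.inr i)) hx hs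
    (fun j => (hχ (Sum.inr (some j))).trans (hχ' (Sum.inr (some j))).symm) ?_
  rw [← x_mul_s ⟨d, hdm⟩, map_mul, map_mul, hx, hs]

theorem image_pair (p : LPCoord m d ⊕ Option (Fin m) → ℂ) :
    pair '' fibrePoints _ (TotalRing m d) p = centralSection p := by
  ext q
  constructor
  · rintro ⟨χ, hχ, rfl⟩
    rw [mem_fibrePoints_cutRing] at hχ
    have hlp : (fun i => p (Sum.inl i)) = fun i => χ (lp m d i) := funext fun i =>
      (hχ (Sum.inl i)).symm
    refine ⟨⟨χ (lam m d), apply_lam_ne_zero χ, ?_⟩, ?_⟩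
    · rw [hlp]
      exact pair_mem_centralEquations χ
    · rw [← hχ (Sum.inr none)]
      simp only [← hχ (Sum.inr (some _))]
      simp [pair, g]
  · rintro ⟨hq, hg⟩
    obtain ⟨χ, rfl, hlp, he⟩ := exists_pair_eq hq fun j => p (Sum.inr (some j))
    refine ⟨χ, mem_fibrePoints_cutRing.2 ?_, rfl⟩
    rintro (i | _ | j)
    · exact hlp i
    · rw [← hg]
      simp only [← he]
      simp [pair, g]
    · exact he j

end TotalRing

/-- The central curve of a generic linear program has a constant number of points on a generic
hyperplane, and is irreducible to the extent that polynomials vanishing on infinitely many of its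
points vanish at those on the hyperplane. -/
theorem exists_generic_centralSection (hdm : d < m) : ∃ (n : ℕ) (F : CutRing m d), F ≠ 0 ∧
    ∀ p, eval p F ≠ 0 → (centralSection p).encard = n ∧
      ∀ Y ⊆ centralPoints (fun i => p (Sum.inl i)),
        (∀ j, ((fun q => q (Sum.inl j) * slack (fun i => p (Sum.inl i)) q j) '' Y).Infinite) →
        ∀ Q : MvPolynomial (Fin m ⊕ Fin d) ℂ, (∀ q ∈ Y, eval q Q = 0) →
          ∀ q ∈ centralSection p, eval q Q = 0 := by
  have := TotalRing.faithfulSMul_cutRing hdm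
  have := TotalRing.isAlgebraic_cutRing hdm
  have := TotalRing.faithfulSMul_polynomial_lpRing hdm.le
  have := TotalRing.isAlgebraic_polynomial_lpRing hdm.le
  obtain ⟨n, F, hF, hn⟩ := exists_encard_fibrePoints (ι := LPCoord m d ⊕ Option (Fin m))
    (T := TotalRing m d)
  obtain ⟨u, hu, hirr⟩ := exists_forall_apply_eq_zero_of_infinite (ι := LPCoord m d ⊕ Fin m)
    (T := TotalRing m d) fun a ha => TotalRing.exists_eq_of_isAlgebraic hdm.le ha
  obtain ⟨G, hG, hGu⟩ := exists_forall_fibrePoints_apply_ne_zero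
    (ι := LPCoord m d ⊕ Option (Fin m)) hu
  refine ⟨n, F * G, mul_ne_zero hF hG, fun p hp => ?_⟩
  rw [map_mul] at hp
  refine ⟨?_, fun Y hY hinf Q hQ q hq => ?_⟩
  · rw [← TotalRing.image_pair, (TotalRing.pair_injOn hdm p).encard_image]
    exact hn p (left_ne_zero_of_mul hp)
  -- On the whole curve, `lam` is the product `x j * s j` for any one index `j`.
  let j : Fin m := ⟨d, hdm⟩
  rw [← TotalRing.image_pair] at hq
  obtain ⟨χ, hχ, rfl⟩ := hq
  have hχu := hGu p (right_ne_zero_of_mul hp) χ hχ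
  rw [TotalRing.mem_fibrePoints_cutRing] at hχ
  let p' : LPCoord m d ⊕ Fin m → ℂ :=
    Sum.elim (fun i => p (Sum.inl i)) fun j => p (Sum.inr (some j))
  have hχ' : χ ∈ fibrePoints _ (TotalRing m d) p' := by
    rw [TotalRing.mem_fibrePoints_lpRing]
    rintro (i | j)
    · exact hχ (Sum.inl i)
    · exact hχ (Sum.inr (some j))
  let t : TotalRing m d := aeval (Sum.elim (TotalRing.x m d) (TotalRing.y m d)) Q
  have ht : ∀ χ : TotalRing m d →ₐ[ℂ] ℂ, χ t = eval (TotalRing.pair χ) Q := fun χ =>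
    map_aeval_apply (χ : TotalRing m d →+* ℂ) (fun c => by simp) _ Q
  rw [← ht]
  refine hirr p' {χ ∈ fibrePoints _ (TotalRing m d) p' | TotalRing.pair χ ∈ Y} (fun _ h => h.1) ?_ t
    (fun χ hχ => (ht χ).trans (hQ _ hχ.2)) χ hχ' hχu
  refine (hinf j).mono ?_
  rintro _ ⟨q, hq, rfl⟩
  obtain ⟨χ, rfl, hlp, he⟩ := TotalRing.exists_pair_eq (hY hq) fun j => p (Sum.inr (some j))
  refine ⟨χ, ⟨TotalRing.mem_fibrePoints_lpRing.2 ?_, hq⟩, ?_⟩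
  · rintro (i | j)
    · exact hlp i
    · exact he j
  · simp only [← hlp]
    rw [TotalRing.slack_pair, TotalRing.algebraMap_polynomial_lpRing, Polynomial.aeval_X,
      ← TotalRing.x_mul_s j, map_mul]
    rfl

end TotalSpace

/-! ### Generic conditions -/

section Generic

open MvPolynomial

theorem ForGeneric.and {σ K : Type} [Field K] {P Q : (σ → K) → Prop} (hP : ForGeneric P)
    (hQ : ForGeneric Q) : ForGeneric fun p => P p ∧ Q p := by
  obtain ⟨f, hf, hfP⟩ := hP
  obtain ⟨g, hg, hgQ⟩ := hQ
  refine ⟨f * g, mul_ne_zero hf hg, fun p hp => ?_⟩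
  rw [map_mul] at hp
  exact ⟨hfP p (left_ne_zero_of_mul hp), hgQ p (right_ne_zero_of_mul hp)⟩

theorem ForGeneric.mono {σ K : Type} [Field K] {P Q : (σ → K) → Prop} (hP : ForGeneric P)
    (h : ∀ p, P p → Q p) : ForGeneric Q := by
  obtain ⟨f, hf, hfP⟩ := hP
  exact ⟨f, hf, fun p hp => h p (hfP p hp)⟩

theorem ForGeneric.forall {σ K ι : Type} [Field K] [Finite ι] {P : ι → (σ → K) → Prop}
    (hP : ∀ i, ForGeneric (P i)) : ForGeneric fun p => ∀ i, P i p := by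
  have := Fintype.ofFinite ι
  choose f hf hfP using hP
  refine ⟨∏ i, f i, Finset.prod_ne_zero_iff.2 fun i _ => hf i, fun p hp i => ?_⟩
  rw [map_prod] at hp
  exact hfP i p (Finset.prod_ne_zero_iff.1 hp i (Finset.mem_univ i))

theorem forGeneric_eval_ne_zero {σ K : Type} [Field K] {f : MvPolynomial σ K} (hf : f ≠ 0) :
    ForGeneric fun p => eval p f ≠ 0 := ⟨f, hf, fun _ h => h⟩

theorem ForGeneric.exists {σ K : Type} [Field K] [Infinite K] {P : (σ → K) → Prop}
    (hP : ForGeneric P) : ∃ p, P p := by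
  obtain ⟨f, hf, hfP⟩ := hP
  by_contra! h
  refine hf (MvPolynomial.funext fun p => ?_)
  rw [map_zero]
  by_contra hp
  exact h p (hfP p hp)

theorem exists_eval_ne_zero {σ K : Type} [Field K] [Infinite K] {f : MvPolynomial σ K}
    (hf : f ≠ 0) : ∃ p, eval p f ≠ 0 := (forGeneric_eval_ne_zero hf).exists

/-- A nonzero complex polynomial does not vanish at generic real points: some real multiple of its
real part at real points is a nonzero polynomial. -/
theorem forGeneric_eval_ofReal_ne_zero {σ : Type} {f : MvPolynomial σ ℂ} (hf : f ≠ 0) :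
    ForGeneric fun p : σ → ℝ => eval (fun i => (p i : ℂ)) f ≠ 0 := by
  classical
  obtain ⟨k, hk⟩ := MvPolynomial.ne_zero_iff.1 hf
  let g : MvPolynomial σ ℝ :=
    ∑ l ∈ f.support, monomial l (starRingEnd ℂ (coeff k f) * coeff l f).re
  have hg : coeff k g = Complex.normSq (coeff k f) := by
    simp only [g, coeff_sum, coeff_monomial]
    rw [Finset.sum_ite_eq' f.support k, if_pos (mem_support_iff.2 hk), mul_comm, Complex.mul_conj,
      Complex.ofReal_re]
  refine ⟨g, fun h => hk ?_, fun p hp h0 => hp ?_⟩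
  · rw [h, coeff_zero] at hg
    exact Complex.normSq_eq_zero.1 hg.symm
  · have h1 : eval p g = (starRingEnd ℂ (coeff k f) * eval (fun i => (p i : ℂ)) f).re := by
      rw [eval_eq _ f, Finset.mul_sum, Complex.re_sum, map_sum]
      refine Finset.sum_congr rfl fun l _ => ?_
      have h2 : (∏ i ∈ l.support, (p i : ℂ) ^ l i) = ((∏ i ∈ l.support, p i ^ l i : ℝ) : ℂ) := by
        push_cast; rfl
      rw [eval_monomial, h2, ← mul_assoc, Complex.re_mul_ofReal, Finsupp.prod]
    rw [h1, h0, mul_zero, Complex.zero_re]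

/-- The restriction of a nonzero polynomial to a generic real fibre of a coordinate projection is
nonzero. -/
theorem forGeneric_exists_specialization {σ τ ρ : Type} {F : MvPolynomial ρ ℂ} (hF : F ≠ 0)
    {E : ρ → σ ⊕ τ} (hE : Function.Injective E) : ForGeneric fun p : σ → ℝ =>
      ∃ G : MvPolynomial τ ℂ, G ≠ 0 ∧
        ∀ q, eval q G = eval (fun i => Sum.elim (fun i => (p i : ℂ)) q (E i)) F := by
  have hF' : rename E F ≠ 0 := by
    rwa [Ne, map_eq_zero_iff _ (rename_injective E hE)]
  obtain ⟨v, hv⟩ := exists_eval_ne_zero hF'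
  let f : MvPolynomial σ ℂ := aeval (Sum.elim X fun i => C (v (Sum.inr i))) (rename E F)
  have hf : ∀ p, eval p f = eval (Sum.elim p fun i => v (Sum.inr i)) (rename E F) := fun p => by
    have := map_aeval_apply (eval p) (fun c => by simp [algebraMap_eq])
      (Sum.elim X fun i => C (v (Sum.inr i))) (rename E F)
    refine this.trans ?_
    have h1 : (fun i => eval p (Sum.elim X (fun i => C (v (Sum.inr i))) i)) =
        Sum.elim p fun i => v (Sum.inr i) := by
      ext (i | i) <;> simp
    rw [h1]
    rfl
  have hf0 : f ≠ 0 := by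
    intro h
    have h1 := hf fun i => v (Sum.inl i)
    rw [h, map_zero] at h1
    apply hv
    rw [h1]
    congr 2
    ext (i | i) <;> rfl
  refine (forGeneric_eval_ofReal_ne_zero hf0).mono fun p hp => ?_
  let G : MvPolynomial τ ℂ := aeval (Sum.elim (fun i => C (p i : ℂ)) X) (rename E F)
  have hG : ∀ q, eval q G = eval (Sum.elim (fun i => (p i : ℂ)) q) (rename E F) := fun q => by
    have := map_aeval_apply (eval q) (fun c => by simp [algebraMap_eq])
      (Sum.elim (fun i => C (p i : ℂ)) X) (rename E F)
    refine this.trans ?_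
    have h1 : (fun i => eval q (Sum.elim (fun i => C (p i : ℂ)) X i)) =
        Sum.elim (fun i => (p i : ℂ)) q := by
      ext (i | i) <;> simp
    rw [h1]
    rfl
  refine ⟨G, fun h => hp ?_, fun q => ?_⟩
  · rw [hf, ← hG, h, map_zero]
  · rw [hG, eval_rename]
    rfl

end Generic

/-! ### Matrices without vanishing maximal minors -/

section Minors

variable {K : Type*} [Field K] {r m : ℕ}

/-- Every `r` columns of the matrix `W` with `r` rows are independent. -/
def MaxMinorsNeZero (W : Matrix (Fin r) (Fin m) K) : Prop :=
  ∀ f : Fin r → Fin m, Function.Injective f → (W.submatrix id f).det ≠ 0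

theorem MaxMinorsNeZero.map {W : Matrix (Fin r) (Fin m) ℝ} (hW : MaxMinorsNeZero W) :
    MaxMinorsNeZero (W.map Complex.ofReal) := by
  intro f hf h
  refine hW f hf ?_
  have h1 := RingHom.map_det Complex.ofRealHom (W.submatrix id f)
  have h2 : Complex.ofRealHom.mapMatrix (W.submatrix id f) =
    (W.map Complex.ofReal).submatrix id f := rfl
  rw [h2, h] at h1
  exact Complex.ofReal_eq_zero.1 h1

/-- A finite set of at least `r` indices contains the range of an injective family of size `r`. -/
theorem Finset.exists_injective_forall_mem {S : Finset (Fin m)} (hS : r ≤ S.card) :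
    ∃ f : Fin r → Fin m, Function.Injective f ∧ ∀ k, f k ∈ S := by
  obtain ⟨T, hTS, hT⟩ := Finset.exists_subset_card_eq hS
  exact ⟨T.orderEmbOfFin hT, (T.orderEmbOfFin hT).injective,
    fun k => hTS (T.orderEmbOfFin_mem hT k)⟩

/-- A set of at most `r ≤ m` indices is contained in the range of an injective family of size
`r`. -/
theorem Finset.exists_injective_forall_mem_range {S : Finset (Fin m)} (hS : S.card ≤ r)
    (hrm : r ≤ m) : ∃ f : Fin r → Fin m, Function.Injective f ∧ ∀ j ∈ S, j ∈ Set.range f := by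
  obtain ⟨T, hST, hT⟩ := Finset.exists_superset_card_eq hS (by simpa using hrm)
  refine ⟨T.orderEmbOfFin hT, (T.orderEmbOfFin hT).injective, fun j hj => ?_⟩
  rw [T.range_orderEmbOfFin hT]
  exact hST hj

theorem MaxMinorsNeZero.eq_zero_of_vecMul {W : Matrix (Fin r) (Fin m) K} (hW : MaxMinorsNeZero W)
    {z : Fin r → K} {S : Finset (Fin m)} (hS : r ≤ S.card)
    (hz : ∀ j ∈ S, Matrix.vecMul z W j = 0) : z = 0 := by
  obtain ⟨f, hf, hfS⟩ := Finset.exists_injective_forall_mem hS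
  refine Matrix.eq_zero_of_vecMul_eq_zero (hW f hf) ?_
  ext k
  exact hz _ (hfS k)

theorem MaxMinorsNeZero.vecMul_injective {W : Matrix (Fin r) (Fin m) K} (hW : MaxMinorsNeZero W)
    (hrm : r ≤ m) : Function.Injective fun z => Matrix.vecMul z W := by
  intro z z' h
  rw [← sub_eq_zero]
  refine hW.eq_zero_of_vecMul (S := Finset.univ) (by simpa using hrm) fun j _ => ?_
  rw [Matrix.sub_vecMul, Pi.sub_apply, sub_eq_zero]
  exact congrFun h j

theorem mulVec_eq_submatrix_mulVec (W : Matrix (Fin r) (Fin m) K) {n : ℕ} {f : Fin n → Fin m}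
    (hf : Function.Injective f) {x : Fin m → K} (hx : ∀ j, x j ≠ 0 → j ∈ Set.range f) :
    Matrix.mulVec W x = Matrix.mulVec (W.submatrix id f) (x ∘ f) := by
  ext i
  symm
  refine Fintype.sum_of_injective f hf _ _ (fun j hj => ?_) fun k => rfl
  by_cases h : x j = 0
  · rw [h, mul_zero]
  · exact absurd (hx j h) hj

theorem MaxMinorsNeZero.eq_zero_of_mulVec {W : Matrix (Fin r) (Fin m) K} (hW : MaxMinorsNeZero W)
    (hrm : r ≤ m) {x : Fin m → K} {S : Finset (Fin m)} (hS : S.card ≤ r)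
    (hx : ∀ j, x j ≠ 0 → j ∈ S) (h : Matrix.mulVec W x = 0) : x = 0 := by
  obtain ⟨f, hf, hfS⟩ := Finset.exists_injective_forall_mem_range hS hrm
  have hxf : ∀ j, x j ≠ 0 → j ∈ Set.range f := fun j hj => hfS j (hx j hj)
  rw [mulVec_eq_submatrix_mulVec W hf hxf] at h
  have h1 := Matrix.eq_zero_of_mulVec_eq_zero (hW f hf) h
  ext j
  by_contra hj
  obtain ⟨k, rfl⟩ := hxf j hj
  exact hj (congrFun h1 k)

open MvPolynomial in
/-- A matrix of distinct variables has no vanishing maximal minors at generic points. -/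
theorem forGeneric_maxMinorsNeZero {σ : Type} {a : Fin r → Fin m → σ}
    (ha : Function.Injective fun ij : Fin r × Fin m => a ij.1 ij.2) :
    ForGeneric fun p : σ → ℝ => MaxMinorsNeZero (Matrix.of fun i j => p (a i j)) := by
  have : ∀ f : {f : Fin r → Fin m // Function.Injective f}, ForGeneric fun p : σ → ℝ =>
      ((Matrix.of fun i j => p (a i j)).submatrix id f).det ≠ 0 := by
    rintro ⟨f, hf⟩
    let E : Fin r × Fin r → σ := fun ij => a ij.1 (f ij.2)
    have hE : Function.Injective E := fun x y h => by
      have h1 : ((x.1, f x.2) : Fin r × Fin m) = (y.1, f y.2) := ha h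
      simp only [Prod.mk.injEq] at h1
      exact Prod.ext h1.1 (hf h1.2)
    have h0 : rename E (Matrix.mvPolynomialX (Fin r) (Fin r) ℝ).det ≠ 0 := by
      rw [Ne, map_eq_zero_iff _ (rename_injective E hE)]
      exact Matrix.det_mvPolynomialX_ne_zero _ _
    refine (forGeneric_eval_ne_zero h0).mono fun p hp => ?_
    rw [eval_rename, RingHom.map_det] at hp
    convert hp using 2
    ext i k
    simp [E]
  exact (ForGeneric.forall this).mono fun p hp f hf => hp ⟨f, hf⟩

end Minors

/-! ### Existence of central paths -/

section CentralPath

open Matrix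

variable {m d : ℕ}

theorem half_mul_sub_le_barrier {s lam t : ℝ} (hs : 0 < s) (hlam : 0 < lam) (ht : 0 < t) :
    s * t / 2 - lam * (Real.log (2 * lam / s) - 1) ≤ s * t - lam * Real.log t := by
  have ha : 0 < 2 * lam / s := by positivity
  have h1 := Real.log_le_sub_one_of_pos (div_pos ht ha)
  rw [Real.log_div ht.ne' ha.ne'] at h1
  have h2 : lam * (t / (2 * lam / s)) = s * t / 2 := by field_simp
  nlinarith

/-- The logarithmic barrier function. -/
noncomputable def barrier (s : Fin m → ℝ) (lam : ℝ) (x : Fin m → ℝ) : ℝ :=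
  ∑ j, (s j * x j - lam * Real.log (x j))

/-- Sublevel sets of the barrier function lie in compact boxes of positive vectors. -/
theorem exists_box_of_barrier_le {s : Fin m → ℝ} (hs : ∀ j, 0 < s j) {lam : ℝ} (hlam : 0 < lam)
    (H : ℝ) : ∃ l u : Fin m → ℝ, (∀ j, 0 < l j) ∧ ∀ x : Fin m → ℝ, (∀ j, 0 < x j) →
      barrier s lam x ≤ H → x ∈ Set.Icc l u := by
  let C : Fin m → ℝ := fun j => |lam * (Real.log (2 * lam / s j) - 1)|
  let H' : ℝ := H + ∑ j, C j
  refine ⟨fun _ => Real.exp (-H' / lam), fun j => 2 * (H' + C j) / s j, fun _ => Real.exp_pos _,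
    fun x hx hH => ?_⟩
  have h1 : ∀ j, s j * x j / 2 - C j ≤ s j * x j - lam * Real.log (x j) := fun j =>
    (sub_le_sub_left (le_abs_self _) _).trans (half_mul_sub_le_barrier (hs j) hlam (hx j))
  have h2 : ∀ j, s j * x j - lam * Real.log (x j) ≤ H' := fun j => by
    have h3 : s j * x j - lam * Real.log (x j) + C j ≤
        ∑ k, (s k * x k - lam * Real.log (x k) + C k) := by
      refine Finset.single_le_sum (f := fun k => s k * x k - lam * Real.log (x k) + C k)
        (fun k _ => ?_) (Finset.mem_univ j)
      have := h1 k
      have := mul_pos (hs k) (hx k)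
      change (0 : ℝ) ≤ _
      linarith
    rw [Finset.sum_add_distrib] at h3
    have h4 : 0 ≤ C j := abs_nonneg _
    unfold barrier at hH
    linarith
  refine ⟨fun j => ?_, fun j => ?_⟩
  · have h5 := mul_pos (hs j) (hx j)
    change Real.exp (-H' / lam) ≤ x j
    rw [← Real.le_log_iff_exp_le (hx j), div_le_iff₀ hlam]
    linarith [h2 j]
  · change x j ≤ 2 * (H' + C j) / s j
    rw [le_div_iff₀ (hs j)]
    linarith [h1 j, h2 j]

theorem hasStrictFDerivAt_barrier (s : Fin m → ℝ) (lam : ℝ) {x : Fin m → ℝ} (hx : ∀ j, 0 < x j) :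
    HasStrictFDerivAt (barrier s lam)
      (∑ j, (s j - lam * (x j)⁻¹) • (ContinuousLinearMap.proj j : (Fin m → ℝ) →L[ℝ] ℝ)) x := by
  refine HasStrictFDerivAt.fun_sum fun j _ => ?_
  have h1 : HasStrictFDerivAt (fun x : Fin m → ℝ => x j)
      (ContinuousLinearMap.proj j : (Fin m → ℝ) →L[ℝ] ℝ) x := hasStrictFDerivAt_apply j x
  have h2 := (h1.const_mul (s j)).sub ((h1.log (hx j).ne').const_mul lam)
  refine h2.congr_fderiv ?_
  ext v
  simp [sub_mul, mul_assoc]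

/-- Along an affine subspace through a positive point, the barrier function has a minimum, which
satisfies the Lagrange conditions. -/
theorem exists_critical_point {A : Matrix (Fin d) (Fin m) ℝ}
    (hA : Function.Injective fun y => vecMul y A) {s x₀ : Fin m → ℝ} (hs : ∀ j, 0 < s j)
    (hx₀ : ∀ j, 0 < x₀ j) {lam : ℝ} (hlam : 0 < lam) :
    ∃ (x : Fin m → ℝ) (w : Fin d → ℝ), (∀ j, 0 < x j) ∧ A *ᵥ x = A *ᵥ x₀ ∧
      ∀ j, s j - lam * (x j)⁻¹ = vecMul w A j := by
  obtain ⟨l, u, hl, hbox⟩ := exists_box_of_barrier_le hs hlam (barrier s lam x₀)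
  let K : Set (Fin m → ℝ) := Set.Icc l u ∩ {x | A *ᵥ x = A *ᵥ x₀}
  have hpos : ∀ x ∈ K, ∀ j, 0 < x j := fun x hx j => (hl j).trans_le (hx.1.1 j)
  have hK : IsCompact K := isCompact_Icc.inter_right
    (isClosed_eq (Continuous.matrix_mulVec continuous_const continuous_id) continuous_const)
  have hx₀K : x₀ ∈ K := ⟨hbox x₀ hx₀ le_rfl, rfl⟩
  obtain ⟨x, hxK, hmin⟩ := hK.exists_isMinOn ⟨x₀, hx₀K⟩ (f := barrier s lam) fun x hx =>
    (hasStrictFDerivAt_barrier s lam (hpos x hx)).continuousAt.continuousWithinAt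
  have hx := hpos x hxK
  have hext : IsLocalExtrOn (barrier s lam) {x' | ∀ i, (A *ᵥ x') i = (A *ᵥ x) i} x := by
    left
    have hev : ∀ᶠ x' in nhds x, ∀ j, (0 : ℝ) < x' j := by
      rw [Filter.eventually_all]
      exact fun j => (continuous_apply j).continuousAt.eventually_const_lt (hx j)
    filter_upwards [self_mem_nhdsWithin, mem_nhdsWithin_of_mem_nhds hev] with x' hx'A hx'
    by_cases h : barrier s lam x' ≤ barrier s lam x₀
    · exact hmin ⟨hbox x' hx' h, (funext hx'A).trans hxK.2⟩
    · exact (hmin hx₀K).trans (not_le.1 h).le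
  obtain ⟨Λ, Λ₀, hne, hΛ⟩ := hext.exists_multipliers_of_hasStrictFDerivAt
    (f' := fun i => ∑ j, A i j • (ContinuousLinearMap.proj j : (Fin m → ℝ) →L[ℝ] ℝ))
    (fun i => by
      have h1 := (∑ j, A i j • (ContinuousLinearMap.proj j : (Fin m → ℝ) →L[ℝ] ℝ)).hasStrictFDerivAt
        (x := x)
      refine h1.congr_of_eventuallyEq (Filter.Eventually.of_forall fun x' => ?_)
      simp [mulVec, dotProduct])
    (hasStrictFDerivAt_barrier s lam hx)
  have hΛ' : ∀ j, vecMul Λ A j + Λ₀ * (s j - lam * (x j)⁻¹) = 0 := fun j => by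
    have := DFunLike.congr_fun hΛ (Pi.single j 1)
    simpa [vecMul, dotProduct, Pi.single_apply] using this
  have hΛ₀ : Λ₀ ≠ 0 := by
    rintro rfl
    refine hne ?_
    have : Λ = 0 := hA (by
      ext j
      simpa using hΛ' j)
    rw [this]
    rfl
  refine ⟨x, -(Λ₀⁻¹ • Λ), hx, hxK.2, fun j => ?_⟩
  rw [neg_vecMul, smul_vecMul, Pi.neg_apply, Pi.smul_apply, smul_eq_mul]
  have := hΛ' j
  field_simp
  field_simp at this
  linarith

/-- A linear program has a central path if it has a feasible point `x₀ > 0` and its dual has one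
with slack `s₀ > 0`. As `c` differs from `s₀` by a combination of the rows of `A`, the KKT
conditions are those for a critical point of the barrier function with slack `s₀`. -/
theorem LPData.hasCentralPath {D : LPData m d} (hA : Function.Injective fun y => vecMul y D.A)
    {x₀ s₀ : Fin m → ℝ} {y₀ : Fin d → ℝ} (hx₀ : ∀ j, 0 < x₀ j) (hs₀ : ∀ j, 0 < s₀ j)
    (hb : D.A *ᵥ x₀ = D.b) (hc : ∀ j, s₀ j + vecMul y₀ D.A j = D.c j) : D.HasCentralPath := by
  intro lam hlam
  obtain ⟨x, w, hx, hAx, hw⟩ := exists_critical_point hA hs₀ hx₀ hlam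
  refine ⟨(x, y₀ + w), ⟨fun j => ?_, hAx.trans hb, hx⟩, ?_⟩
  · have := hw j
    rw [← hc, add_vecMul, Pi.add_apply, one_div]
    linarith
  · rintro ⟨x', y'⟩ ⟨h1, h2, h3⟩
    -- Two solutions agree, because `lam (1 / x - 1 / x')` is orthogonal to `x' - x`.
    have hdiff : ∀ j, lam * ((x j)⁻¹ - (x' j)⁻¹) = vecMul (y' - (y₀ + w)) D.A j := fun j => by
      have e1 := hw j
      have e2 := h1 j
      rw [← hc, one_div] at e2
      rw [sub_vecMul, add_vecMul, Pi.sub_apply, Pi.add_apply]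
      linarith
    have hsum : ∑ j, lam * ((x j)⁻¹ - (x' j)⁻¹) * (x' j - x j) = 0 := by
      have e1 : D.A *ᵥ (x' - x) = 0 := by
        rw [mulVec_sub, hAx, hb]
        simp only at h2
        rw [h2, sub_self]
      have e2 : vecMul (y' - (y₀ + w)) D.A ⬝ᵥ (x' - x) = 0 := by
        rw [← dotProduct_mulVec, e1, dotProduct_zero]
      simpa only [dotProduct, ← hdiff, Pi.sub_apply] using e2
    have hterm : ∀ j, lam * ((x j)⁻¹ - (x' j)⁻¹) * (x' j - x j) =
        lam * (x j)⁻¹ * (x' j)⁻¹ * (x' j - x j) ^ 2 := fun j => by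
      have := (hx j).ne'
      have := (h3 j).ne'
      simp only at *
      field_simp
    have hxx : x' = x := by
      ext j
      have hnn : ∀ k ∈ Finset.univ, 0 ≤ lam * (x k)⁻¹ * (x' k)⁻¹ * (x' k - x k) ^ 2 := fun k _ => by
        have := hx k
        have := h3 k
        simp only at this
        positivity
      simp only [hterm] at hsum
      have e3 := (Finset.sum_eq_zero_iff_of_nonneg hnn).1 hsum j (Finset.mem_univ j)
      have e4 : lam * (x j)⁻¹ * (x' j)⁻¹ ≠ 0 :=
        mul_ne_zero (mul_ne_zero hlam.ne' (inv_ne_zero (hx j).ne')) (inv_ne_zero (h3 j).ne')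
      exact sub_eq_zero.1 (pow_eq_zero_iff two_ne_zero |>.1 ((mul_eq_zero.1 e3).resolve_left e4))
    have hyy : y' - (y₀ + w) = 0 := hA (by
      ext j
      simp only
      rw [← hdiff, hxx, sub_self, mul_zero, zero_vecMul, Pi.zero_apply])
    rw [hxx, sub_eq_zero.1 hyy]

open MvPolynomial in
/-- The linear programs with a central path are Zariski dense: those of the form
`(A, A x, s + y A)` with `x, s > 0` have one, and the map `(A, x, s, y) ↦ (A, A x, s + y A)` is
dominant. -/
theorem exists_hasCentralPath (hdm : d ≤ m) {P : (LPCoord m d → ℝ) → Prop} (hP : ForGeneric P) :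
    ∃ p, P p ∧ (LPData.ofCoords p).HasCentralPath := by
  obtain ⟨f, hf, hfP⟩ := hP
  let D : MvPolynomial (LPCoord m d) ℝ := basisDet hdm fun i j => X (Sum.inl (i, j))
  have hD : D ≠ 0 := basisDet_X_ne_zero hdm fun a b h => by simpa [Prod.ext_iff] using h
  let ι := (Fin d × Fin m) ⊕ Fin d ⊕ Fin m ⊕ Fin m
  let v : LPCoord m d → MvPolynomial ι ℝ := lpOfPoint (fun i j => X (Sum.inl (i, j)))
    (fun j => X (Sum.inr (Sum.inr (Sum.inl j)))) (fun j => X (Sum.inr (Sum.inr (Sum.inr j))))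
    fun i => X (Sum.inr (Sum.inl i))
  let h : MvPolynomial ι ℝ := bind₁ v (f * D)
  have hv : ∀ q : ι → ℝ, (fun i => eval q (v i)) = lpOfPoint (fun i j => q (Sum.inl (i, j)))
      (fun j => q (Sum.inr (Sum.inr (Sum.inl j)))) (fun j => q (Sum.inr (Sum.inr (Sum.inr j))))
      fun i => q (Sum.inr (Sum.inl i)) := fun q => by
    ext i
    simp only [v, map_lpOfPoint, eval_X]
  have heval : ∀ q, eval q h = eval (fun i => eval q (v i)) (f * D) := fun q => by
    exact eval₂Hom_bind₁ _ _ _ _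
  have hbasis : ∀ p : LPCoord m d → ℝ, eval p D = basisDet hdm fun i j => p (Sum.inl (i, j)) :=
    fun p => by simp only [D, map_basisDet, eval_X]
  have hh : h ≠ 0 := by
    obtain ⟨p, hp⟩ := exists_eval_ne_zero (mul_ne_zero hf hD)
    have hp' := hp
    rw [map_mul] at hp'
    have hb := right_ne_zero_of_mul hp'
    rw [hbasis] at hb
    obtain ⟨y, x, hyx⟩ := exists_lpOfPoint_splitAt_eq hdm _ (fun i => p (Sum.inr (Sum.inl i)))
      (fun j => p (Sum.inr (Sum.inr j))) hb
    intro h0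
    have h1 := heval (Sum.elim (fun ij => p (Sum.inl (ij.1, ij.2)))
      (Sum.elim y (Sum.elim (splitAt d x 0) (splitAt d 0 x))))
    rw [h0, map_zero, hv] at h1
    apply hp
    rw [h1]
    congr 2
    refine Eq.trans ?_ (hyx.symm.trans rfl)
    ext (i | i | i) <;> rfl
  let s : ι → Set ℝ := Sum.elim (fun _ => Set.univ) (Sum.elim (fun _ => Set.univ)
    (Sum.elim (fun _ => Set.Ioi 0) fun _ => Set.Ioi 0))
  have hs : ∀ i, (s i).Infinite := by
    rintro (i | i | i | i)
    · exact Set.infinite_univ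
    · exact Set.infinite_univ
    · exact Set.Ioi_infinite 0
    · exact Set.Ioi_infinite 0
  obtain ⟨q, hqs, hq⟩ : ∃ q ∈ Set.pi Set.univ s, eval q h ≠ 0 := by
    by_contra! hcon
    exact hh (MvPolynomial.funext_set s hs fun q hq => by rw [hcon q hq, map_zero])
  rw [heval, hv, map_mul, hbasis] at hq
  refine ⟨_, hfP _ (left_ne_zero_of_mul hq), ?_⟩
  refine LPData.hasCentralPath (x₀ := fun j => q (Sum.inr (Sum.inr (Sum.inl j))))
    (s₀ := fun j => q (Sum.inr (Sum.inr (Sum.inr j)))) (y₀ := fun i => q (Sum.inr (Sum.inl i)))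
    ?_ (fun j => hqs (Sum.inr (Sum.inr (Sum.inl j))) trivial)
    (fun j => hqs (Sum.inr (Sum.inr (Sum.inr j))) trivial) ?_ ?_
  · intro y y' hyy
    have hdet := right_ne_zero_of_mul hq
    rw [← sub_eq_zero]
    refine Matrix.eq_zero_of_vecMul_eq_zero hdet ?_
    rw [sub_vecMul, sub_eq_zero]
    ext k
    exact congrFun hyy (Fin.castLE hdm k)
  · rfl
  · intro j; rfl

end CentralPath

/-! ### The degree of a generic central curve -/

section Degree

open MvPolynomial

variable {m d : ℕ}

theorem mem_zariskiClosure {σ : Type} {V : Set (σ → ℂ)} {q : σ → ℂ} : q ∈ zariskiClosure V ↔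
    ∀ Q : MvPolynomial σ ℂ, (∀ v ∈ V, eval v Q = 0) → eval q Q = 0 := by
  unfold zariskiClosure
  simp only [mem_zeroLocus_iff, mem_vanishingIdeal_iff]
  rfl

/-- The position of the entries of the matrix with first row `c` and further rows `A`. -/
def lpIndex (i : Fin (d + 1)) (j : Fin m) : LPCoord m d :=
  Fin.cases (Sum.inr (Sum.inr j)) (fun i => Sum.inl (i, j)) i

theorem lpIndex_injective :
    Function.Injective fun ij : Fin (d + 1) × Fin m => lpIndex (d := d) ij.1 ij.2 := by
  rintro ⟨i, j⟩ ⟨i', j'⟩ h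
  revert h
  refine Fin.cases ?_ (fun i => ?_) i <;> refine Fin.cases ?_ (fun i' => ?_) i' <;>
    simp [lpIndex]

/-- The matrix with first row `c` and further rows `A`. -/
def lpMatrix {K : Type*} (θ : LPCoord m d → K) : Matrix (Fin (d + 1)) (Fin m) K :=
  Matrix.of fun i j => θ (lpIndex i j)

theorem vecMul_lpMatrix {K : Type*} [CommRing K] (θ : LPCoord m d → K) (z : Fin (d + 1) → K)
    (j : Fin m) : Matrix.vecMul z (lpMatrix θ) j =
      z 0 * θ (Sum.inr (Sum.inr j)) + ∑ i, z (Fin.succ i) * θ (Sum.inl (i, j)) := by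
  simp only [Matrix.vecMul, dotProduct, Fin.sum_univ_succ]
  rfl

theorem slack_eq_vecMul {K : Type*} [CommRing K] (θ : LPCoord m d → K) (q : Fin m ⊕ Fin d → K)
    (j : Fin m) : slack θ q j =
      Matrix.vecMul (Fin.cons 1 fun i => -q (Sum.inr i)) (lpMatrix θ) j := by
  rw [vecMul_lpMatrix]
  simp [slack, sub_eq_add_neg]

/-- The dual point and `lam` are determined by the primal point. -/
theorem injOn_centralPoints (hdm : d < m) {θ : LPCoord m d → ℂ}
    (hθ : MaxMinorsNeZero (lpMatrix θ)) :
    Set.InjOn (fun (q : Fin m ⊕ Fin d → ℂ) j => q (Sum.inl j)) (centralPoints θ) := by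
  rintro q ⟨lam, hlam, hq, -⟩ q' ⟨lam', hlam', hq', -⟩ h
  have hx : ∀ j, q (Sum.inl j) = q' (Sum.inl j) := congrFun h
  have hvec : Matrix.vecMul (lam' • (Fin.cons 1 fun i => -q (Sum.inr i) : Fin (d + 1) → ℂ))
      (lpMatrix θ) =
      Matrix.vecMul (lam • (Fin.cons 1 fun i => -q' (Sum.inr i) : Fin (d + 1) → ℂ))
      (lpMatrix θ) := by
    ext j
    rw [Matrix.smul_vecMul, Matrix.smul_vecMul, Pi.smul_apply, Pi.smul_apply, ← slack_eq_vecMul,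
      ← slack_eq_vecMul, smul_eq_mul, smul_eq_mul]
    have h1 := hq j
    have h2 := hq' j
    rw [← hx] at h2
    have h3 : q (Sum.inl j) ≠ 0 := by
      rintro h3
      rw [h3, zero_mul] at h1
      exact hlam h1.symm
    apply mul_left_cancel₀ h3
    linear_combination lam' * h1 - lam * h2
  have hz := hθ.vecMul_injective hdm hvec
  have hl : lam' = lam := by simpa using congrFun hz 0
  ext (j | i)
  · exact hx j
  · have := congrFun hz (Fin.succ i)
    rw [hl] at this
    simpa [hlam] using this

/-- For `lam = 0`, a solution `x` has at most `d` nonzero coordinates, since otherwise `d + 1`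
slacks vanish; so it is determined by its support. -/
theorem finite_centralEquations_zero (hdm : d < m) {θ : LPCoord m d → ℂ}
    (hθ : MaxMinorsNeZero (lpMatrix θ))
    (hA : MaxMinorsNeZero (Matrix.of fun i j => θ (Sum.inl (i, j)))) :
    ((fun (q : Fin m ⊕ Fin d → ℂ) j => q (Sum.inl j)) '' centralEquations θ 0).Finite := by
  classical
  let S : (Fin m → ℂ) → Finset (Fin m) := fun x => Finset.univ.filter fun j => x j ≠ 0
  refine Set.Finite.of_finite_image (f := S) (Set.toFinite _) ?_
  rintro _ ⟨q, hq, rfl⟩ _ ⟨q', hq', rfl⟩ hS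
  have hcard : (S fun j => q (Sum.inl j)).card ≤ d := by
    by_contra! h
    have h0 := hθ.eq_zero_of_vecMul (z := Fin.cons 1 fun i => -q (Sum.inr i))
      (S := S fun j => q (Sum.inl j)) h fun j hj => by
        rw [← slack_eq_vecMul]
        exact (mul_eq_zero.1 (hq.1 j)).resolve_left (Finset.mem_filter.1 hj).2
    simpa using congrFun h0 0
  rw [← sub_eq_zero]
  refine hA.eq_zero_of_mulVec hdm.le hcard (fun j hj => ?_) ?_
  · by_contra hj'
    have h1 : q (Sum.inl j) = 0 := by simpa [S] using hj'
    have hj'' : j ∉ S fun j => q' (Sum.inl j) := hS ▸ hj'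
    have h2 : q' (Sum.inl j) = 0 := by simpa [S] using hj''
    exact hj (by simp [h1, h2])
  · rw [Matrix.mulVec_sub, sub_eq_zero]
    ext i
    exact (hq.2 i).trans (hq'.2 i).symm

theorem mul_slack_of_kkt {p : LPCoord m d → ℝ} {lam : ℝ} {x : Fin m → ℝ} {y : Fin d → ℝ}
    (h : (LPData.ofCoords p).KKT lam x y) (j : Fin m) :
    (x j : ℂ) * slack (fun i => (p i : ℂ)) (Sum.elim (fun j => (x j : ℂ)) fun i => (y i : ℂ)) j =
      lam := by
  have h1 : p (Sum.inr (Sum.inr j)) - lam * (1 / x j) - ∑ i, y i * p (Sum.inl (i, j)) = 0 := h.1 j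
  have h2 := (h.2.2 j).ne'
  have h3 : x j * (p (Sum.inr (Sum.inr j)) - ∑ i, y i * p (Sum.inl (i, j))) = lam := by
    have h4 : x j * (lam * (1 / x j)) = lam := by field_simp
    linear_combination x j * h1 + h4
  rw [← h3]
  simp [slack]

theorem centralPath_subset_centralPoints (p : LPCoord m d → ℝ) :
    (LPData.ofCoords p).centralPath ⊆ centralPoints fun i => (p i : ℂ) := by
  rintro _ ⟨lam, x, y, hlam, h, rfl⟩
  refine ⟨lam, by exact_mod_cast hlam.ne', mul_slack_of_kkt h, fun i => ?_⟩
  have h4 : ∑ j, p (Sum.inl (i, j)) * x j = p (Sum.inr (Sum.inl i)) := congrFun h.2.1 i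
  change _ = ((p (Sum.inr (Sum.inl i)) : ℝ) : ℂ)
  rw [← h4]
  simp

theorem infinite_image_centralPath {p : LPCoord m d → ℝ} (hp : (LPData.ofCoords p).HasCentralPath)
    (j : Fin m) : ((fun q => q (Sum.inl j) * slack (fun i => (p i : ℂ)) q j) ''
      (LPData.ofCoords p).centralPath).Infinite := by
  refine ((Set.Ioi_infinite (0 : ℝ)).image Complex.ofReal_injective.injOn).mono ?_
  rintro _ ⟨lam, hlam, rfl⟩
  obtain ⟨⟨x, y⟩, h, -⟩ := hp lam hlam
  exact ⟨_, ⟨lam, x, y, hlam, h, rfl⟩, mul_slack_of_kkt h j⟩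

/-- The equations of the central path, freed of `lam`, hold on its closure. -/
theorem exists_mem_centralEquations_of_mem_zariskiClosure (hdm : d < m) {θ : LPCoord m d → ℂ}
    {Y : Set (Fin m ⊕ Fin d → ℂ)} (hY : Y ⊆ centralPoints θ) {q : Fin m ⊕ Fin d → ℂ}
    (hq : q ∈ zariskiClosure Y) : ∃ lam, q ∈ centralEquations θ lam := by
  rw [mem_zariskiClosure] at hq
  have hslack : ∀ (q : Fin m ⊕ Fin d → ℂ) j,
      eval q (slack (fun i => C (θ i)) X j) = slack θ q j := fun q j => by
    simp [slack]
  refine ⟨q (Sum.inl ⟨d, hdm⟩) * slack θ q ⟨d, hdm⟩, fun j => ?_, fun i => ?_⟩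
  · have := hq (X (Sum.inl j) * slack (fun i => C (θ i)) X j -
      X (Sum.inl ⟨d, hdm⟩) * slack (fun i => C (θ i)) X ⟨d, hdm⟩) fun v hv => by
        obtain ⟨lam, -, hv, -⟩ := hY hv
        rw [map_sub, map_mul, map_mul, hslack, hslack, eval_X, eval_X, hv, hv, sub_self]
    rwa [map_sub, map_mul, map_mul, hslack, hslack, eval_X, eval_X, sub_eq_zero] at this
  · have := hq (∑ j, C (θ (Sum.inl (i, j))) * X (Sum.inl j) - C (θ (Sum.inr (Sum.inl i))))
      fun v hv => by
        obtain ⟨lam, -, -, hv⟩ := hY hv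
        simp [hv i]
    simpa [sub_eq_zero] using this

/-- The degree of the central curve is the number of points of a generic section. Density of the
central path puts the section into its Zariski closure; the other points of the closure belong to
`lam = 0`, and a generic hyperplane avoids these finitely many points. -/
theorem exists_generic_centralCurveDegree (hdm : d < m) {n : ℕ} {F : CutRing m d} (hF0 : F ≠ 0)
    (hF : ∀ p, eval p F ≠ 0 → (centralSection p).encard = n ∧
      ∀ Y ⊆ centralPoints (fun i => p (Sum.inl i)),
        (∀ j, ((fun q => q (Sum.inl j) * slack (fun i => p (Sum.inl i)) q j) '' Y).Infinite) →
        ∀ Q : MvPolynomial (Fin m ⊕ Fin d) ℂ, (∀ q ∈ Y, eval q Q = 0) →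
          ∀ q ∈ centralSection p, eval q Q = 0) : IsGenericCentralCurveDegree m d n := by
  classical
  have hgen := ((forGeneric_exists_specialization hF0 Function.injective_id).and
    (forGeneric_maxMinorsNeZero (lpIndex_injective (m := m) (d := d)))).and
    (forGeneric_maxMinorsNeZero (r := d) (m := m) (a := fun i j => (Sum.inl (i, j) : LPCoord m d))
      fun a b h => by simpa [Prod.ext_iff] using h)
  refine hgen.mono fun p hp hpath => ?_
  obtain ⟨⟨⟨G, hG0, hG⟩, hW⟩, hA⟩ := hp
  let θ : LPCoord m d → ℂ := fun i => (p i : ℂ)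
  have hW' : MaxMinorsNeZero (lpMatrix θ) := hW.map
  have hA' : MaxMinorsNeZero (Matrix.of fun i j => θ (Sum.inl (i, j))) := hA.map
  have hfin := finite_centralEquations_zero hdm hW' hA'
  refine ⟨G * ∏ x ∈ hfin.toFinset, (∑ j, X (some j) * C (x j) - X none),
    mul_ne_zero hG0 (Finset.prod_ne_zero_iff.2 fun x _ h => ?_), fun e he => ?_⟩
  · have h1 := congrArg (eval fun o => o.elim (1 : ℂ) fun _ => 0) h
    simp at h1
  rw [map_mul, map_prod] at he
  have hFe : eval (Sum.elim θ e) F ≠ 0 := by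
    have := left_ne_zero_of_mul he
    rw [hG] at this
    exact this
  have havoid : ∀ q ∈ centralEquations θ 0, ∑ j, e (some j) * q (Sum.inl j) ≠ e none := by
    intro q hq h0
    refine Finset.prod_ne_zero_iff.1 (right_ne_zero_of_mul he) (fun j => q (Sum.inl j))
      (hfin.mem_toFinset.2 ⟨q, hq, rfl⟩) ?_
    simp [h0]
  obtain ⟨hn, hdense⟩ := hF _ hFe
  have hpts := centralPath_subset_centralPoints p
  rw [← hn]
  have himage : (fun (q : Fin m ⊕ Fin d → ℂ) j => q (Sum.inl j)) '' centralSection (Sum.elim θ e) =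
      (LPData.ofCoords p).centralCurve ∩ hyperplane e := by
    ext x
    constructor
    · rintro ⟨q, hq, rfl⟩
      refine ⟨⟨q, mem_zariskiClosure.2 fun Q hQ => ?_, rfl⟩, hq.2⟩
      exact hdense _ hpts (infinite_image_centralPath hpath) Q hQ q hq
    · rintro ⟨⟨q, hq, rfl⟩, hqe⟩
      refine ⟨q, ⟨?_, hqe⟩, rfl⟩
      obtain ⟨lam, hlam⟩ := exists_mem_centralEquations_of_mem_zariskiClosure hdm hpts hq
      refine ⟨lam, ?_, hlam⟩
      rintro rfl
      exact havoid q hlam hqe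
  rw [← himage, ((injOn_centralPoints hdm hW').mono fun q hq => hq.1).encard_image]

/-- The degree is unique, since central paths exist for a Zariski dense set of programs. -/
theorem isGenericCentralCurveDegree_iff (hdm : d < m) {n : ℕ}
    (hn : IsGenericCentralCurveDegree m d n) (k : ℕ) :
    IsGenericCentralCurveDegree m d k ↔ k = n := by
  refine ⟨fun hk => ?_, fun h => h ▸ hn⟩
  obtain ⟨p, ⟨h1, h2⟩, hp⟩ := exists_hasCentralPath hdm.le (hk.and hn)
  obtain ⟨e, he1, he2⟩ := ((h1 hp).and (h2 hp)).exists
  rw [he1] at he2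
  exact_mod_cast he2

end Degree

/-! ### Reciprocal linear equations: properness -/

section Reciprocal

open Matrix Filter Topology

variable {r m : ℕ}

/-- The vectors `z` for which `z M` has no zero coordinate and `N` takes the vector of inverses of
these coordinates to `v`. -/
def reciprocalSolutions (M N : Matrix (Fin r) (Fin m) ℂ) (v : Fin r → ℂ) : Set (Fin r → ℂ) :=
  {z | (∀ j, vecMul z M j ≠ 0) ∧ N *ᵥ (fun j => (vecMul z M j)⁻¹) = v}

/-- If `r` coordinates of the inverse of `z M` have nonzero limits, `z` converges. -/
theorem exists_tendsto_of_mul_vecMul_eq_one {M : Matrix (Fin r) (Fin m) ℂ} (hM : MaxMinorsNeZero M)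
    {α : Type*} {l : Filter α} [l.NeBot] {z : α → Fin r → ℂ} {x : α → Fin m → ℂ}
    (hzx : ∀ᶠ a in l, ∀ j, x a j * vecMul (z a) M j = 1) {x' : Fin m → ℂ}
    (hx : Tendsto x l (𝓝 x')) {S : Finset (Fin m)} (hS : r ≤ S.card) (hxS : ∀ j ∈ S, x' j ≠ 0) :
    ∃ z', Tendsto z l (𝓝 z') ∧ ∀ j, x' j * vecMul z' M j = 1 := by
  obtain ⟨f, hf, hfS⟩ := Finset.exists_injective_forall_mem hS
  set B := M.submatrix id f
  have hB : IsUnit B.det := isUnit_iff_ne_zero.2 (hM f hf)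
  have hxj : ∀ j, Tendsto (fun a => x a j) l (𝓝 (x' j)) := tendsto_pi_nhds.1 hx
  have h1 : Tendsto (fun a k => (x a (f k))⁻¹) l (𝓝 fun k => (x' (f k))⁻¹) :=
    tendsto_pi_nhds.2 fun k => (hxj (f k)).inv₀ (hxS _ (hfS k))
  have hcont : Continuous fun w : Fin r → ℂ => vecMul w B⁻¹ :=
    Continuous.matrix_vecMul continuous_id continuous_const
  have h2 : Tendsto z l (𝓝 (vecMul (fun k => (x' (f k))⁻¹) B⁻¹)) := by
    refine ((hcont.tendsto _).comp h1).congr' ?_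
    filter_upwards [hzx] with a ha
    have h3 : (fun k => (x a (f k))⁻¹) = vecMul (z a) B := by
      ext k
      exact inv_eq_of_mul_eq_one_right (ha (f k))
    rw [Function.comp_apply, h3, vecMul_vecMul, mul_nonsing_inv _ hB, vecMul_one]
  refine ⟨_, h2, fun j => ?_⟩
  have hcont' : Continuous fun w : Fin r → ℂ => vecMul w M j :=
    (continuous_apply j).comp (Continuous.matrix_vecMul continuous_id continuous_const)
  refine tendsto_nhds_unique ((hxj j).mul ((hcont'.tendsto _).comp h2)) ?_
  refine tendsto_const_nhds.congr' ?_
  filter_upwards [hzx] with a ha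
  exact (ha j).symm

/-- A family of solutions converges along an ultrafilter if the equations do. If the inverse `x` of
`z M` is bounded, its limit has many nonzero coordinates, because the limit of the right-hand sides
is no combination of few columns. If `x` is unbounded, the limits `x'`, `z'` of `x / ‖x‖` and
`‖x‖ z` exist for a similar reason and satisfy `M x' = 0` and `x' j * (z' M) j = 1`, whence
`0 = z' M x' = m`. -/
theorem exists_tendsto_reciprocalSolutions {M : Matrix (Fin r) (Fin m) ℂ} (hM : MaxMinorsNeZero M)
    (hrm : r ≤ m) (hm : m ≠ 0) {v' : Fin r → ℂ}
    (hv' : ∀ x, M *ᵥ x = v' → r ≤ (Finset.univ.filter fun j => x j ≠ 0).card)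
    {α : Type*} {l : Ultrafilter α} {N : α → Matrix (Fin r) (Fin m) ℂ} {v : α → Fin r → ℂ}
    {z : α → Fin r → ℂ} (hz : ∀ᶠ a in l, z a ∈ reciprocalSolutions M (N a) (v a))
    (hN : Tendsto N l (𝓝 M)) (hv : Tendsto v l (𝓝 v')) :
    ∃ z' ∈ reciprocalSolutions M M v', Tendsto z l (𝓝 z') := by
  let x : α → Fin m → ℂ := fun a j => (vecMul (z a) M j)⁻¹
  have hxz : ∀ᶠ a in l, ∀ j, x a j * vecMul (z a) M j = 1 := by
    filter_upwards [hz] with a ha j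
    exact inv_mul_cancel₀ (ha.1 j)
  have hNx : ∀ᶠ a in l, N a *ᵥ x a = v a := by
    filter_upwards [hz] with a ha
    exact ha.2
  have hmul : ∀ {x : α → Fin m → ℂ} {x' : Fin m → ℂ}, Tendsto x l (𝓝 x') →
      Tendsto (fun a => N a *ᵥ x a) l (𝓝 (M *ᵥ x')) := fun hx => by
    have hc : Continuous fun p : Matrix (Fin r) (Fin m) ℂ × (Fin m → ℂ) => p.1 *ᵥ p.2 :=
      Continuous.matrix_mulVec continuous_fst continuous_snd
    exact (hc.tendsto _).comp (hN.prodMk_nhds hx)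
  by_cases hbd : ∃ R, ∀ᶠ a in l, ‖x a‖ ≤ R
  · obtain ⟨R, hR⟩ := hbd
    obtain ⟨x', -, hx'⟩ := (isCompact_closedBall (0 : Fin m → ℂ) R).ultrafilter_le_nhds' (l.map x)
      (by
        change ∀ᶠ a in l, x a ∈ Metric.closedBall 0 R
        simpa using hR)
    have hx : Tendsto x l (𝓝 x') := hx'
    have hMx : M *ᵥ x' = v' := tendsto_nhds_unique (hmul hx)
      (hv.congr' (by filter_upwards [hNx] with a ha using ha.symm))
    obtain ⟨z', hz', h1⟩ := exists_tendsto_of_mul_vecMul_eq_one hM hxz hx (hv' x' hMx)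
      fun j hj => (Finset.mem_filter.1 hj).2
    refine ⟨z', ⟨fun j => right_ne_zero_of_mul_eq_one (h1 j), ?_⟩, hz'⟩
    have h2 : (fun j => (vecMul z' M j)⁻¹) = x' := by
      ext j
      exact inv_eq_of_mul_eq_one_left (h1 j)
    rw [h2, hMx]
  · exfalso
    push Not at hbd
    have hinf : Tendsto (fun a => ‖x a‖) l atTop := by
      rw [tendsto_atTop]
      intro R
      filter_upwards [hbd R] with a ha using ha.le
    have hpos : ∀ᶠ a in l, 0 < ‖x a‖ := hinf.eventually_gt_atTop 0
    let t : α → ℂ := fun a => (‖x a‖ : ℂ)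
    have ht : ∀ᶠ a in l, t a ≠ 0 := by
      filter_upwards [hpos] with a ha
      exact Complex.ofReal_ne_zero.2 ha.ne'
    let xn : α → Fin m → ℂ := fun a => (t a)⁻¹ • x a
    have hnorm : ∀ᶠ a in l, ‖xn a‖ = 1 := by
      filter_upwards [hpos] with a ha
      simp only [xn, t, norm_smul, norm_inv, Complex.norm_real, norm_norm]
      exact inv_mul_cancel₀ ha.ne'
    obtain ⟨x', -, hx'⟩ := (isCompact_closedBall (0 : Fin m → ℂ) 1).ultrafilter_le_nhds' (l.map xn)
      (by
        change ∀ᶠ a in l, xn a ∈ Metric.closedBall 0 1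
        filter_upwards [hnorm] with a ha
        simp [ha])
    have hx : Tendsto xn l (𝓝 x') := hx'
    have hx'1 : ‖x'‖ = 1 := tendsto_nhds_unique hx.norm
      (tendsto_const_nhds.congr' (by filter_upwards [hnorm] with a ha using ha.symm))
    have htinv : Tendsto (fun a => (t a)⁻¹) l (𝓝 0) := by
      have h1 := (Complex.continuous_ofReal.tendsto 0).comp (tendsto_inv_atTop_zero.comp hinf)
      rw [Complex.ofReal_zero] at h1
      refine h1.congr fun a => ?_
      simp [t]
    have hMx : M *ᵥ x' = 0 := by
      refine tendsto_nhds_unique (hmul hx) ?_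
      have h1 := htinv.smul hv
      rw [zero_smul] at h1
      refine h1.congr' ?_
      filter_upwards [hNx] with a ha
      rw [mulVec_smul, ha]
    have hcard : r ≤ (Finset.univ.filter fun j => x' j ≠ 0).card := by
      by_contra! h
      have h0 := hM.eq_zero_of_mulVec hrm h.le (fun j hj => by simpa using hj) hMx
      rw [h0, norm_zero] at hx'1
      exact zero_ne_one hx'1
    obtain ⟨z', hz', h1⟩ := exists_tendsto_of_mul_vecMul_eq_one hM (z := fun a => t a • z a)
      (by
        filter_upwards [hxz, ht] with a ha hta j
        simp only [xn, smul_vecMul, Pi.smul_apply, smul_eq_mul]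
        rw [mul_mul_mul_comm, inv_mul_cancel₀ hta, one_mul, ha]) hx hcard
      fun j hj => (Finset.mem_filter.1 hj).2
    have h2 : vecMul z' M ⬝ᵥ x' = 0 := by
      rw [← dotProduct_mulVec, hMx, dotProduct_zero]
    have h3 : vecMul z' M ⬝ᵥ x' = m := by
      simp only [dotProduct, mul_comm (vecMul z' M _), h1]
      simp
    rw [h2] at h3
    exact hm (by exact_mod_cast h3.symm)

/-- Over the reals, `l = z W` is real for every solution: with `b = im z`, the vector
`im (1 / l) = - im l / |l|²` is in the kernel of `W`, hence orthogonal to `b W = im l`. -/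
theorem im_vecMul_eq_zero {W : Matrix (Fin r) (Fin m) ℝ} {v : Fin r → ℝ} {z : Fin r → ℂ}
    (hz : z ∈ reciprocalSolutions (W.map Complex.ofReal) (W.map Complex.ofReal)
      fun i => (v i : ℂ)) (j : Fin m) : (vecMul z (W.map Complex.ofReal) j).im = 0 := by
  let b : Fin r → ℝ := fun i => (z i).im
  have hb : ∀ j, vecMul b W j = (vecMul z (W.map Complex.ofReal) j).im := fun j => by
    simp [vecMul, dotProduct, b]
  let xi : Fin m → ℝ := fun j => (vecMul z (W.map Complex.ofReal) j)⁻¹.im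
  have hxi : W *ᵥ xi = 0 := by
    ext i
    have := congrArg Complex.im (congrFun hz.2 i)
    simpa [mulVec, dotProduct, xi] using this
  have h0 : vecMul b W ⬝ᵥ xi = 0 := by
    rw [← dotProduct_mulVec, hxi, dotProduct_zero]
  have h1 : ∑ j, (vecMul z (W.map Complex.ofReal) j).im ^ 2 /
      Complex.normSq (vecMul z (W.map Complex.ofReal) j) = 0 := by
    rw [← neg_eq_zero, ← h0, dotProduct, ← Finset.sum_neg_distrib]
    refine Finset.sum_congr rfl fun j _ => ?_
    rw [hb]
    simp only [xi, Complex.inv_im]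
    ring
  have h2 := (Finset.sum_eq_zero_iff_of_nonneg fun j _ =>
    div_nonneg (sq_nonneg _) (Complex.normSq_nonneg _)).1 h1 j (Finset.mem_univ j)
  rcases div_eq_zero_iff.1 h2 with h3 | h3
  · exact pow_eq_zero_iff two_ne_zero |>.1 h3
  · exact absurd (Complex.normSq_eq_zero.1 h3) (hz.1 j)

end Reciprocal

/-! ### Reciprocal linear equations: stability of the number of solutions -/

section Reciprocal

open Matrix Filter Topology

variable {d m : ℕ}

/-- The map that takes `(e, z)` to `e` and the right-hand side of the reciprocal equations with
solution `z`, where `e` is the first row of the second matrix. -/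
noncomputable def reciprocalMap (M : Matrix (Fin (d + 1)) (Fin m) ℂ)
    (p : (Fin m → ℂ) × (Fin (d + 1) → ℂ)) : (Fin m → ℂ) × (Fin (d + 1) → ℂ) :=
  (p.1, M.updateRow 0 p.1 *ᵥ fun j => (vecMul p.2 M j)⁻¹)

theorem mem_reciprocalSolutions_updateRow {M : Matrix (Fin (d + 1)) (Fin m) ℂ} {z : Fin (d + 1) → ℂ}
    {u : (Fin m → ℂ) × (Fin (d + 1) → ℂ)} :
    z ∈ reciprocalSolutions M (M.updateRow 0 u.1) u.2 ↔
      (∀ j, vecMul z M j ≠ 0) ∧ reciprocalMap M (u.1, z) = u := by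
  unfold reciprocalSolutions reciprocalMap
  rw [Set.mem_ofPred_eq, Prod.ext_iff]
  simp

/-- The linear form `(e, z) ↦ (z M) j`. -/
noncomputable def vecMulForm (M : Matrix (Fin (d + 1)) (Fin m) ℂ) (j : Fin m) :
    (Fin m → ℂ) × (Fin (d + 1) → ℂ) →L[ℂ] ℂ :=
  (∑ k, M k j • (ContinuousLinearMap.proj k : (Fin (d + 1) → ℂ) →L[ℂ] ℂ)).comp
    (ContinuousLinearMap.snd ℂ (Fin m → ℂ) (Fin (d + 1) → ℂ))

theorem vecMulForm_apply (M : Matrix (Fin (d + 1)) (Fin m) ℂ) (j : Fin m)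
    (p : (Fin m → ℂ) × (Fin (d + 1) → ℂ)) : vecMulForm M j p = vecMul p.2 M j := by
  simp [vecMulForm, vecMul, dotProduct, mul_comm]

/-- The derivative of the entries of the matrix with first row `e`. -/
noncomputable def updateRowForm (i : Fin (d + 1)) (j : Fin m) :
    (Fin m → ℂ) × (Fin (d + 1) → ℂ) →L[ℂ] ℂ :=
  if i = 0 then (ContinuousLinearMap.proj j : (Fin m → ℂ) →L[ℂ] ℂ).comp
    (ContinuousLinearMap.fst ℂ (Fin m → ℂ) (Fin (d + 1) → ℂ)) else 0

theorem updateRowForm_apply (i : Fin (d + 1)) (j : Fin m) (p : (Fin m → ℂ) × (Fin (d + 1) → ℂ)) :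
    updateRowForm i j p = if i = 0 then p.1 j else 0 := by
  unfold updateRowForm
  split_ifs <;> rfl

/-- The derivative of `reciprocalMap`. -/
noncomputable def reciprocalDeriv (M : Matrix (Fin (d + 1)) (Fin m) ℂ)
    (p : (Fin m → ℂ) × (Fin (d + 1) → ℂ)) :
    (Fin m → ℂ) × (Fin (d + 1) → ℂ) →L[ℂ] (Fin m → ℂ) × (Fin (d + 1) → ℂ) :=
  (ContinuousLinearMap.fst ℂ _ _).prod <| ContinuousLinearMap.pi fun i => ∑ j,
    (M.updateRow 0 p.1 i j • (-(vecMul p.2 M j ^ 2)⁻¹) • vecMulForm M j +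
      (vecMul p.2 M j)⁻¹ • updateRowForm i j)

theorem reciprocalDeriv_apply_snd (M : Matrix (Fin (d + 1)) (Fin m) ℂ)
    (p q : (Fin m → ℂ) × (Fin (d + 1) → ℂ)) (i : Fin (d + 1)) : (reciprocalDeriv M p q).2 i =
      ∑ j, (M.updateRow 0 p.1 i j * (-(vecMul p.2 M j ^ 2)⁻¹ * vecMul q.2 M j) +
        (vecMul p.2 M j)⁻¹ * if i = 0 then q.1 j else 0) := by
  simp only [← vecMulForm_apply M _ q, ← updateRowForm_apply i _ q]
  have h : (reciprocalDeriv M p q).2 i = (∑ j,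
      (M.updateRow 0 p.1 i j • (-(vecMul p.2 M j ^ 2)⁻¹) • vecMulForm M j +
        (vecMul p.2 M j)⁻¹ • updateRowForm i j)) q := rfl
  rw [h, _root_.sum_apply]
  rfl

theorem hasStrictFDerivAt_reciprocalMap (M : Matrix (Fin (d + 1)) (Fin m) ℂ)
    {p : (Fin m → ℂ) × (Fin (d + 1) → ℂ)} (hp : ∀ j, vecMul p.2 M j ≠ 0) :
    HasStrictFDerivAt (reciprocalMap M) (reciprocalDeriv M p) p := by
  have hfst : HasStrictFDerivAt (fun p : (Fin m → ℂ) × (Fin (d + 1) → ℂ) => p.1)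
      (ContinuousLinearMap.fst ℂ _ _) p := hasStrictFDerivAt_fst
  refine hfst.prodMk (hasStrictFDerivAt_pi.2 fun i => ?_)
  change HasStrictFDerivAt (fun x : (Fin m → ℂ) × (Fin (d + 1) → ℂ) =>
    ∑ j, M.updateRow 0 x.1 i j * (vecMul x.2 M j)⁻¹) _ p
  refine HasStrictFDerivAt.fun_sum fun j _ => ?_
  have h1 : HasStrictFDerivAt (fun p : (Fin m → ℂ) × (Fin (d + 1) → ℂ) => vecMul p.2 M j)
      (vecMulForm M j) p :=
    (vecMulForm M j).hasStrictFDerivAt.congr_of_eventuallyEq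
      (Eventually.of_forall fun q => vecMulForm_apply M j q)
  have h2 : HasStrictFDerivAt
      (fun p : (Fin m → ℂ) × (Fin (d + 1) → ℂ) => M.updateRow 0 p.1 i j)
      (updateRowForm i j) p := by
    unfold updateRowForm
    by_cases hi : i = 0
    · subst hi
      simp only [updateRow_self, if_true]
      exact ((ContinuousLinearMap.proj j : (Fin m → ℂ) →L[ℂ] ℂ).comp
        (ContinuousLinearMap.fst ℂ (Fin m → ℂ) (Fin (d + 1) → ℂ))).hasStrictFDerivAt
    · simp only [updateRow_ne hi, if_neg hi]
      exact hasStrictFDerivAt_const _ _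
  exact h2.mul ((hasStrictDerivAt_inv (hp j)).comp_hasStrictFDerivAt p h1)

/-- At real solutions the derivative is injective: with `l = z W` it takes `(0, δ)` to
`- W (δ W / l²)`, and `δ̄ W (δ W / l²)` is a sum of squares. -/
theorem reciprocalDeriv_injective {W : Matrix (Fin (d + 1)) (Fin m) ℝ} (hW : MaxMinorsNeZero W)
    (hdm : d < m) {z : Fin (d + 1) → ℂ} (hz : ∀ j, vecMul z (W.map Complex.ofReal) j ≠ 0)
    (him : ∀ j, (vecMul z (W.map Complex.ofReal) j).im = 0) :
    Function.Injective (reciprocalDeriv (W.map Complex.ofReal)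
      ((W.map Complex.ofReal) 0, z)) := by
  set M := W.map Complex.ofReal with hM
  rw [injective_iff_map_eq_zero]
  rintro ⟨ε, δ⟩ h
  have hε : ε = 0 := congrArg Prod.fst h
  subst hε
  let w : Fin m → ℂ := fun j => (vecMul z M j ^ 2)⁻¹ * vecMul δ M j
  have h1 : M *ᵥ w = 0 := by
    ext i
    have h2 : (reciprocalDeriv M (M 0, z) (0, δ)).2 i = 0 := congrFun (congrArg Prod.snd h) i
    have h3 : M.updateRow 0 (M 0) = M := updateRow_eq_self M 0
    rw [reciprocalDeriv_apply_snd, ← neg_eq_zero, ← Finset.sum_neg_distrib, h3] at h2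
    change ∑ j, M i j * w j = 0
    rw [← h2]
    refine Finset.sum_congr rfl fun j _ => ?_
    simp [w]
  have h2 : ∑ j, Complex.normSq (vecMul δ M j) / (vecMul z M j).re ^ 2 = 0 := by
    have h3 : vecMul (star δ) M ⬝ᵥ w = 0 := by
      rw [← dotProduct_mulVec, h1, dotProduct_zero]
    have h4 : ∀ j, vecMul (star δ) M j = starRingEnd ℂ (vecMul δ M j) := fun j => by
      simp [vecMul, dotProduct, hM]
    have h5 : ((∑ j, Complex.normSq (vecMul δ M j) / (vecMul z M j).re ^ 2 : ℝ) : ℂ) = 0 := by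
      rw [← h3]
      push_cast
      refine Finset.sum_congr rfl fun j _ => ?_
      have h6 : ((vecMul z M j).re : ℂ) = vecMul z M j := by
        apply Complex.ext <;> simp [him j]
      rw [h4, h6, Complex.normSq_eq_conj_mul_self]
      simp only [w]
      ring
    exact_mod_cast h5
  have h3 : ∀ j, vecMul δ M j = 0 := fun j => by
    have h4 := (Finset.sum_eq_zero_iff_of_nonneg fun j _ =>
      div_nonneg (Complex.normSq_nonneg _) (sq_nonneg _)).1 h2 j (Finset.mem_univ j)
    rcases div_eq_zero_iff.1 h4 with h5 | h5
    · exact Complex.normSq_eq_zero.1 h5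
    · exact absurd (Complex.ext (pow_eq_zero_iff two_ne_zero |>.1 h5) (him j)) (hz j)
  have h4 : δ = 0 := hW.map.vecMul_injective hdm (by
    ext j
    simp only [zero_vecMul, Pi.zero_apply]
    exact h3 j)
  rw [h4]
  rfl

/-- `reciprocalMap` is a local homeomorphism at real solutions. -/
theorem exists_openPartialHomeomorph {W : Matrix (Fin (d + 1)) (Fin m) ℝ} (hW : MaxMinorsNeZero W)
    (hdm : d < m) {z : Fin (d + 1) → ℂ} (hz : ∀ j, vecMul z (W.map Complex.ofReal) j ≠ 0)
    (him : ∀ j, (vecMul z (W.map Complex.ofReal) j).im = 0) :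
    ∃ φ : OpenPartialHomeomorph ((Fin m → ℂ) × (Fin (d + 1) → ℂ))
      ((Fin m → ℂ) × (Fin (d + 1) → ℂ)),
      ((W.map Complex.ofReal) 0, z) ∈ φ.source ∧ ⇑φ = reciprocalMap (W.map Complex.ofReal) := by
  have hinj := reciprocalDeriv_injective hW hdm hz him
  have hsurj := LinearMap.injective_iff_surjective.1 hinj
  let L := ContinuousLinearEquiv.ofBijective _ (LinearMap.ker_eq_bot.2 hinj)
    (LinearMap.range_eq_top.2 hsurj)
  have hd : HasStrictFDerivAt (reciprocalMap (W.map Complex.ofReal))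
      (L : _ →L[ℂ] (Fin m → ℂ) × (Fin (d + 1) → ℂ)) ((W.map Complex.ofReal) 0, z) := by
    rw [ContinuousLinearEquiv.coe_ofBijective]
    exact hasStrictFDerivAt_reciprocalMap _ hz
  exact ⟨hd.toOpenPartialHomeomorph _, hd.mem_toOpenPartialHomeomorph_source,
    hd.toOpenPartialHomeomorph_coe⟩

open MvPolynomial in
/-- The points off the zero set of a nonzero polynomial are dense: a line through such a point meets
the zero set in finitely many points. -/
theorem dense_eval_ne_zero {σ : Type} [Finite σ] {f : MvPolynomial σ ℂ} (hf : f ≠ 0) :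
    Dense {p : σ → ℂ | eval p f ≠ 0} := by
  intro p
  obtain ⟨q, hq⟩ := exists_eval_ne_zero hf
  let g : Polynomial ℂ :=
    aeval (fun i => Polynomial.C (p i) + Polynomial.X * Polynomial.C (q i - p i)) f
  have hg : ∀ t : ℂ, g.eval t = eval (fun i => p i + t * (q i - p i)) f := fun t => by
    have := map_aeval_apply (Polynomial.evalRingHom t) (fun c => by simp [Polynomial.algebraMap_eq])
      (fun i => Polynomial.C (p i) + Polynomial.X * Polynomial.C (q i - p i)) f
    refine this.trans ?_
    simp
  have hg0 : g ≠ 0 := by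
    intro h
    have := hg 1
    rw [h, Polynomial.eval_zero] at this
    exact hq (by simpa using this.symm)
  have hev : ∀ᶠ t in 𝓝[≠] (0 : ℂ),
      (fun i => p i + t * (q i - p i)) ∈ {p : σ → ℂ | eval p f ≠ 0} := by
    have hfin : (g.roots.toFinset : Set ℂ).Finite := Finset.finite_toSet _
    have h1 : ∀ᶠ t in 𝓝[≠] (0 : ℂ), t ∉ (g.roots.toFinset : Set ℂ) \ {0} := by
      refine mem_nhdsWithin_of_mem_nhds
        ((hfin.subset Set.sdiff_subset).isClosed.isOpen_compl.mem_nhds ?_)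
      simp
    filter_upwards [h1, self_mem_nhdsWithin] with t ht ht0 h0
    refine ht ⟨?_, ht0⟩
    rw [Finset.mem_coe, Multiset.mem_toFinset, Polynomial.mem_roots hg0, Polynomial.IsRoot.def, hg]
    exact h0
  have hcont : Tendsto (fun t : ℂ => fun i => p i + t * (q i - p i)) (𝓝[≠] 0) (𝓝 p) := by
    have h1 : Continuous (fun t : ℂ => fun i => p i + t * (q i - p i)) := by fun_prop
    have h2 := h1.tendsto 0
    simp only [zero_mul, add_zero] at h2
    exact h2.mono_left nhdsWithin_le_nhds
  exact mem_closure_of_tendsto hcont hev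

end Reciprocal

section Reciprocal

open Matrix Filter Topology

variable {d m : ℕ}

/-- Real reciprocal equations have finitely many solutions, with disjoint neighbourhoods on which
`reciprocalMap` is injective and open. Infinitely many solutions would accumulate at a solution,
against local injectivity. -/
theorem exists_neighbourhoods {W : Matrix (Fin (d + 1)) (Fin m) ℝ} (hW : MaxMinorsNeZero W)
    (hdm : d < m) {v : Fin (d + 1) → ℝ}
    (hv : ∀ x, W.map Complex.ofReal *ᵥ x = (fun i => (v i : ℂ)) →
      d + 1 ≤ (Finset.univ.filter fun j => x j ≠ 0).card) :
    (reciprocalSolutions (W.map Complex.ofReal) (W.map Complex.ofReal) fun i => (v i : ℂ)).Finite ∧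
    ∃ O : (Fin (d + 1) → ℂ) → Set ((Fin m → ℂ) × (Fin (d + 1) → ℂ)),
      ∀ z ∈ reciprocalSolutions (W.map Complex.ofReal) (W.map Complex.ofReal) fun i => (v i : ℂ),
        ((W.map Complex.ofReal) 0, z) ∈ O z ∧ IsOpen (O z) ∧
        (∀ p ∈ O z, ∀ j, vecMul p.2 (W.map Complex.ofReal) j ≠ 0) ∧
        Set.InjOn (reciprocalMap (W.map Complex.ofReal)) (O z) ∧
        ContinuousOn (reciprocalMap (W.map Complex.ofReal)) (O z) ∧
        (∀ U ⊆ O z, IsOpen U → IsOpen (reciprocalMap (W.map Complex.ofReal) '' U)) ∧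
        ∀ z' ∈ reciprocalSolutions (W.map Complex.ofReal) (W.map Complex.ofReal)
          fun i => (v i : ℂ), z ≠ z' → Disjoint (O z) (O z') := by
  classical
  set M := W.map Complex.ofReal with hM
  set S := reciprocalSolutions M M fun i => (v i : ℂ) with hS
  have hΦ : ∀ z ∈ S, reciprocalMap M (M 0, z) = (M 0, fun i => (v i : ℂ)) := fun z hz => by
    have h1 : M.updateRow 0 (M 0) = M := updateRow_eq_self M 0
    unfold reciprocalMap
    simp only [h1, hz.2]
  have : Nonempty (OpenPartialHomeomorph ((Fin m → ℂ) × (Fin (d + 1) → ℂ))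
      ((Fin m → ℂ) × (Fin (d + 1) → ℂ))) := ⟨OpenPartialHomeomorph.refl _⟩
  choose! φ hφ hφM using fun z (hz : z ∈ S) =>
    exists_openPartialHomeomorph hW hdm hz.1 (im_vecMul_eq_zero hz)
  have hfin : S.Finite := by
    by_contra hinf
    have : Infinite S := Set.infinite_coe_iff.2 hinf
    obtain ⟨z', hz', hlim⟩ := exists_tendsto_reciprocalSolutions hW.map hdm (by omega) hv
      (l := hyperfilter S) (N := fun _ => M) (v := fun _ i => (v i : ℂ)) (z := Subtype.val)
      (Eventually.of_forall fun z => z.2) tendsto_const_nhds tendsto_const_nhds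
    have h1 : Tendsto (fun z : S => (M 0, (z : Fin (d + 1) → ℂ))) (hyperfilter S) (𝓝 (M 0, z')) :=
      tendsto_const_nhds.prodMk_nhds hlim
    have h2 : ∀ᶠ z : S in hyperfilter S, (z : Fin (d + 1) → ℂ) = z' := by
      filter_upwards [h1.eventually ((φ z').open_source.mem_nhds (hφ z' hz'))] with z hz
      have h3 := (φ z').injOn hz (hφ z' hz')
        (by rw [hφM z' hz', hΦ z z.2, hΦ z' hz'])
      exact congrArg Prod.snd h3
    have h3 : ({⟨z', hz'⟩} : Set S) ∈ hyperfilter S := by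
      filter_upwards [h2] with z hz
      exact Subtype.ext hz
    exact notMem_hyperfilter_of_finite (Set.finite_singleton _) h3
  obtain ⟨V, hV, hdisj⟩ := hfin.t2_separation
  have hopen : IsOpen {p : (Fin m → ℂ) × (Fin (d + 1) → ℂ) | ∀ j, vecMul p.2 M j ≠ 0} := by
    simp only [Set.ofPred_forall]
    refine isOpen_iInter_of_finite fun j => isOpen_ne_fun ?_ continuous_const
    exact (continuous_apply j).comp (Continuous.matrix_vecMul continuous_snd continuous_const)
  refine ⟨hfin, fun z => (φ z).source ∩ {p | p.2 ∈ V z} ∩ {p | ∀ j, vecMul p.2 M j ≠ 0},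
    fun z hz => ⟨⟨⟨hφ z hz, (hV z).1⟩, hz.1⟩, ?_, fun p hp => hp.2, ?_, ?_, ?_, ?_⟩⟩
  · exact ((φ z).open_source.inter ((hV z).2.preimage continuous_snd)).inter hopen
  · rw [← hφM z hz]
    exact (φ z).injOn.mono fun p hp => hp.1.1
  · rw [← hφM z hz]
    exact (φ z).continuousOn.mono fun p hp => hp.1.1
  · intro U hU hUo
    rw [← hφM z hz]
    exact (φ z).isOpen_image_of_subset_source hUo fun p hp => (hU hp).1.1
  · intro z' hz' hne
    rw [Set.disjoint_left]
    intro p hp hp'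
    exact (Set.disjoint_left.1 (hdisj hz hz' hne)) hp.1.2 hp'.1.2

/-- A small perturbation of the right-hand side and the first row of one of the two matrices does
not change the number of solutions of real reciprocal equations. It can be chosen in any given dense
set, and such that the solutions lie off the hyperplane `z 0 = 0`. -/
theorem exists_perturbation {W : Matrix (Fin (d + 1)) (Fin m) ℝ} (hW : MaxMinorsNeZero W)
    (hdm : d < m) {v : Fin (d + 1) → ℝ}
    (hv : ∀ x, W.map Complex.ofReal *ᵥ x = (fun i => (v i : ℂ)) →
      d + 1 ≤ (Finset.univ.filter fun j => x j ≠ 0).card)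
    {P : Set ((Fin m → ℂ) × (Fin (d + 1) → ℂ))} (hP : Dense P) :
    ∃ u ∈ P, (reciprocalSolutions (W.map Complex.ofReal)
        ((W.map Complex.ofReal).updateRow 0 u.1) u.2).encard =
      (reciprocalSolutions (W.map Complex.ofReal) (W.map Complex.ofReal)
        fun i => (v i : ℂ)).encard ∧
      ∀ z ∈ reciprocalSolutions (W.map Complex.ofReal)
        ((W.map Complex.ofReal).updateRow 0 u.1) u.2, z 0 ≠ 0 := by
  classical
  obtain ⟨hfin, O, hO⟩ := exists_neighbourhoods hW hdm hv
  set M := W.map Complex.ofReal with hM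
  set S := reciprocalSolutions M M fun i => (v i : ℂ) with hS
  set u₀ : (Fin m → ℂ) × (Fin (d + 1) → ℂ) := (M 0, fun i => (v i : ℂ)) with hu₀
  have hMM : M.updateRow 0 (M 0) = M := updateRow_eq_self M 0
  have hΦ : ∀ z ∈ S, reciprocalMap M (M 0, z) = u₀ := fun z hz => by
    unfold reciprocalMap
    simp only [hMM, hz.2, hu₀]
  -- All solutions of nearby equations are close to solutions of the given ones.
  have hnear : ∀ᶠ u in 𝓝 u₀, ∀ z ∈ reciprocalSolutions M (M.updateRow 0 u.1) u.2,
      ∃ z' ∈ S, (u.1, z) ∈ O z' := by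
    by_contra hcon
    rw [not_eventually] at hcon
    have hne := frequently_iff_neBot.1 hcon
    obtain ⟨l, hl'⟩ := Ultrafilter.exists_le (𝓝 u₀ ⊓ 𝓟 {u : (Fin m → ℂ) × (Fin (d + 1) → ℂ) |
      ¬ ∀ z ∈ reciprocalSolutions M (M.updateRow 0 u.1) u.2, ∃ z' ∈ S, (u.1, z) ∈ O z'})
    have hl : ↑l ≤ 𝓝 u₀ := hl'.trans inf_le_left
    have hlb : ∀ᶠ u : (Fin m → ℂ) × (Fin (d + 1) → ℂ) in l, ¬ ∀ z ∈ reciprocalSolutions M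
      (M.updateRow 0 u.1) u.2, ∃ z' ∈ S, (u.1, z) ∈ O z' :=
      (hl'.trans inf_le_right) (mem_principal_self _)
    push Not at hlb
    let z : (Fin m → ℂ) × (Fin (d + 1) → ℂ) → Fin (d + 1) → ℂ := fun u =>
      if h : ∃ z ∈ reciprocalSolutions M (M.updateRow 0 u.1) u.2, ∀ z' ∈ S, (u.1, z) ∉ O z' then
        h.choose else 0
    have hz : ∀ᶠ u in l, z u ∈ reciprocalSolutions M (M.updateRow 0 u.1) u.2 ∧
        ∀ z' ∈ S, (u.1, z u) ∉ O z' := by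
      filter_upwards [hlb] with u hu
      simp only [z, dif_pos hu]
      exact hu.choose_spec
    have h1 : Tendsto (fun u : (Fin m → ℂ) × (Fin (d + 1) → ℂ) => u.1) l (𝓝 (M 0)) :=
      (continuous_fst.tendsto u₀).comp hl
    have h2 : Tendsto (fun u : (Fin m → ℂ) × (Fin (d + 1) → ℂ) => u.2) l
        (𝓝 fun i => (v i : ℂ)) := (continuous_snd.tendsto u₀).comp hl
    have h3 : Tendsto (fun u : (Fin m → ℂ) × (Fin (d + 1) → ℂ) => M.updateRow 0 u.1) l (𝓝 M) := by
      have hc : Continuous fun e : Fin m → ℂ => M.updateRow 0 e :=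
        continuous_const.matrix_updateRow 0 continuous_id
      have := (hc.tendsto (M 0)).comp h1
      rwa [hMM] at this
    obtain ⟨z', hz', hlim⟩ := exists_tendsto_reciprocalSolutions hW.map hdm (by omega) hv
      (l := l) (hz.mono fun u hu => hu.1) h3 h2
    have h4 := (h1.prodMk_nhds hlim).eventually ((hO z' hz').2.1.mem_nhds (hO z' hz').1)
    obtain ⟨u, hu1, hu2⟩ := (h4.and hz).exists
    exact hu2.2 z' hz' hu1
  -- Every solution of the given equations deforms.
  have himage : ∀ᶠ u in 𝓝 u₀, ∀ z ∈ S, u ∈ reciprocalMap M '' O z := by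
    rw [Filter.eventually_all_finite hfin]
    intro z hz
    refine ((hO z hz).2.2.2.2.2.1 _ subset_rfl (hO z hz).2.1).mem_nhds ?_
    exact ⟨_, (hO z hz).1, hΦ z hz⟩
  obtain ⟨V, hV, hVo, hVu⟩ := _root_.eventually_nhds_iff.1 (hnear.and himage)
  -- The deformed solutions can be moved off the hyperplane `z 0 = 0`.
  have hmove : ∀ T : Finset (Fin (d + 1) → ℂ), (T : Set (Fin (d + 1) → ℂ)) ⊆ S →
      ∃ V' ⊆ V, IsOpen V' ∧ V'.Nonempty ∧
        ∀ u ∈ V', ∀ z ∈ T, ∀ p ∈ O z, reciprocalMap M p = u → p.2 0 ≠ 0 := by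
    intro T
    induction T using Finset.induction_on with
    | empty => exact fun _ => ⟨V, subset_rfl, hVo, ⟨u₀, hVu⟩, by simp⟩
    | insert z T hzT ih =>
      intro hT
      rw [Finset.coe_insert, Set.insert_subset_iff] at hT
      obtain ⟨V', hV'V, hV'o, ⟨u, hu⟩, hV'⟩ := ih hT.2
      obtain ⟨-, hOo, -, hinj, hcont, himg, -⟩ := hO z hT.1
      have hpre : IsOpen (O z ∩ reciprocalMap M ⁻¹' V') := hcont.isOpen_inter_preimage hOo hV'o
      obtain ⟨p, hpO, hpu⟩ := (hV u (hV'V hu)).2 z hT.1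
      have hdense : Dense {p : (Fin m → ℂ) × (Fin (d + 1) → ℂ) | p.2 0 ≠ 0} := by
        have h1 : Dense ({0}ᶜ : Set ℂ) := dense_compl_singleton 0
        exact h1.preimage ((isOpenMap_eval 0).comp isOpenMap_snd)
      have hne0 : IsOpen {p : (Fin m → ℂ) × (Fin (d + 1) → ℂ) | p.2 0 ≠ 0} :=
        isOpen_ne_fun ((continuous_apply 0).comp continuous_snd) continuous_const
      obtain ⟨p', hp'⟩ := hdense.inter_open_nonempty _ hpre ⟨p, hpO, by
        rw [Set.mem_preimage, hpu]; exact hu⟩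
      refine ⟨reciprocalMap M '' (O z ∩ reciprocalMap M ⁻¹' V' ∩ {p | p.2 0 ≠ 0}), ?_,
        himg _ (fun q hq => hq.1.1) (hpre.inter hne0), ⟨_, p', hp', rfl⟩, ?_⟩
      · rintro _ ⟨q, hq, rfl⟩
        exact hV'V hq.1.2
      · rintro _ ⟨q, hq, rfl⟩ z₁ hz₁ p₁ hp₁ hpq
        rcases Finset.mem_insert.1 hz₁ with rfl | hz₁
        · rw [hinj hp₁ hq.1.1 hpq]
          exact hq.2
        · exact hV' _ hq.1.2 z₁ hz₁ p₁ hp₁ hpq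
  obtain ⟨V', hV'V, hV'o, hV'ne, hV'⟩ := hmove hfin.toFinset (by simp)
  obtain ⟨u, huV', huP⟩ := hP.inter_open_nonempty V' hV'o hV'ne
  obtain ⟨hnu, hiu⟩ := hV u (hV'V huV')
  have hsol : ∀ z ∈ S, ∃ z', (u.1, z') ∈ O z ∧ reciprocalMap M (u.1, z') = u := fun z hz => by
    obtain ⟨p, hpO, hpu⟩ := hiu z hz
    have h0 : p.1 = u.1 := by rw [← hpu]; rfl
    have h1 : p = (u.1, p.2) := Prod.ext h0 rfl
    exact ⟨p.2, by rwa [← h1], by rwa [← h1]⟩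
  choose! g hgO hgu using hsol
  refine ⟨u, huP, ?_, fun z hz => ?_⟩
  · have hinj : Set.InjOn g S := fun z hz z' hz' h => by
      by_contra hne
      have h1 := hgO z hz
      rw [h] at h1
      exact Set.disjoint_left.1 ((hO z hz).2.2.2.2.2.2 z' hz' hne) h1 (hgO z' hz')
    rw [← hinj.encard_image]
    congr 1
    ext z
    constructor
    · intro hz
      obtain ⟨z', hz', hzO⟩ := hnu z hz
      refine ⟨z', hz', ?_⟩
      have h1 := (hO z' hz').2.2.2.1 (hgO z' hz') hzO
        ((hgu z' hz').trans (mem_reciprocalSolutions_updateRow.1 hz).2.symm)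
      exact congrArg Prod.snd h1
    · rintro ⟨z', hz', rfl⟩
      exact mem_reciprocalSolutions_updateRow.2
        ⟨(hO z' hz').2.2.1 _ (hgO z' hz'), hgu z' hz'⟩
  · obtain ⟨z', hz', hzO⟩ := hnu z hz
    exact hV' u huV' z' (hfin.mem_toFinset.2 hz') _ hzO (mem_reciprocalSolutions_updateRow.1 hz).2

end Reciprocal

/-! ### Sections of the central curve as reciprocal equations -/

section Sections

open Matrix Filter Topology MvPolynomial

variable {d m : ℕ}

/-- A section of the set of central points consists of the points `x = 1 / (z M)`, `y = - z' / z 0`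
for the solutions `z = (z 0, z')`, `z 0 ≠ 0`, of reciprocal equations whose first row and first
right-hand side are the coefficients of the hyperplane. -/
theorem encard_centralSection (hdm : d < m) {p : LPCoord m d ⊕ Option (Fin m) → ℂ}
    (hM : MaxMinorsNeZero (lpMatrix fun i => p (Sum.inl i)))
    (h0 : ∀ z ∈ reciprocalSolutions (lpMatrix fun i => p (Sum.inl i))
      ((lpMatrix fun i => p (Sum.inl i)).updateRow 0 fun j => p (Sum.inr (some j)))
      (Fin.cons (p (Sum.inr none)) fun i => p (Sum.inl (Sum.inr (Sum.inl i)))), z 0 ≠ 0) :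
    (reciprocalSolutions (lpMatrix fun i => p (Sum.inl i))
      ((lpMatrix fun i => p (Sum.inl i)).updateRow 0 fun j => p (Sum.inr (some j)))
      (Fin.cons (p (Sum.inr none)) fun i => p (Sum.inl (Sum.inr (Sum.inl i))))).encard =
    (centralSection p).encard := by
  set θ : LPCoord m d → ℂ := fun i => p (Sum.inl i) with hθ
  set M := lpMatrix θ with hMdef
  set S := reciprocalSolutions M (M.updateRow 0 fun j => p (Sum.inr (some j)))
    (Fin.cons (p (Sum.inr none)) fun i => p (Sum.inl (Sum.inr (Sum.inl i)))) with hS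
  let Ψ : (Fin (d + 1) → ℂ) → Fin m ⊕ Fin d → ℂ := fun z =>
    Sum.elim (fun j => (vecMul z M j)⁻¹) fun i => -(z (Fin.succ i) / z 0)
  have hinj : Set.InjOn Ψ S := fun z _ z' _ h => by
    refine hM.vecMul_injective hdm (funext fun j => ?_)
    exact inv_injective (congrFun h (Sum.inl j))
  have hmem : ∀ z : Fin (d + 1) → ℂ, z ∈ S ↔ (∀ j, vecMul z M j ≠ 0) ∧
      (∑ j, p (Sum.inr (some j)) * (vecMul z M j)⁻¹ = p (Sum.inr none) ∧
      ∀ i, ∑ j, θ (Sum.inl (i, j)) * (vecMul z M j)⁻¹ = θ (Sum.inr (Sum.inl i))) := fun z => by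
    refine and_congr_right fun _ => ?_
    rw [funext_iff, Fin.forall_fin_succ]
    rfl
  rw [← hinj.encard_image]
  congr 1
  ext q
  constructor
  · rintro ⟨z, hz, rfl⟩
    have hz0 := h0 z hz
    obtain ⟨hz1, hz2, hz3⟩ := (hmem z).1 hz
    refine ⟨⟨(z 0)⁻¹, inv_ne_zero hz0, fun j => ?_, hz3⟩, hz2⟩
    have h1 : z = z 0 • (Fin.cons 1 fun i => -Ψ z (Sum.inr i) : Fin (d + 1) → ℂ) := by
      ext i
      refine Fin.cases ?_ (fun i => ?_) i
      · simp
      · simp [Ψ, mul_div_cancel₀ _ hz0]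
    have h2 : vecMul z M j = z 0 * slack θ (Ψ z) j := by
      conv_lhs => rw [h1]
      rw [smul_vecMul, Pi.smul_apply, ← slack_eq_vecMul, smul_eq_mul]
    have h3 : slack θ (Ψ z) j ≠ 0 := right_ne_zero_of_mul (h2 ▸ hz1 j)
    change (vecMul z M j)⁻¹ * slack θ (Ψ z) j = (z 0)⁻¹
    rw [h2, mul_inv, mul_assoc, inv_mul_cancel₀ h3, mul_one]
  · rintro ⟨⟨lam, hlam, hq1, hq2⟩, hq3⟩
    let z : Fin (d + 1) → ℂ := lam⁻¹ • (Fin.cons 1 fun i => -q (Sum.inr i) : Fin (d + 1) → ℂ)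
    have h1 : ∀ j, (vecMul z M j)⁻¹ = q (Sum.inl j) := fun j => by
      refine inv_eq_of_mul_eq_one_left ?_
      change q (Sum.inl j) * vecMul z (lpMatrix θ) j = 1
      rw [smul_vecMul, Pi.smul_apply, ← slack_eq_vecMul, smul_eq_mul, mul_left_comm, hq1,
        inv_mul_cancel₀ hlam]
    have h2 : ∀ j, vecMul z M j ≠ 0 := fun j h => by
      have h3 : q (Sum.inl j) = 0 := by rw [← h1, h, _root_.inv_zero]
      exact hlam (by rw [← hq1 j, h3, zero_mul])
    refine ⟨z, (hmem z).2 ⟨h2, ?_, fun i => ?_⟩, ?_⟩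
    · simp only [h1]; exact hq3
    · simp only [h1]; exact hq2 i
    · ext (j | i)
      · exact h1 j
      · simp only [Ψ, z, Sum.elim_inr, Pi.smul_apply, Fin.cons_succ, Fin.cons_zero, smul_eq_mul]
        field_simp

/-- The position of the coordinates of a linear program and a hyperplane, when the matrix with first
row `c` and further rows `A` is fixed: the others are the first row and the right-hand side of
reciprocal equations. -/
def sectionIndex : LPCoord m d ⊕ Option (Fin m) →
    (Fin (d + 1) × Fin m) ⊕ (Fin m ⊕ Fin (d + 1))
  | Sum.inl (Sum.inl ij) => Sum.inl (Fin.succ ij.1, ij.2)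
  | Sum.inl (Sum.inr (Sum.inr j)) => Sum.inl (0, j)
  | Sum.inl (Sum.inr (Sum.inl i)) => Sum.inr (Sum.inr (Fin.succ i))
  | Sum.inr (some j) => Sum.inr (Sum.inl j)
  | Sum.inr none => Sum.inr (Sum.inr 0)

theorem sectionIndex_injective : Function.Injective (sectionIndex (m := m) (d := d)) := by
  rintro ((⟨i, j⟩ | i | j) | (_ | j)) ((⟨i', j'⟩ | i' | j') | (_ | j')) h <;>
    simp_all [sectionIndex, Fin.succ_ne_zero, (Fin.succ_ne_zero _).symm]

/-- For a generic real matrix `W`, and a real right-hand side `v` which is no combination of few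
columns of `W`, the number of solutions of the reciprocal equations of `W` is the number of points
of a generic section. -/
theorem forGeneric_encard_reciprocalSolutions (hdm : d < m) {n : ℕ} {F : CutRing m d} (hF0 : F ≠ 0)
    (hF : ∀ p, eval p F ≠ 0 → (centralSection p).encard = n) :
    ForGeneric fun k : Fin (d + 1) × Fin m → ℝ =>
      MaxMinorsNeZero (Matrix.of fun i j => k (i, j)) ∧
      ∀ v : Fin (d + 1) → ℝ, (∀ x, (Matrix.of fun i j => k (i, j)).map Complex.ofReal *ᵥ x =
          (fun i => (v i : ℂ)) → d + 1 ≤ (Finset.univ.filter fun j => x j ≠ 0).card) →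
        (reciprocalSolutions ((Matrix.of fun i j => k (i, j)).map Complex.ofReal)
          ((Matrix.of fun i j => k (i, j)).map Complex.ofReal) fun i => (v i : ℂ)).encard = n := by
  refine ((forGeneric_exists_specialization hF0 sectionIndex_injective).and
    (forGeneric_maxMinorsNeZero (a := fun i j => (i, j)) fun _ _ h => h)).mono ?_
  rintro k ⟨⟨G, hG0, hG⟩, hW⟩
  refine ⟨hW, fun v hv => ?_⟩
  have hdense : Dense {u : (Fin m → ℂ) × (Fin (d + 1) → ℂ) |
      eval (Sum.elim u.1 u.2) G ≠ 0} :=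
    (dense_eval_ne_zero hG0).preimage
      (Homeomorph.sumArrowHomeomorphProdArrow
        (ι := Fin m) (ι' := Fin (d + 1)) (X := ℂ)).symm.isOpenMap
  obtain ⟨u, huP, hcard, hu0⟩ := exists_perturbation hW hdm hv hdense
  let p : LPCoord m d ⊕ Option (Fin m) → ℂ := fun i =>
    Sum.elim (fun i => (k i : ℂ)) (Sum.elim u.1 u.2) (sectionIndex i)
  have hpM : lpMatrix (fun i => p (Sum.inl i)) =
      (Matrix.of fun i j => k (i, j)).map Complex.ofReal := by
    ext i j
    refine Fin.cases ?_ (fun i => ?_) i <;> rfl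
  have hpv : (Fin.cons (p (Sum.inr none)) fun i => p (Sum.inl (Sum.inr (Sum.inl i))) :
      Fin (d + 1) → ℂ) = u.2 := by
    ext i
    refine Fin.cases ?_ (fun i => ?_) i <;> rfl
  have hpe : (fun j => p (Sum.inr (some j))) = u.1 := rfl
  have h1 := encard_centralSection hdm (p := p)
  rw [hpM, hpv, hpe] at h1
  rw [← hcard, h1 hW.map hu0]
  exact hF p (by rw [← hG]; exact huP)

end Sections

/-! ### Likelihood equations of diagonal models -/

section Likelihood

open Matrix MvPolynomial

variable {r m : ℕ}

/-- The complex span of a diagonal model consists of the diagonal matrices with diagonal `z W`. -/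
theorem mem_span_complexify_iff {W : Matrix (Fin r) (Fin m) ℝ} {K : Matrix (Fin m) (Fin m) ℂ} :
    K ∈ Submodule.span ℂ (complexify '' (Submodule.span ℝ
      (Set.range fun i => diagonal (W i)) : Set (Matrix (Fin m) (Fin m) ℝ))) ↔
    ∃ z, K = diagonal (vecMul z (W.map Complex.ofReal)) := by
  constructor
  · intro hK
    induction hK using Submodule.span_induction with
    | mem K hK =>
      obtain ⟨D, hD, rfl⟩ := hK
      induction hD using Submodule.span_induction with
      | mem D hD =>
        obtain ⟨i, rfl⟩ := hD
        refine ⟨Pi.single i 1, ?_⟩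
        rw [single_one_vecMul, complexify, diagonal_map Complex.ofReal_zero]
        rfl
      | zero => exact ⟨0, by ext; simp [complexify]⟩
      | add D D' _ _ h h' =>
        obtain ⟨z, hz⟩ := h
        obtain ⟨z', hz'⟩ := h'
        refine ⟨z + z', ?_⟩
        have h1 : complexify (D + D') = complexify D + complexify D' := by
          ext; simp [complexify]
        rw [add_vecMul, h1, hz, hz', diagonal_add]
        rfl
      | smul a D _ h =>
        obtain ⟨z, hz⟩ := h
        refine ⟨(a : ℂ) • z, ?_⟩
        rw [smul_vecMul, diagonal_smul, ← hz]
        ext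
        simp [complexify]
    | zero => exact ⟨0, by simp⟩
    | add K K' _ _ h h' =>
      obtain ⟨z, rfl⟩ := h
      obtain ⟨z', rfl⟩ := h'
      exact ⟨z + z', by rw [add_vecMul, diagonal_add]; rfl⟩
    | smul a K _ h =>
      obtain ⟨z, rfl⟩ := h
      exact ⟨a • z, by rw [smul_vecMul, diagonal_smul]⟩
  · rintro ⟨z, rfl⟩
    have h : diagonal (vecMul z (W.map Complex.ofReal)) =
        ∑ i, z i • complexify (diagonal (W i)) := by
      ext j k
      by_cases hjk : j = k
      · subst hjk
        simp [Matrix.sum_apply, complexify, vecMul, dotProduct]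
      · simp [Matrix.sum_apply, complexify, hjk]
    rw [h]
    exact Submodule.sum_mem _ fun i _ => Submodule.smul_mem _ _
      (Submodule.subset_span ⟨_, Submodule.subset_span ⟨i, rfl⟩, rfl⟩)

/-- Orthogonality to a diagonal model is a condition on diagonals. -/
theorem forall_trace_eq_zero_iff {W : Matrix (Fin r) (Fin m) ℝ} {T : Matrix (Fin m) (Fin m) ℂ} :
    (∀ D ∈ Submodule.span ℝ (Set.range fun i => diagonal (W i)),
      trace (T * complexify D) = 0) ↔ W.map Complex.ofReal *ᵥ (fun j => T j j) = 0 := by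
  have hgen : ∀ i, trace (T * complexify (diagonal (W i))) =
      (W.map Complex.ofReal *ᵥ fun j => T j j) i := fun i => by
    rw [complexify, diagonal_map Complex.ofReal_zero]
    simp only [trace, diag_apply, mul_diagonal, mulVec, dotProduct, map_apply]
    exact Finset.sum_congr rfl fun j _ => mul_comm _ _
  constructor
  · intro h
    ext i
    rw [← hgen]
    exact h _ (Submodule.subset_span ⟨i, rfl⟩)
  · intro h D hD
    induction hD using Submodule.span_induction with
    | mem D hD =>
      obtain ⟨i, rfl⟩ := hD
      rw [hgen, h, Pi.zero_apply]
    | zero => simp [complexify]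
    | add D D' _ _ h h' =>
      have h1 : complexify (D + D') = complexify D + complexify D' := by
        ext; simp [complexify]
      rw [h1, mul_add, trace_add, h, h', add_zero]
    | smul a D _ h =>
      have h1 : complexify (a • D) = (a : ℂ) • complexify D := by
        ext; simp [complexify]
      rw [h1, Matrix.mul_smul, trace_smul, h, smul_zero]

/-- The likelihood equations of a diagonal model are reciprocal equations in the coordinates of the
concentration matrix. -/
theorem encard_likelihoodSolutions (hrm : r ≤ m) {W : Matrix (Fin r) (Fin m) ℝ}
    (hW : MaxMinorsNeZero W) (S : Matrix (Fin m) (Fin m) ℝ) :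
    (likelihoodSolutions (Submodule.span ℝ (Set.range fun i => diagonal (W i))) S).encard =
      (reciprocalSolutions (W.map Complex.ofReal) (W.map Complex.ofReal)
        fun i => ((W *ᵥ fun j => S j j) i : ℂ)).encard := by
  set M := W.map Complex.ofReal with hM
  let Ψ : (Fin r → ℂ) → Matrix (Fin m) (Fin m) ℂ := fun z => diagonal fun j => (vecMul z M j)⁻¹
  have hinj : Function.Injective Ψ := fun z z' h => by
    refine hW.map.vecMul_injective hrm (funext fun j => inv_injective ?_)
    exact congrFun (diagonal_injective h) j
  have hv : (fun i => ((W *ᵥ fun j => S j j) i : ℂ)) = M *ᵥ fun j => (S j j : ℂ) := by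
    ext i
    simp [mulVec, dotProduct, hM]
  have hΨ : ∀ z, (∀ D ∈ Submodule.span ℝ (Set.range fun i => diagonal (W i)),
      trace ((Ψ z - complexify S) * complexify D) = 0) ↔
      M *ᵥ (fun j => (vecMul z M j)⁻¹) = M *ᵥ fun j => (S j j : ℂ) := fun z => by
    rw [forall_trace_eq_zero_iff, ← hM, ← sub_eq_zero (b := M *ᵥ fun j => (S j j : ℂ)),
      ← mulVec_sub]
    have : (fun j => (Ψ z - complexify S) j j) =
        (fun j => (vecMul z M j)⁻¹) - fun j => (S j j : ℂ) := by
      ext j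
      simp [Ψ, complexify]
    rw [this]
  rw [← hinj.encard_image, hv]
  congr 1
  ext T
  constructor
  · rintro ⟨-, ⟨K, hK, hTK⟩, hT⟩
    obtain ⟨z, rfl⟩ := mem_span_complexify_iff.1 hK
    rw [← hM] at hTK
    have hne : ∀ j, vecMul z M j ≠ 0 := fun j hj => by
      have h1 := congrFun (congrFun hTK j) j
      rw [mul_diagonal, hj, mul_zero, one_apply_eq] at h1
      exact zero_ne_one h1
    have hTz : T = Ψ z := by
      have h1 : diagonal (vecMul z M) * Ψ z = 1 := by
        rw [diagonal_mul_diagonal, ← diagonal_one]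
        congr 1
        ext j
        exact mul_inv_cancel₀ (hne j)
      calc T = T * (diagonal (vecMul z M) * Ψ z) := by rw [h1, mul_one]
        _ = Ψ z := by rw [← mul_assoc, hTK, one_mul]
    subst hTz
    exact ⟨z, ⟨hne, (hΨ z).1 hT⟩, rfl⟩
  · rintro ⟨z, ⟨hne, hz⟩, rfl⟩
    refine ⟨isSymm_diagonal _, ⟨_, mem_span_complexify_iff.2 ⟨z, rfl⟩, ?_⟩, (hΨ z).2 hz⟩
    rw [← hM, diagonal_mul_diagonal, ← diagonal_one]
    congr 1
    ext j
    exact inv_mul_cancel₀ (hne j)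

/-- For generic `s`, the vector `W s` is no combination of `d` columns of `W`. -/
theorem forGeneric_card_le_of_mulVec {d : ℕ} (hdm : d < m) {W : Matrix (Fin (d + 1)) (Fin m) ℝ}
    (hW : MaxMinorsNeZero W) : ForGeneric fun s : Sym2 (Fin m) → ℝ =>
      ∀ x, W.map Complex.ofReal *ᵥ x =
          (fun i => ((W *ᵥ fun j => symmOfCoords s j j) i : ℂ)) →
        d + 1 ≤ (Finset.univ.filter fun j => x j ≠ 0).card := by
  let B : (Fin d → Fin m) → (Sym2 (Fin m) → ℝ) → Matrix (Fin (d + 1)) (Fin (d + 1)) ℝ :=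
    fun f s => Matrix.of fun i => Fin.cons ((W *ᵥ fun j => symmOfCoords s j j) i)
      fun k => W i (f k)
  have hB : ∀ f : {f : Fin d → Fin m // Function.Injective f},
      ForGeneric fun s : Sym2 (Fin m) → ℝ => (B f s).det ≠ 0 := by
    rintro ⟨f, hf⟩
    let Q : Matrix (Fin (d + 1)) (Fin (d + 1)) (MvPolynomial (Sym2 (Fin m)) ℝ) :=
      Matrix.of fun i => Fin.cons (∑ j, C (W i j) * X s(j, j)) fun k => C (W i (f k))
    have hQ : ∀ s, eval s Q.det = (B f s).det := fun s => by
      rw [RingHom.map_det]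
      congr 1
      ext i k
      refine Fin.cases ?_ (fun k => ?_) k
      · simp [Q, B, mulVec, dotProduct, symmOfCoords]
      · simp [Q, B]
    refine ⟨Q.det, fun h => ?_, fun s hs => (hQ s).symm.trans_ne hs⟩
    -- If `s` is a unit vector, the determinant is a maximal minor.
    obtain ⟨j₀, hj₀⟩ : ∃ j₀, j₀ ∉ Set.range f := by
      by_contra! hsurj
      have := Fintype.card_le_of_surjective f hsurj
      simp at this
      omega
    have h1 := hQ (Pi.single s(j₀, j₀) 1)
    rw [h, map_zero] at h1
    refine hW (Fin.cons j₀ f) (Fin.cons_injective_iff.2 ⟨hj₀, hf⟩) ?_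
    rw [h1]
    congr 1
    ext i k
    refine Fin.cases ?_ (fun k => ?_) k
    · have h2 : (fun j => symmOfCoords (Pi.single s(j₀, j₀) 1) j j) = Pi.single j₀ (1 : ℝ) := by
        ext j
        simp [symmOfCoords, Pi.single_apply]
      simp [B, h2]
    · simp [B]
  refine (ForGeneric.forall hB).mono fun s hs x hx => ?_
  by_contra! hcard
  obtain ⟨f, hf, hfS⟩ := Finset.exists_injective_forall_mem_range (Nat.lt_succ_iff.1 hcard) hdm.le
  rw [mulVec_eq_submatrix_mulVec _ hf fun j hj => hfS j (by simpa using hj)] at hx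
  have hdet : ((B f s).map Complex.ofReal).det ≠ 0 := by
    have h1 := RingHom.map_det Complex.ofRealHom (B f s)
    have h2 : Complex.ofRealHom.mapMatrix (B f s) = (B f s).map Complex.ofReal := rfl
    rw [← h2, ← h1]
    exact Complex.ofReal_ne_zero.2 (hs ⟨f, hf⟩)
  have h1 : (Fin.cons 1 (-(x ∘ f)) : Fin (d + 1) → ℂ) = 0 := by
    refine eq_zero_of_mulVec_eq_zero hdet ?_
    ext i
    have h2 := congrFun hx i
    simp only [mulVec, dotProduct] at h2
    simp only [mulVec, dotProduct, Fin.sum_univ_succ]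
    simp only [B, map_apply, of_apply, Fin.cons_zero, Fin.cons_succ, Pi.neg_apply, mul_neg,
      Finset.sum_neg_distrib, mul_one, Pi.zero_apply, mulVec, dotProduct]
    rw [← h2]
    simp
  exact one_ne_zero (congrFun h1 0)

/-- The ML degree of a generic diagonal model is the number of points of a generic section. -/
theorem isGenericDiagonalMLDegree_iff {d : ℕ} (hdm : d < m) {n : ℕ} {F : CutRing m d} (hF0 : F ≠ 0)
    (hF : ∀ p, eval p F ≠ 0 → (centralSection p).encard = n) (k : ℕ) :
    IsGenericDiagonalMLDegree m (d + 1) k ↔ k = n := by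
  have hn : IsGenericDiagonalMLDegree m (d + 1) n := by
    refine (forGeneric_encard_reciprocalSolutions hdm hF0 hF).mono ?_
    rintro w ⟨hW, hw⟩
    refine (forGeneric_card_le_of_mulVec hdm hW).mono fun s hs => ?_
    rw [← hw _ hs]
    exact encard_likelihoodSolutions hdm hW _
  refine ⟨fun hk => ?_, fun h => h ▸ hn⟩
  obtain ⟨w, hw1, hw2⟩ := (hk.and hn).exists
  obtain ⟨s, hs1, hs2⟩ := (hw1.and hw2).exists
  rw [hs1] at hs2
  exact_mod_cast hs2

end Likelihood

/-- For `d < m`, the generic central curve degree `ψ_LP(m, d)` and the generic diagonal ML degree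
`φ_diag(m, d + 1)` are well defined (exist and are unique) and are equal. -/
theorem mainTheorem9 (m d : ℕ) (hdm : d < m) :
    ∃ n : ℕ, (∀ k : ℕ, IsGenericCentralCurveDegree m d k ↔ k = n) ∧
      (∀ k : ℕ, IsGenericDiagonalMLDegree m (d + 1) k ↔ k = n) := by
  obtain ⟨n, F, hF0, hF⟩ := exists_generic_centralSection hdm
  exact ⟨n, isGenericCentralCurveDegree_iff hdm (exists_generic_centralCurveDegree hdm hF0 hF),
    isGenericDiagonalMLDegree_iff hdm hF0 fun p hp => (hF p hp).1⟩
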